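/- Let $d\in\{1,2,3\}$ and let all derivatives be weak derivatives. For $\beta,\delta\in\mathbb R$, an open set $\Omega\subseteq\mathbb R^d$ and a locally integrable potential $V\ge 0$ on $\Omega$, put $$E_\Omega(\phi)=\int_\Omega\Big[\tfrac12|\nabla\phi|^2+V|\phi|^2+\tfrac{\beta}{2}|\phi|^4+\tfrac{\delta}{2}\big|\nabla|\phi|^2\big|^2\Big]dx ,$$ and let $S_\Omega$ be the set of complex-valued $\phi\in H^1(\Omega)$ with $\int_\Omega V|\phi|^2<\infty$, $\int_\Omega|\phi|^2=1$ and finite energy (the energy density is integrable on $\Omega$). Functions are identified if they agree almost everywhere. **(i) Whole space.** Let $\delta\neq0$, $\beta\in\mathbb R$, and let $V:\mathbb R^d\to[0,\infty)$ be locally integrable and confining, i.e. $\lim_{|x|\to\infty}V(x)=\infty$. A ground state is a minimizer of $E_{\mathbb R^d}$ over $S_{\mathbb R^d}$. Then: - a ground state exists if and only if $\delta>0$; - if $\phi_g$ is a ground state, then $e^{i\theta}\phi_g$ is a ground state for every real $\theta$; - if $\phi_g$ is a ground state, then the nonnegative function $|\phi_g|$ is a ground state; - if $\beta\ge0$, any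 two nonnegative ground states coincide. **(ii) Bounded domains.** Let $\Omega\subset\mathbb R^d$ be a nonempty bounded connected open set. There is a constant $C_\Omega>0$, depending only on $\Omega$, such that for all $\delta>0$, all $\beta>-\delta/C_\Omega$ and all locally integrable $V:\Omega\to[0,\infty)$ there is exactly one nonnegative minimizer of $E_\Omega$ over $S_\Omega\cap H^1_0(\Omega)$, where $H_0^1(\Omega)$ is the closure of $C_c^\infty(\Omega)$ in $H^1(\Omega)$ (zero Dirichlet boundary conditions). -/

import Mathlib

open MeasureTheory Filter Topology
open scoped ContDiff

noncomputable section

namespace MGPE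

/-- The Euclidean space `ℝ^d`. -/
abbrev Space (d : ℕ) : Type := EuclideanSpace ℝ (Fin d)

variable {d : ℕ} {F : Type*} [NormedAddCommGroup F] [NormedSpace ℝ F]

/-- `g` is a weak (distributional) `i`-th partial derivative of `f` on the open set `Ω`:
both are locally integrable on `Ω` and `∫_Ω (∂ᵢ ψ) f = - ∫_Ω ψ g` for all `ψ ∈ C_c^∞(Ω)`. -/
def HasWeakPartial (Ω : Set (Space d)) (f : Space d → F) (i : Fin d) (g : Space d → F) : Prop :=
  LocallyIntegrableOn f Ω ∧ LocallyIntegrableOn g Ω ∧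
    ∀ ψ : Space d → ℝ, ContDiff ℝ ∞ ψ → HasCompactSupport ψ → tsupport ψ ⊆ Ω →
      ∫ x in Ω, (fderiv ℝ ψ x (EuclideanSpace.single i 1)) • f x = - ∫ x in Ω, ψ x • g x

open Classical in
/-- The weak partial derivative `∂ᵢ f` on `Ω` (a representative of its a.e. class, which is
unique by `HasWeakPartial.ae_eq`; the value is `0` if there is no weak derivative). -/
def weakPartial (Ω : Set (Space d)) (f : Space d → F) (i : Fin d) : Space d → F :=
  if h : ∃ g, HasWeakPartial Ω f i g then h.choose else 0

/-- `|∇f(x)|² = ∑ᵢ |∂ᵢ f(x)|²`, with weak derivatives on `Ω`. -/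
def gradSq (Ω : Set (Space d)) (f : Space d → F) (x : Space d) : ℝ :=
  ∑ i, ‖weakPartial Ω f i x‖ ^ 2

/-- Weak derivatives on an open set are unique almost everywhere. -/
theorem HasWeakPartial.ae_eq [CompleteSpace F] {Ω : Set (Space d)} (hΩ : IsOpen Ω)
    {f : Space d → F} {i : Fin d} {g₁ g₂ : Space d → F} (h₁ : HasWeakPartial Ω f i g₁)
    (h₂ : HasWeakPartial Ω f i g₂) : ∀ᵐ x ∂(volume.restrict Ω), g₁ x = g₂ x := by
  have key : ∀ g : Space d → F, LocallyIntegrableOn g Ω → ∀ ψ : Space d → ℝ, ContDiff ℝ ∞ ψ →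
      HasCompactSupport ψ → tsupport ψ ⊆ Ω → Integrable (fun x => ψ x • g x) := by
    intro g hg ψ hψ hc hs
    have hK : IntegrableOn (fun x => ψ x • g x) (tsupport ψ) :=
      (hg.integrableOn_compact_subset hs hc).continuousOn_smul hψ.continuous.continuousOn hc
    refine (integrableOn_iff_integrable_of_support_subset fun x hx => ?_).mp hK
    by_contra h
    exact hx (by simp [image_eq_zero_of_notMem_tsupport h])
  have h0 : ∀ᵐ x, x ∈ Ω → g₁ x - g₂ x = 0 := by
    refine hΩ.ae_eq_zero_of_integral_contDiff_smul_eq_zero (h₁.2.1.sub h₂.2.1) ?_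
    intro ψ hψ hc hs
    have e₁ := h₁.2.2 ψ hψ hc hs
    have e₂ := h₂.2.2 ψ hψ hc hs
    have e : ∫ x in Ω, ψ x • g₁ x = ∫ x in Ω, ψ x • g₂ x := neg_injective (e₁.symm.trans e₂)
    have hz : ∀ g : Space d → F, ∀ x, x ∉ Ω → ψ x • g x = 0 := fun g x hx => by
      rw [image_eq_zero_of_notMem_tsupport (fun h => hx (hs h)), zero_smul]
    rw [setIntegral_eq_integral_of_forall_compl_eq_zero (hz g₁),
      setIntegral_eq_integral_of_forall_compl_eq_zero (hz g₂)] at e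
    simp only [smul_sub]
    rw [integral_sub (key _ h₁.2.1 ψ hψ hc hs) (key _ h₂.2.1 ψ hψ hc hs), e, sub_self]
  rw [ae_restrict_iff' hΩ.measurableSet]
  filter_upwards [h0] with x hx hxΩ
  exact sub_eq_zero.mp (hx hxΩ)

/-- The Sobolev space `H¹(Ω)` of complex-valued functions. -/
def MemH1 (Ω : Set (Space d)) (φ : Space d → ℂ) : Prop :=
  MemLp φ 2 (volume.restrict Ω) ∧
    ∀ i, ∃ g, HasWeakPartial Ω φ i g ∧ MemLp g 2 (volume.restrict Ω)

/-- The Sobolev space `H¹₀(Ω)`: the closure of `C_c^∞(Ω)` in `H¹(Ω)`. -/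
def MemH10 (Ω : Set (Space d)) (φ : Space d → ℂ) : Prop :=
  MemH1 Ω φ ∧ ∃ u : ℕ → Space d → ℂ,
    (∀ n, ContDiff ℝ ∞ (u n) ∧ HasCompactSupport (u n) ∧ tsupport (u n) ⊆ Ω) ∧
    Tendsto (fun n => eLpNorm (fun x => u n x - φ x) 2 (volume.restrict Ω)) atTop (𝓝 0) ∧
    ∀ i, Tendsto (fun n => eLpNorm
      (fun x => fderiv ℝ (u n) x (EuclideanSpace.single i 1) - weakPartial Ω φ i x) 2
      (volume.restrict Ω)) atTop (𝓝 0)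

/-- The energy density
`½|∇φ|² + V|φ|² + (β/2)|φ|⁴ + (δ/2)|∇|φ|²|²`, with weak derivatives on `Ω`. -/
def energyDensity (Ω : Set (Space d)) (V : Space d → ℝ) (β δ : ℝ) (φ : Space d → ℂ)
    (x : Space d) : ℝ :=
  1 / 2 * gradSq Ω φ x + V x * ‖φ x‖ ^ 2 + β / 2 * ‖φ x‖ ^ 4
    + δ / 2 * gradSq Ω (fun y => ‖φ y‖ ^ 2) x

/-- The energy `E(φ)` of the modified Gross-Pitaevskii equation on `Ω`. -/
def energy (Ω : Set (Space d)) (V : Space d → ℝ) (β δ : ℝ) (φ : Space d → ℂ) : ℝ :=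
  ∫ x in Ω, energyDensity Ω V β δ φ x

/-- The space `X` on `Ω`: functions in `H¹(Ω)` with `∫_Ω V|φ|² < ∞`. -/
def MemX (Ω : Set (Space d)) (V : Space d → ℝ) (φ : Space d → ℂ) : Prop :=
  MemH1 Ω φ ∧ IntegrableOn (fun x => V x * ‖φ x‖ ^ 2) Ω

/-- The constraint set `S` on `Ω`: functions in `X` with unit `L²` norm and finite energy. -/
def constraintSet (Ω : Set (Space d)) (V : Space d → ℝ) (β δ : ℝ) : Set (Space d → ℂ) :=
  {φ | MemX Ω V φ ∧ ∫ x in Ω, ‖φ x‖ ^ 2 = 1 ∧ IntegrableOn (energyDensity Ω V β δ φ) Ω}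

/-- Ground states on the whole space: minimizers of the energy over `S`. -/
def IsGroundState (V : Space d → ℝ) (β δ : ℝ) (φ : Space d → ℂ) : Prop :=
  φ ∈ constraintSet Set.univ V β δ ∧
    ∀ χ ∈ constraintSet Set.univ V β δ, energy Set.univ V β δ φ ≤ energy Set.univ V β δ χ

/-- Ground states on `Ω` with zero Dirichlet boundary conditions: minimizers of the energy over
the functions in `H¹₀(Ω)` which satisfy the constraints. -/
def IsDirichletGroundState (Ω : Set (Space d)) (V : Space d → ℝ) (β δ : ℝ)
    (φ : Space d → ℂ) : Prop :=
  (φ ∈ constraintSet Ω V β δ ∧ MemH10 Ω φ) ∧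
    ∀ χ ∈ constraintSet Ω V β δ, MemH10 Ω χ → energy Ω V β δ φ ≤ energy Ω V β δ χ

/-- `φ` is (a.e. on `Ω`) real-valued and nonnegative. -/
def IsNonneg (Ω : Set (Space d)) (φ : Space d → ℂ) : Prop :=
  ∀ᵐ x ∂(volume.restrict Ω), 0 ≤ (φ x).re ∧ (φ x).im = 0

end MGPE

end

open MeasureTheory Filter Topology
open scoped ContDiff ENNReal

set_option linter.unusedSectionVars false

noncomputable section

namespace MGPE

variable {d : ℕ} {E : Type*} [NormedAddCommGroup E] [InnerProductSpace ℝ E]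
  [FiniteDimensional ℝ E] {E' : Type*} [NormedAddCommGroup E'] [InnerProductSpace ℝ E']
  [FiniteDimensional ℝ E']

/-! ### Square integrals -/

/-! The energy is a convex function of the density `ρ = |φ|²` as soon as the quadratic form `β‖ρ‖² +
δ‖∇ρ‖²` is positive. The potential term is linear in `ρ`. The kinetic term is convex because
`√((|φ₁|² + |φ₂|²)/2)` is the length of the vector `(φ₁, φ₂)/√2`, and taking the length of a
vector-valued Sobolev function does not increase its Dirichlet integral. The other two terms are
quadratic in `ρ`, so the parallelogram identity gives the exact convexity defect
(`Admissible.rootMean`). Two minimizers make this defect nonpositive. Their densities then agree,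
provided the form is definite: for `β ≥ 0` because an integrable function with zero gradient
vanishes, and on a bounded domain for `β > -δ/C` by Poincaré's inequality with constant `C`. Applied
to a single function, the same argument shows that `|φ|` has no more energy than `φ`.

Existence is the direct method (`SobolevClass.exists_minimizer`). The basic tool is the Nash
inequality `‖u‖₂² ≤ r²‖∇u‖₂² + (2/|B_r|)‖u‖₁²`, valid in every dimension. Applied to `ρ`, whose `L¹`
norm is one, it absorbs the quartic term into the `δ` term, whatever the sign of `β`. This gives
coercivity and, after truncation, shows that finite total energy makes every term finite
(`IsSobolev.admissible`). Rellich's theorem together with the confining potential gives strong `L²`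
limits of minimizing sequences. Nash once more turns `L¹` convergence of the densities into `L²`
convergence, so the quartic term passes to the limit, while the other terms are lower
semicontinuous.

If `δ < 0`, concentrating a test function by `s^(d/2) φ(s x)` makes the `δ` term grow like
`s^(d+2)`, faster than all the others, so the energy is unbounded below (`exists_energy_lt`).

A bounded domain is reduced to the whole space: functions in `H¹₀(Ω)` are extended by zero, and the
potential by `|x|` outside `Ω`, which makes it confining (`isDirichletGroundState_iff`).
Minimization then runs over the closure of the test functions, which is weakly closed and stable
under the mean of densities. -/

theorem eLpNorm_two_sq {α F : Type*} [MeasurableSpace α] [NormedAddCommGroup F] (μ : Measure α)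
    (f : α → F) : eLpNorm f 2 μ ^ 2 = ∫⁻ x, ‖f x‖ₑ ^ 2 ∂μ := by
  have := eLpNorm_nnreal_pow_eq_lintegral (f := f) (μ := μ) (p := 2) (by norm_num)
  simpa using this

theorem memLp_two_iff_lintegral {α F : Type*} [MeasurableSpace α] [NormedAddCommGroup F]
    {μ : Measure α} {f : α → F} :
    MemLp f 2 μ ↔ AEStronglyMeasurable f μ ∧ ∫⁻ x, ‖f x‖ₑ ^ 2 ∂μ < ⊤ := by
  rw [MemLp, ← eLpNorm_two_sq, ENNReal.pow_lt_top_iff]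
  simp

theorem tendsto_eLpNorm_two_zero_iff {ι α F : Type*} [MeasurableSpace α] [NormedAddCommGroup F]
    {μ : Measure α} {f : ι → α → F} {l : Filter ι} :
    Tendsto (fun n => eLpNorm (f n) 2 μ) l (𝓝 0) ↔
      Tendsto (fun n => ∫⁻ x, ‖f n x‖ₑ ^ 2 ∂μ) l (𝓝 0) := by
  simp_rw [← eLpNorm_two_sq]
  constructor
  · intro h
    simpa using ENNReal.Tendsto.pow (n := 2) h
  · intro h
    have := (ENNReal.continuous_rpow_const (y := (1 / 2 : ℝ))).tendsto _ |>.comp h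
    simp only [Function.comp_def, ← ENNReal.rpow_natCast, ← ENNReal.rpow_mul] at this
    simpa using this

theorem lintegral_enorm_sq {α F : Type*} [MeasurableSpace α] [NormedAddCommGroup F]
    {μ : Measure α} {f : α → F} (hf : MemLp f 2 μ) :
    ∫⁻ x, ‖f x‖ₑ ^ 2 ∂μ = ENNReal.ofReal (∫ x, ‖f x‖ ^ 2 ∂μ) := by
  rw [ofReal_integral_eq_lintegral_ofReal (hf.integrable_norm_pow two_ne_zero)
    (Eventually.of_forall fun x => by positivity)]
  refine lintegral_congr fun x => ?_
  rw [ENNReal.ofReal_pow (norm_nonneg _), ofReal_norm]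

/-- Cauchy–Schwarz with a weight. -/
theorem sq_lintegral_mul_le {α : Type*} [MeasurableSpace α] {μ : Measure α} {a b : α → ℝ≥0∞}
    (ha : AEMeasurable a μ) (hb : AEMeasurable b μ) :
    (∫⁻ x, a x * b x ∂μ) ^ 2 ≤ (∫⁻ x, b x ∂μ) * ∫⁻ x, a x ^ 2 * b x ∂μ := by
  -- Hölder for the splitting `a b = √b · (a √b)`.
  have h := ENNReal.lintegral_mul_le_Lp_mul_Lq μ Real.HolderConjugate.two_two
    (f := fun x => b x ^ (1 / 2 : ℝ)) (g := fun x => a x * b x ^ (1 / 2 : ℝ))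
    (hb.pow_const _) (ha.mul (hb.pow_const _))
  have hs : ∀ t : ℝ≥0∞, t ^ (1 / 2 : ℝ) * t ^ (1 / 2 : ℝ) = t := fun t => by
    rw [← ENNReal.rpow_add_of_nonneg _ _ (by norm_num) (by norm_num)]; norm_num
  have hs2 : ∀ t : ℝ≥0∞, (t ^ (1 / 2 : ℝ)) ^ 2 = t := fun t => by rw [sq, hs]
  have e1 : ∀ x, ((fun x => b x ^ (1 / 2 : ℝ)) * fun x => a x * b x ^ (1 / 2 : ℝ)) x
      = a x * b x := fun x => by
    simp only [Pi.mul_apply]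
    rw [mul_left_comm, hs]
  simp only [e1, ENNReal.rpow_two, hs2, mul_pow] at h
  calc (∫⁻ x, a x * b x ∂μ) ^ 2 ≤ _ := pow_le_pow_left' h 2
    _ = _ := by rw [mul_pow, hs2, hs2]

theorem sq_lintegral_le {α : Type*} [MeasurableSpace α] {μ : Measure α} {a : α → ℝ≥0∞}
    (ha : AEMeasurable a μ) :
    (∫⁻ x, a x ∂μ) ^ 2 ≤ μ Set.univ * ∫⁻ x, a x ^ 2 ∂μ := by
  simpa using sq_lintegral_mul_le (b := fun _ => 1) ha aemeasurable_const

/-- Pointwise convergence and convergence of the norms imply strong convergence in `L²`. -/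
theorem tendsto_lintegral_sub_of_ae {α : Type*} [MeasurableSpace α] {μ : Measure α}
    {f : ℕ → α → E} {g : α → E} (hf : ∀ n, AEStronglyMeasurable (f n) μ)
    (hg : MemLp g 2 μ) (hle : ∀ n, ∫⁻ x, ‖f n x‖ₑ ^ 2 ∂μ ≤ ∫⁻ x, ‖g x‖ₑ ^ 2 ∂μ)
    (hae : ∀ᵐ x ∂μ, Tendsto (fun n => f n x) atTop (𝓝 (g x))) :
    Tendsto (fun n => ∫⁻ x, ‖f n x - g x‖ₑ ^ 2 ∂μ) atTop (𝓝 0) := by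
  set A := ∫⁻ x, ‖g x‖ₑ ^ 2 ∂μ with hA
  have hAt : A < ⊤ := (memLp_two_iff_lintegral.1 hg).2
  have hpar : ∀ v w : E, ‖v - w‖ₑ ^ 2 + ‖v + w‖ₑ ^ 2 = 2 * ‖v‖ₑ ^ 2 + 2 * ‖w‖ₑ ^ 2 := by
    intro v w
    simp only [← ofReal_norm, ← ENNReal.ofReal_pow (norm_nonneg _)]
    rw [← ENNReal.ofReal_add (by positivity) (by positivity),
      show (2 : ℝ≥0∞) = ENNReal.ofReal 2 by simp, ← ENNReal.ofReal_mul (by positivity),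
      ← ENNReal.ofReal_mul (by positivity), ← ENNReal.ofReal_add (by positivity) (by positivity)]
    congr 1
    have := parallelogram_law_with_norm ℝ v w
    nlinarith
  -- By the parallelogram law `∫|f n - g|²` is at most `4A - ∫|f n + g|²`, and Fatou's lemma bounds
  -- the lower limit of the subtracted integral below by `4A`.
  have hsum : ∀ n, (∫⁻ x, ‖f n x - g x‖ₑ ^ 2 ∂μ) + ∫⁻ x, ‖f n x + g x‖ₑ ^ 2 ∂μ ≤ 4 * A := by
    intro n
    have m1 : AEMeasurable (fun x => ‖f n x‖ₑ ^ 2) μ := (hf n).enorm.pow_const _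
    have m2 : AEMeasurable (fun x => ‖g x‖ₑ ^ 2) μ := hg.1.enorm.pow_const _
    have m3 : AEMeasurable (fun x => ‖f n x - g x‖ₑ ^ 2) μ := ((hf n).sub hg.1).enorm.pow_const _
    rw [← lintegral_add_left' m3]
    simp only [hpar]
    rw [lintegral_add_left' (m1.const_mul _), lintegral_const_mul'' _ m1,
      lintegral_const_mul'' _ m2]
    calc _ ≤ 2 * A + 2 * A := by gcongr; exact hle n
      _ = _ := by ring
  have hlim : 4 * A ≤ liminf (fun n => ∫⁻ x, ‖f n x + g x‖ₑ ^ 2 ∂μ) atTop := by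
    calc 4 * A = ∫⁻ x, ‖g x + g x‖ₑ ^ 2 ∂μ := by
          rw [hA, ← lintegral_const_mul'' _ (hg.1.enorm.pow_const _)]
          refine lintegral_congr fun x => ?_
          rw [← two_smul ℝ (g x), enorm_smul, mul_pow]
          congr 1
          simp [← ofReal_norm]
          norm_num
      _ ≤ ∫⁻ x, liminf (fun n => ‖f n x + g x‖ₑ ^ 2) atTop ∂μ := by
          refine lintegral_mono_ae ?_
          filter_upwards [hae] with x hx
          have h1 : Tendsto (fun n => ‖f n x + g x‖ₑ ^ 2) atTop (𝓝 (‖g x + g x‖ₑ ^ 2)) :=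
            ENNReal.Tendsto.pow (hx.add_const _).enorm
          rw [h1.liminf_eq]
      _ ≤ _ := lintegral_liminf_le' fun n => ((hf n).add hg.1).enorm.pow_const _
  rw [ENNReal.tendsto_nhds_zero]
  intro ε hε
  -- The strict inequality `4 * A - ε < 4 * A` used below needs `A ≠ 0`.
  rcases eq_or_ne A 0 with h0 | h0
  · refine Eventually.of_forall fun n => ?_
    have := hsum n
    rw [h0, mul_zero, nonpos_iff_eq_zero, add_eq_zero] at this
    rw [this.1]; exact zero_le
  have h4 : 4 * A ≠ ⊤ := ENNReal.mul_ne_top (by norm_num) hAt.ne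
  have hlt : 4 * A - ε < liminf (fun n => ∫⁻ x, ‖f n x + g x‖ₑ ^ 2 ∂μ) atTop :=
    lt_of_lt_of_le (ENNReal.sub_lt_self h4 (by simp [h0]) hε.ne') hlim
  filter_upwards [eventually_lt_of_lt_liminf hlt] with n hn
  have h1 := hsum n
  have h2 : 4 * A ≤ ε + ∫⁻ x, ‖f n x + g x‖ₑ ^ 2 ∂μ := by
    rw [add_comm]; exact tsub_le_iff_right.1 hn.le
  have h3 : ∫⁻ x, ‖f n x + g x‖ₑ ^ 2 ∂μ ≠ ⊤ := ne_top_of_le_ne_top h4 (le_add_self.trans h1)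
  exact (ENNReal.add_le_add_iff_right h3).1 (h1.trans h2)

/-! ### Sobolev functions on the whole space and mollification -/

/-- `f ∈ H¹(ℝ^d)`, with weak gradient `g`. -/
structure IsSobolev (f : Space d → E) (g : Fin d → Space d → E) : Prop where
  memLp : MemLp f 2
  memLp_grad : ∀ i, MemLp (g i) 2
  integral_eq : ∀ (i : Fin d) (ψ : Space d → ℝ), ContDiff ℝ ∞ ψ → HasCompactSupport ψ →
    ∫ x, (fderiv ℝ ψ x (EuclideanSpace.single i 1)) • f x = - ∫ x, ψ x • g i x

theorem _root_.MeasureTheory.MemLp.locallyIntegrable_two {f : Space d → E} (hf : MemLp f 2) :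
    LocallyIntegrable f := hf.locallyIntegrable (by norm_num)

theorem IsSobolev.hasWeakPartial {f : Space d → E} {g : Fin d → Space d → E}
    (h : IsSobolev f g) (i : Fin d) : HasWeakPartial Set.univ f i (g i) := by
  refine ⟨h.memLp.locallyIntegrable_two.locallyIntegrableOn _,
    (h.memLp_grad i).locallyIntegrable_two.locallyIntegrableOn _, fun ψ h1 h2 _ => ?_⟩
  simpa using h.integral_eq i ψ h1 h2

theorem IsSobolev.of_hasWeakPartial {f : Space d → E} {g : Fin d → Space d → E}
    (hf : MemLp f 2) (hg : ∀ i, MemLp (g i) 2) (h : ∀ i, HasWeakPartial Set.univ f i (g i)) :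
    IsSobolev f g := by
  refine ⟨hf, hg, fun i ψ h1 h2 => ?_⟩
  simpa using (h i).2.2 ψ h1 h2 (Set.subset_univ _)

/-- A sequence of bump functions whose supports shrink to the origin. -/
def mollBump (d n : ℕ) : ContDiffBump (0 : Space d) where
  rIn := 1 / (2 * (n + 1))
  rOut := 1 / (n + 1)
  rIn_pos := by positivity
  rIn_lt_rOut := by
    have : (0 : ℝ) < n + 1 := by positivity
    exact one_div_lt_one_div_of_lt this (by linarith)

/-- The mollification of a function at scale `1 / (n + 1)`. -/
def moll (n : ℕ) (f : Space d → E) : Space d → E :=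
  convolution ((mollBump d n).normed volume) f (ContinuousLinearMap.lsmul ℝ ℝ) volume

theorem moll_apply (n : ℕ) (f : Space d → E) (x : Space d) :
    moll n f x = ∫ t, (mollBump d n).normed volume t • f (x - t) := rfl

theorem tendsto_moll_ae {f : Space d → E} (hf : LocallyIntegrable f) :
    ∀ᵐ x, Tendsto (fun n => moll n f x) atTop (𝓝 (f x)) := by
  -- The outer radius is exactly twice the inner one, hence `K := 2`.
  refine ContDiffBump.ae_convolution_tendsto_right_of_locallyIntegrable (K := 2) ?_ ?_ hf
  · exact tendsto_one_div_add_atTop_nhds_zero_nat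
  · refine Eventually.of_forall fun n => ?_
    simp only [mollBump]
    rw [one_div, one_div, mul_inv]
    linarith

theorem contDiff_moll (n : ℕ) {f : Space d → E} (hf : LocallyIntegrable f) :
    ContDiff ℝ ∞ (moll n f) :=
  HasCompactSupport.contDiff_convolution_left _ (mollBump d n).hasCompactSupport_normed
    (mollBump d n).contDiff_normed hf

/-- Young's inequality for a probability kernel: Cauchy–Schwarz against the bump at each point, then
Tonelli and translation invariance. -/
theorem lintegral_moll_sq_le (n : ℕ) {f : Space d → E} (hf : AEStronglyMeasurable f) :
    ∫⁻ x, ‖moll n f x‖ₑ ^ 2 ≤ ∫⁻ x, ‖f x‖ₑ ^ 2 := by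
  set η := (mollBump d n).normed volume with hη
  have hηc : Continuous η := (mollBump d n).continuous_normed
  have hη1 : ∫⁻ t, ‖η t‖ₑ = 1 := by
    rw [← ofReal_integral_norm_eq_lintegral_enorm (mollBump d n).integrable_normed]
    simp_rw [Real.norm_of_nonneg ((mollBump d n).nonneg_normed _)]
    rw [(mollBump d n).integral_normed]; simp
  have hm : AEMeasurable (fun p : Space d × Space d => ‖f (p.1 - p.2)‖ₑ ^ 2 * ‖η p.2‖ₑ)
      (volume.prod volume) := by
    refine ((hf.comp_quasiMeasurePreserving
      (quasiMeasurePreserving_sub volume volume)).enorm.pow_const 2).mul ?_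
    exact (hηc.comp continuous_snd).enorm.measurable.aemeasurable
  have hfx : ∀ x, AEMeasurable (fun t => ‖f (x - t)‖ₑ) volume := fun x =>
    (hf.comp_measurePreserving (Measure.measurePreserving_sub_left volume x)).enorm
  calc ∫⁻ x, ‖moll n f x‖ₑ ^ 2
      ≤ ∫⁻ x, ∫⁻ t, ‖f (x - t)‖ₑ ^ 2 * ‖η t‖ₑ := by
        refine lintegral_mono fun x => ?_
        calc ‖moll n f x‖ₑ ^ 2 ≤ (∫⁻ t, ‖f (x - t)‖ₑ * ‖η t‖ₑ) ^ 2 := by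
              gcongr
              rw [moll_apply]
              refine (enorm_integral_le_lintegral_enorm _).trans_eq ?_
              refine lintegral_congr fun t => ?_
              rw [enorm_smul, mul_comm]
          _ ≤ _ := by
              refine (sq_lintegral_mul_le (hfx x) hηc.enorm.measurable.aemeasurable).trans_eq ?_
              rw [hη1, one_mul]
    _ = ∫⁻ t, ∫⁻ x, ‖f (x - t)‖ₑ ^ 2 * ‖η t‖ₑ := lintegral_lintegral_swap hm
    _ = ∫⁻ t, (∫⁻ x, ‖f x‖ₑ ^ 2) * ‖η t‖ₑ := by
        refine lintegral_congr fun t => ?_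
        rw [lintegral_mul_const' _ _ (by simp)]
        congr 1
        exact lintegral_sub_right_eq_self (fun x => ‖f x‖ₑ ^ 2) t
    _ = _ := by
        rw [lintegral_const_mul _ hηc.enorm.measurable, hη1, mul_one]

theorem memLp_moll (n : ℕ) {f : Space d → E} (hf : MemLp f 2) : MemLp (moll n f) 2 := by
  rw [memLp_two_iff_lintegral]
  exact ⟨(contDiff_moll n hf.locallyIntegrable_two).continuous.aestronglyMeasurable,
    (lintegral_moll_sq_le n hf.1).trans_lt (memLp_two_iff_lintegral.1 hf).2⟩

/-- Mollification converges almost everywhere and does not increase the norm, which together force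
strong convergence. -/
theorem tendsto_moll {f : Space d → E} (hf : MemLp f 2) :
    Tendsto (fun n => ∫⁻ x, ‖moll n f x - f x‖ₑ ^ 2) atTop (𝓝 0) :=
  tendsto_lintegral_sub_of_ae (fun n => (memLp_moll n hf).1) hf
    (fun n => lintegral_moll_sq_le n hf.1) (tendsto_moll_ae hf.locallyIntegrable_two)

/-- The derivative falls on the bump. Since `t ↦ η (x - t)` is itself a test function, the weak
formulation moves the derivative onto `f`; the sign of the reflection cancels that of the
integration by parts. -/
theorem fderiv_moll {f : Space d → E} {g : Fin d → Space d → E} (h : IsSobolev f g) (n : ℕ)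
    (i : Fin d) (x : Space d) :
    fderiv ℝ (moll n f) x (EuclideanSpace.single i 1) = moll n (g i) x := by
  set η := (mollBump d n).normed volume with hη
  have hηs : ContDiff ℝ ∞ η := (mollBump d n).contDiff_normed
  have hηc : HasCompactSupport η := (mollBump d n).hasCompactSupport_normed
  have hd := HasCompactSupport.hasFDerivAt_convolution_left (ContinuousLinearMap.lsmul ℝ ℝ)
    hηc (hηs.of_le (by simp)) h.memLp.locallyIntegrable_two x
  rw [moll, hd.fderiv, convolution_eq_swap, ContinuousLinearMap.integral_apply]
  · have hψ : ContDiff ℝ ∞ fun t => η (x - t) := hηs.comp (contDiff_const.sub contDiff_id)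
    have hψc : HasCompactSupport fun t => η (x - t) :=
      hηc.comp_homeomorph (Homeomorph.subLeft x)
    have key := h.integral_eq i _ hψ hψc
    have e : ∀ t, fderiv ℝ (fun t => η (x - t)) t = - fderiv ℝ η (x - t) := fun t => by
      have h1 := (hηs.differentiable (by simp) (x - t)).hasFDerivAt.comp t
        ((hasFDerivAt_id t).const_sub x)
      refine h1.fderiv.trans ?_
      ext; simp
    simp only [e, neg_apply, neg_smul, integral_neg, neg_inj] at key
    rw [moll, convolution_eq_swap]
    simpa using key
  · have := (hηc.fderiv ℝ).convolutionExists_left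
      (ContinuousLinearMap.precompL (Space d) (ContinuousLinearMap.lsmul ℝ ℝ (E := E)))
      (hηs.continuous_fderiv (by simp)) h.memLp.locallyIntegrable_two x (μ := volume)
    exact this.integrable_swap

/-! ### Limits under the integral sign -/

theorem tendsto_integral_smul_of_tendsto {α : Type*} [MeasurableSpace α] {μ : Measure α}
    {k : α → ℝ} (hk : MemLp k 2 μ) {h : ℕ → α → E} {h₀ : α → E} (hh : ∀ n, MemLp (h n) 2 μ)
    (hh₀ : MemLp h₀ 2 μ) (hlim : Tendsto (fun n => ∫⁻ x, ‖h n x - h₀ x‖ₑ ^ 2 ∂μ) atTop (𝓝 0)) :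
    Tendsto (fun n => ∫ x, k x • h n x ∂μ) atTop (𝓝 (∫ x, k x • h₀ x ∂μ)) := by
  rw [← tendsto_eLpNorm_two_zero_iff (f := fun n x => h n x - h₀ x)] at hlim
  refine tendsto_integral_of_L1 _ (hh₀.smul (r := 1) hk).1
    (Eventually.of_forall fun n =>
      memLp_one_iff_integrable.1 ((hh n).smul (r := 1) hk)) ?_
  refine tendsto_of_tendsto_of_tendsto_of_le_of_le (h := fun n =>
    eLpNorm k 2 μ * eLpNorm (fun x => h n x - h₀ x) 2 μ) tendsto_const_nhds ?_
    (fun n => zero_le) fun n => ?_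
  · simpa using ENNReal.Tendsto.const_mul hlim (Or.inr hk.2.ne)
  · have := eLpNorm_smul_le_mul_eLpNorm (p := 2) (q := 2) (r := 1) ((hh n).1.sub hh₀.1) hk.1
    refine le_trans (le_of_eq ?_) this
    rw [eLpNorm_one_eq_lintegral_enorm]
    simp [smul_sub]

theorem integrable_smul_two {α : Type*} [MeasurableSpace α] {μ : Measure α} {k : α → ℝ}
    {f : α → E} (hk : MemLp k 2 μ) (hf : MemLp f 2 μ) : Integrable (fun x => k x • f x) μ :=
  memLp_one_iff_integrable.1 (hf.smul (r := 1) hk)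

theorem memLp_of_continuous_hasCompactSupport {k : Space d → E} (hc : Continuous k)
    (hs : HasCompactSupport k) : MemLp k 2 :=
  hc.memLp_of_hasCompactSupport hs

theorem continuous_fderiv_apply {F : Type*} [NormedAddCommGroup F] [NormedSpace ℝ F]
    {ψ : Space d → F} (hψ : ContDiff ℝ ∞ ψ) (v : Space d) :
    Continuous fun x => fderiv ℝ ψ x v :=
  (hψ.continuous_fderiv (by simp)).clm_apply continuous_const

theorem hasCompactSupport_fderiv_apply {F : Type*} [NormedAddCommGroup F] [NormedSpace ℝ F]
    {ψ : Space d → F} (hψ : HasCompactSupport ψ) (v : Space d) :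
    HasCompactSupport fun x => fderiv ℝ ψ x v :=
  (hψ.fderiv ℝ).comp_left (g := fun L : Space d →L[ℝ] F => L v) rfl

/-- Weak derivatives pass to dominated pointwise limits. -/
theorem HasWeakPartial.of_dominated {u w : ℕ → Space d → E} {u₀ w₀ : Space d → E} {i : Fin d}
    {U W : Space d → ℝ} (h : ∀ n, HasWeakPartial Set.univ (u n) i (w n))
    (hU : LocallyIntegrable U) (hW : LocallyIntegrable W)
    (huU : ∀ n x, ‖u n x‖ ≤ U x) (hwW : ∀ n x, ‖w n x‖ ≤ W x)
    (hu : ∀ x, Tendsto (fun n => u n x) atTop (𝓝 (u₀ x)))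
    (hw : ∀ x, Tendsto (fun n => w n x) atTop (𝓝 (w₀ x))) :
    HasWeakPartial Set.univ u₀ i w₀ := by
  have hum : AEStronglyMeasurable u₀ := aestronglyMeasurable_of_tendsto_ae atTop
    (fun n => (locallyIntegrableOn_univ.1 (h n).1).aestronglyMeasurable)
    (Eventually.of_forall hu)
  have hwm : AEStronglyMeasurable w₀ := aestronglyMeasurable_of_tendsto_ae atTop
    (fun n => (locallyIntegrableOn_univ.1 (h n).2.1).aestronglyMeasurable)
    (Eventually.of_forall hw)
  have hb : ∀ {v : ℕ → Space d → E} {v₀ : Space d → E} {B : Space d → ℝ},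
      (∀ n x, ‖v n x‖ ≤ B x) → (∀ x, Tendsto (fun n => v n x) atTop (𝓝 (v₀ x))) →
      ∀ x, ‖v₀ x‖ ≤ B x := fun h1 h2 x => le_of_tendsto (h2 x).norm (Eventually.of_forall (h1 · x))
  refine ⟨locallyIntegrableOn_univ.2 (hU.mono hum (Eventually.of_forall fun x =>
    (hb huU hu x).trans (le_abs_self _))), locallyIntegrableOn_univ.2 (hW.mono hwm
    (Eventually.of_forall fun x => (hb hwW hw x).trans (le_abs_self _))), fun ψ h1 h2 h3 => ?_⟩
  have hlim : ∀ {k : Space d → ℝ} {v : ℕ → Space d → E} {v₀ : Space d → E} {B : Space d → ℝ},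
      Continuous k → HasCompactSupport k → LocallyIntegrable B →
      (∀ n, AEStronglyMeasurable (v n)) → (∀ n x, ‖v n x‖ ≤ B x) →
      (∀ x, Tendsto (fun n => v n x) atTop (𝓝 (v₀ x))) →
      Tendsto (fun n => ∫ x in Set.univ, k x • v n x) atTop (𝓝 (∫ x in Set.univ, k x • v₀ x)) := by
    intro k v v₀ B hk hk' hB hv hvB hvl
    simp only [Measure.restrict_univ]
    refine tendsto_integral_of_dominated_convergence (fun x => ‖k x‖ * B x)
      (fun n => hk.aestronglyMeasurable.smul (hv n)) ?_ ?_ ?_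
    · simpa using hB.integrable_smul_left_of_hasCompactSupport hk.norm hk'.norm
    · refine fun n => Eventually.of_forall fun x => ?_
      rw [norm_smul]
      exact mul_le_mul_of_nonneg_left (hvB n x) (norm_nonneg _)
    · exact Eventually.of_forall fun x => (hvl x).const_smul _
  refine tendsto_nhds_unique (hlim (continuous_fderiv_apply h1 _)
    (hasCompactSupport_fderiv_apply h2 _) hU
    (fun n => (locallyIntegrableOn_univ.1 (h n).1).aestronglyMeasurable) huU hu) ?_
  simp_rw [fun n => (h n).2.2 ψ h1 h2 h3]
  exact (hlim h1.continuous h2 hW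
    (fun n => (locallyIntegrableOn_univ.1 (h n).2.1).aestronglyMeasurable) hwW hw).neg

/-! ### The chain rule -/

theorem enorm_add_sq_le {F : Type*} [NormedAddCommGroup F] (a b : F) :
    ‖a + b‖ₑ ^ 2 ≤ 2 * ‖a‖ₑ ^ 2 + 2 * ‖b‖ₑ ^ 2 := by
  simp only [← ofReal_norm, ← ENNReal.ofReal_pow (norm_nonneg _)]
  rw [show (2 : ℝ≥0∞) = ENNReal.ofReal 2 by simp, ← ENNReal.ofReal_mul (by positivity),
    ← ENNReal.ofReal_mul (by positivity), ← ENNReal.ofReal_add (by positivity) (by positivity)]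
  refine ENNReal.ofReal_le_ofReal ?_
  have := norm_add_le a b
  nlinarith [sq_nonneg (‖a‖ - ‖b‖), norm_nonneg (a + b)]

theorem lipschitz_of_hasFDerivAt {F : E → E'} {F' : E → E →L[ℝ] E'} {L : ℝ}
    (hF : ∀ v, HasFDerivAt F (F' v) v) (hL : ∀ v, ‖F' v‖ ≤ L) (v w : E) :
    ‖F v - F w‖ ≤ L * ‖v - w‖ :=
  Convex.norm_image_sub_le_of_norm_hasFDerivWithin_le (fun v _ => (hF v).hasFDerivWithinAt)
    (fun v _ => hL v) convex_univ (Set.mem_univ _) (Set.mem_univ _)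

/-- The chain rule for `C¹` functions with bounded derivative. -/
theorem IsSobolev.comp {f : Space d → E} {g : Fin d → Space d → E} (h : IsSobolev f g)
    {F : E → E'} {F' : E → E →L[ℝ] E'} {L : ℝ} (hF : ∀ v, HasFDerivAt F (F' v) v)
    (hc : Continuous F') (hL : ∀ v, ‖F' v‖ ≤ L) (h0 : F 0 = 0) :
    IsSobolev (fun x => F (f x)) (fun i x => F' (f x) (g i x)) := by
  have hL0 : 0 ≤ L := (norm_nonneg _).trans (hL 0)
  have hlip := lipschitz_of_hasFDerivAt hF hL
  have hFc : Continuous F := continuous_iff_continuousAt.2 fun v => (hF v).continuousAt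
  have hmemF : ∀ {u : Space d → E}, MemLp u 2 → MemLp (fun x => F (u x)) 2 := fun {u} hu =>
    hu.of_le_mul (c := L) (hFc.comp_aestronglyMeasurable hu.1) (Eventually.of_forall fun x => by
      simpa [h0] using hlip (u x) 0)
  have hmemF' : ∀ {u v : Space d → E}, MemLp u 2 → MemLp v 2 →
      MemLp (fun x => F' (u x) (v x)) 2 := fun {u v} hu hv =>
    hv.of_le_mul (c := L)
      ((ContinuousLinearMap.id ℝ (E →L[ℝ] E')).aestronglyMeasurable_comp₂
        (hc.comp_aestronglyMeasurable hu.1) hv.1)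
      (Eventually.of_forall fun x => (F' (u x)).le_of_opNorm_le (hL _) _)
  have hf := h.memLp
  refine ⟨hmemF hf, fun i => hmemF' hf (h.memLp_grad i), fun i ψ hψ hψc => ?_⟩
  have hg := h.memLp_grad i
  set e : Space d := EuclideanSpace.single i 1 with he
  -- For the mollifications of `f` the chain rule and the integration by parts are classical; it
  -- remains to pass to the `L²` limit on both sides.
  have hcm : ∀ n, ContDiff ℝ ∞ (moll n f) := fun n => contDiff_moll n hf.locallyIntegrable_two
  have hder : ∀ n x, HasFDerivAt (fun x => F (moll n f x))
      ((F' (moll n f x)).comp (fderiv ℝ (moll n f) x)) x := fun n x =>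
    (hF _).comp x (((hcm n).differentiable (by simp)) x).hasFDerivAt
  have happ : ∀ n x, fderiv ℝ (fun x => F (moll n f x)) x e = F' (moll n f x) (moll n (g i) x) := by
    intro n x
    rw [(hder n x).fderiv, ContinuousLinearMap.comp_apply, fderiv_moll h]
  have hcg : ∀ n, Continuous fun x => F' (moll n f x) (moll n (g i) x) := fun n =>
    (hc.comp (hcm n).continuous).clm_apply (contDiff_moll n hg.locallyIntegrable_two).continuous
  have hcF : ∀ n, Continuous fun x => F (moll n f x) := fun n => hFc.comp (hcm n).continuous
  have parts : ∀ n, ∫ x, (fderiv ℝ ψ x e) • F (moll n f x)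
      = - ∫ x, ψ x • F' (moll n f x) (moll n (g i) x) := by
    intro n
    have := integral_smul_fderiv_eq_neg_fderiv_smul_of_integrable (𝕜 := ℝ) (μ := volume)
      (f := ψ) (g := fun x => F (moll n f x)) (v := e) ?_ ?_ ?_ ?_ ?_
    · simp only [happ] at this
      rw [this, neg_neg]
    · exact ((continuous_fderiv_apply hψ e).smul (hcF n)).integrable_of_hasCompactSupport
        (hasCompactSupport_fderiv_apply hψc e).smul_right
    · simp only [happ]
      exact (hψ.continuous.smul (hcg n)).integrable_of_hasCompactSupport hψc.smul_right
    · exact (hψ.continuous.smul (hcF n)).integrable_of_hasCompactSupport hψc.smul_right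
    · exact fun x _ => hψ.differentiable (by simp) x
    · exact fun x _ => (hder n x).differentiableAt
  have lim1 : Tendsto (fun n => ∫⁻ x, ‖F (moll n f x) - F (f x)‖ₑ ^ 2) atTop (𝓝 0) := by
    have h1 := ENNReal.Tendsto.const_mul (a := ENNReal.ofReal L ^ 2) (tendsto_moll hf)
      (Or.inr (by simp))
    rw [mul_zero] at h1
    refine tendsto_of_tendsto_of_tendsto_of_le_of_le tendsto_const_nhds h1 (fun _ => zero_le)
      fun n => ?_
    rw [← lintegral_const_mul' _ _ (by simp)]
    refine lintegral_mono fun x => ?_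
    rw [← mul_pow]
    gcongr
    rw [← ofReal_norm, ← ofReal_norm, ← ENNReal.ofReal_mul hL0]
    exact ENNReal.ofReal_le_ofReal (hlip _ _)
  -- The difference splits as `F'(f_n)(g_n - g) + (F'(f_n) - F'(f)) g`. The first part is controlled
  -- by the bound `L`, the second by dominated convergence with majorant `2L|g|`.
  have lim2 : Tendsto (fun n => ∫⁻ x, ‖F' (moll n f x) (moll n (g i) x) - F' (f x) (g i x)‖ₑ ^ 2)
      atTop (𝓝 0) := by
    have h1 := ENNReal.Tendsto.const_mul (a := 2 * ENNReal.ofReal L ^ 2) (tendsto_moll hg)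
      (Or.inr (ENNReal.mul_ne_top (by simp) (by simp)))
    have h2 : Tendsto (fun n => ∫⁻ x, ‖(F' (moll n f x) - F' (f x)) (g i x)‖ₑ ^ 2)
        atTop (𝓝 (∫⁻ x : Space d, 0)) := by
      refine tendsto_lintegral_of_dominated_convergence'
        (fun x => (ENNReal.ofReal (2 * L) * ‖g i x‖ₑ) ^ 2) (fun n => ?_) (fun n => ?_) ?_ ?_
      · exact ((ContinuousLinearMap.id ℝ (E →L[ℝ] E')).aestronglyMeasurable_comp₂
          ((hc.comp (hcm n).continuous).aestronglyMeasurable.sub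
          (hc.comp_aestronglyMeasurable hf.1)) hg.1).enorm.pow_const _
      · refine Eventually.of_forall fun x => ?_
        dsimp only
        gcongr
        rw [← ofReal_norm, ← ofReal_norm, ← ENNReal.ofReal_mul (by positivity)]
        refine ENNReal.ofReal_le_ofReal (ContinuousLinearMap.le_of_opNorm_le _ ?_ _)
        calc _ ≤ ‖F' (moll n f x)‖ + ‖F' (f x)‖ := norm_sub_le _ _
          _ ≤ 2 * L := by linarith [hL (moll n f x), hL (f x)]
      · simp_rw [mul_pow]
        rw [lintegral_const_mul' _ _ (ENNReal.pow_ne_top ENNReal.ofReal_ne_top)]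
        exact ENNReal.mul_ne_top (ENNReal.pow_ne_top ENNReal.ofReal_ne_top) (memLp_two_iff_lintegral.1 hg).2.ne
      · filter_upwards [tendsto_moll_ae hf.locallyIntegrable_two] with x hx
        have h3 : Tendsto (fun n => F' (moll n f x) - F' (f x)) atTop (𝓝 0) := by
          simpa using ((hc.tendsto _).comp hx).sub_const (F' (f x))
        have h4 : Tendsto (fun n => (F' (moll n f x) - F' (f x)) (g i x)) atTop (𝓝 0) := by
          simpa [Function.comp_def] using
            ((ContinuousLinearMap.apply ℝ E' (g i x)).continuous.tendsto _).comp h3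
        simpa using ENNReal.Tendsto.pow (n := 2) h4.enorm
    rw [lintegral_zero] at h2
    have h3 := h1.add (ENNReal.Tendsto.const_mul (a := 2) h2 (Or.inr (by simp)))
    simp only [mul_zero, add_zero] at h3
    refine tendsto_of_tendsto_of_tendsto_of_le_of_le tendsto_const_nhds h3 (fun _ => zero_le)
      fun n => ?_
    have hLt : ENNReal.ofReal L ^ 2 ≠ ⊤ := ENNReal.pow_ne_top ENNReal.ofReal_ne_top
    dsimp only
    rw [mul_assoc, ← lintegral_const_mul' _ _ hLt, ← lintegral_const_mul' 2 _ (by simp),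
      ← lintegral_const_mul' 2 _ (by simp), ← lintegral_add_left']
    · refine lintegral_mono fun x => ?_
      have e1 : F' (moll n f x) (moll n (g i) x) - F' (f x) (g i x)
          = F' (moll n f x) (moll n (g i) x - g i x) + (F' (moll n f x) - F' (f x)) (g i x) := by
        simp
      rw [e1]
      refine (enorm_add_sq_le _ _).trans ?_
      rw [← mul_pow]
      gcongr
      rw [← ofReal_norm, ← ofReal_norm, ← ENNReal.ofReal_mul hL0]
      exact ENNReal.ofReal_le_ofReal (ContinuousLinearMap.le_of_opNorm_le _ (hL _) _)
    · exact ((((memLp_moll n hg).1.sub hg.1).enorm.pow_const 2).const_mul _).const_mul _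
  have hk1 : MemLp (fun x => fderiv ℝ ψ x e) 2 := memLp_of_continuous_hasCompactSupport
    (continuous_fderiv_apply hψ e) (hasCompactSupport_fderiv_apply hψc e)
  have hk2 : MemLp ψ 2 := memLp_of_continuous_hasCompactSupport hψ.continuous hψc
  refine tendsto_nhds_unique (tendsto_integral_smul_of_tendsto hk1
    (fun n => hmemF (memLp_moll n hf)) (hmemF hf) lim1) ?_
  simp_rw [parts]
  exact (tendsto_integral_smul_of_tendsto hk2
    (fun n => hmemF' (memLp_moll n hf) (memLp_moll n hg)) (hmemF' hf hg) lim2).neg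

/-! ### Algebra of Sobolev functions -/

theorem IsSobolev.congr {f f' : Space d → E} {g g' : Fin d → Space d → E} (h : IsSobolev f g)
    (hf : f =ᵐ[volume] f') (hg : ∀ i, g i =ᵐ[volume] g' i) : IsSobolev f' g' := by
  refine ⟨(memLp_congr_ae hf).1 h.memLp, fun i => (memLp_congr_ae (hg i)).1 (h.memLp_grad i),
    fun i ψ h1 h2 => ?_⟩
  have e1 : ∫ x, (fderiv ℝ ψ x (EuclideanSpace.single i 1)) • f x
      = ∫ x, (fderiv ℝ ψ x (EuclideanSpace.single i 1)) • f' x := integral_congr_ae (by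
    filter_upwards [hf] with x hx; rw [hx])
  have e2 : ∫ x, ψ x • g i x = ∫ x, ψ x • g' i x := integral_congr_ae (by
    filter_upwards [hg i] with x hx; rw [hx])
  rw [← e1, ← e2, h.integral_eq i ψ h1 h2]

theorem IsSobolev.ae_unique {f f' : Space d → E} {g g' : Fin d → Space d → E}
    (h : IsSobolev f g) (h' : IsSobolev f' g') (hf : f =ᵐ[volume] f') (i : Fin d) :
    g i =ᵐ[volume] g' i := by
  have h2 : IsSobolev f' g := h.congr hf fun _ => EventuallyEq.rfl
  have := (h2.hasWeakPartial i).ae_eq isOpen_univ (h'.hasWeakPartial i)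
  rwa [Measure.restrict_univ] at this

theorem IsSobolev.clm {f : Space d → E} {g : Fin d → Space d → E} (h : IsSobolev f g)
    (L : E →L[ℝ] E') : IsSobolev (fun x => L (f x)) (fun i x => L (g i x)) :=
  h.comp (F := L) (F' := fun _ => L) (fun _ => L.hasFDerivAt) continuous_const
    (fun _ => le_rfl) (map_zero L)

theorem IsSobolev.add {f f' : Space d → E} {g g' : Fin d → Space d → E} (h : IsSobolev f g)
    (h' : IsSobolev f' g') : IsSobolev (fun x => f x + f' x) (fun i x => g i x + g' i x) := by
  refine ⟨h.memLp.add h'.memLp, fun i => (h.memLp_grad i).add (h'.memLp_grad i),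
    fun i ψ h1 h2 => ?_⟩
  have hk1 := memLp_of_continuous_hasCompactSupport
    (continuous_fderiv_apply h1 (EuclideanSpace.single i 1)) (hasCompactSupport_fderiv_apply h2 _)
  have hk2 := memLp_of_continuous_hasCompactSupport h1.continuous h2
  simp only [smul_add]
  rw [integral_add (integrable_smul_two hk1 h.memLp) (integrable_smul_two hk1 h'.memLp),
    integral_add (integrable_smul_two hk2 (h.memLp_grad i))
      (integrable_smul_two hk2 (h'.memLp_grad i)),
    h.integral_eq i ψ h1 h2, h'.integral_eq i ψ h1 h2, neg_add]

theorem IsSobolev.const_smul {f : Space d → E} {g : Fin d → Space d → E} (h : IsSobolev f g)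
    (c : ℝ) : IsSobolev (fun x => c • f x) (fun i x => c • g i x) :=
  h.clm (c • ContinuousLinearMap.id ℝ E)

theorem IsSobolev.sub {f f' : Space d → E} {g g' : Fin d → Space d → E} (h : IsSobolev f g)
    (h' : IsSobolev f' g') : IsSobolev (fun x => f x - f' x) (fun i x => g i x - g' i x) := by
  simpa [sub_eq_add_neg] using h.add (h'.const_smul (-1))

/-- The pair of two Sobolev functions. -/
theorem IsSobolev.pair {f : Space d → E} {f' : Space d → E'} {g : Fin d → Space d → E}
    {g' : Fin d → Space d → E'} (h : IsSobolev f g) (h' : IsSobolev f' g') :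
    IsSobolev (fun x => WithLp.toLp 2 (f x, f' x)) (fun i x => WithLp.toLp 2 (g i x, g' i x)) := by
  let e : (E × E') →L[ℝ] WithLp 2 (E × E') :=
    (WithLp.prodContinuousLinearEquiv 2 ℝ E E').symm.toContinuousLinearMap
  have := (h.clm (e.comp (ContinuousLinearMap.inl ℝ E E'))).add
    (h'.clm (e.comp (ContinuousLinearMap.inr ℝ E E')))
  simpa [e, ← map_add, ← WithLp.toLp_add] using this

/-! ### Radial functions of Sobolev functions -/

theorem hasFDerivAt_normSq (v : E) :
    HasFDerivAt (fun v : E => ‖v‖ ^ 2) ((2 : ℝ) • innerSL ℝ v) v := by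
  have := (hasStrictFDerivAt_norm_sq v).hasFDerivAt
  rwa [← Nat.cast_smul_eq_nsmul ℝ] at this

/-- Unlike `|v|²`, its truncation `|v|² / (1 + c|v|²)` has bounded derivative, so the chain rule
applies. Letting `c → 0` recovers the density. -/
theorem IsSobolev.truncSq {f : Space d → E} {g : Fin d → Space d → E} (h : IsSobolev f g)
    {c : ℝ} (hc : 0 < c) :
    IsSobolev (fun x => ‖f x‖ ^ 2 / (1 + c * ‖f x‖ ^ 2))
      (fun i x => 2 * inner ℝ (f x) (g i x) / (1 + c * ‖f x‖ ^ 2) ^ 2) := by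
  have hpos : ∀ v : E, 0 < 1 + c * ‖v‖ ^ 2 := fun v => by positivity
  have := h.comp (F := fun v : E => ‖v‖ ^ 2 / (1 + c * ‖v‖ ^ 2))
    (F' := fun v => (2 / (1 + c * ‖v‖ ^ 2) ^ 2) • innerSL ℝ v) (L := 1 + 1 / c) ?_ ?_ ?_ ?_
  · refine this.congr EventuallyEq.rfl fun i => Eventually.of_forall fun x => ?_
    simp [innerSL_apply_apply]
    ring
  · intro v
    have h1 := hasFDerivAt_normSq v
    have h0 : HasDerivAt (fun s : ℝ => s / (1 + c * s))
        ((1 * (1 + c * ‖v‖ ^ 2) - ‖v‖ ^ 2 * (c * 1)) / (1 + c * ‖v‖ ^ 2) ^ 2) (‖v‖ ^ 2) :=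
      (hasDerivAt_id' _).fun_div (((hasDerivAt_id' _).const_mul c).const_add 1) (hpos v).ne'
    have h2 := h0.comp_hasFDerivAt v h1
    refine h2.congr_fderiv ?_
    ext w
    simp
    field_simp
    ring
  · have : ∀ v : E, (1 + c * ‖v‖ ^ 2) ^ 2 ≠ 0 := fun v => (pow_pos (hpos v) 2).ne'
    fun_prop (disch := exact this _)
  · intro v
    rw [norm_smul, innerSL_apply_norm, Real.norm_of_nonneg (by positivity), div_mul_eq_mul_div,
      div_le_iff₀ (pow_pos (hpos v) 2)]
    have h1 : 1 ≤ 1 + c * ‖v‖ ^ 2 := by have : 0 ≤ c * ‖v‖ ^ 2 := by positivity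
                                        linarith
    have h3 : (1 + 1 / c) * (1 + c * ‖v‖ ^ 2) = 1 + 1 / c + c * ‖v‖ ^ 2 + ‖v‖ ^ 2 := by
      field_simp; ring
    have h2 : 2 * ‖v‖ ≤ (1 + 1 / c) * (1 + c * ‖v‖ ^ 2) := by
      have : 0 ≤ 1 / c + c * ‖v‖ ^ 2 := by positivity
      nlinarith [sq_nonneg (‖v‖ - 1)]
    calc 2 * ‖v‖ ≤ (1 + 1 / c) * (1 + c * ‖v‖ ^ 2) := h2
      _ ≤ _ := by
        have : 0 ≤ 1 + 1 / c := by positivity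
        gcongr
        nlinarith
  · simp

/-- A smooth version of the norm, shifted by `ε` so that it vanishes at the origin; otherwise it
would not be square integrable on the whole space. -/
theorem IsSobolev.regNorm {f : Space d → E} {g : Fin d → Space d → E} (h : IsSobolev f g)
    {ε : ℝ} (hε : 0 < ε) :
    IsSobolev (fun x => √(‖f x‖ ^ 2 + ε ^ 2) - ε)
      (fun i x => inner ℝ (f x) (g i x) / √(‖f x‖ ^ 2 + ε ^ 2)) := by
  have hpos : ∀ v : E, 0 < ‖v‖ ^ 2 + ε ^ 2 := fun v => by positivity
  have := h.comp (F := fun v : E => √(‖v‖ ^ 2 + ε ^ 2) - ε)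
    (F' := fun v => (1 / √(‖v‖ ^ 2 + ε ^ 2)) • innerSL ℝ v) (L := 1) ?_ ?_ ?_ ?_
  · refine this.congr EventuallyEq.rfl fun i => Eventually.of_forall fun x => ?_
    simp [innerSL_apply_apply]
    ring
  · intro v
    have h2 := (((hasFDerivAt_normSq v).add_const (ε ^ 2)).sqrt (hpos v).ne').sub_const ε
    refine h2.congr_fderiv ?_
    ext w
    simp
    ring
  · have : ∀ v : E, √(‖v‖ ^ 2 + ε ^ 2) ≠ 0 := fun v => (Real.sqrt_pos.2 (hpos v)).ne'
    fun_prop (disch := exact this _)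
  · intro v
    rw [norm_smul, innerSL_apply_norm, Real.norm_of_nonneg (by positivity), div_mul_eq_mul_div,
      div_le_one (Real.sqrt_pos.2 (hpos v)), one_mul]
    exact Real.le_sqrt_of_sq_le (by nlinarith [sq_nonneg ε])
  · simp [Real.sqrt_sq hε.le]

theorem regNorm_bounds (t : ℝ) (ht : 0 ≤ t) {ε : ℝ} (hε : 0 ≤ ε) :
    0 ≤ √(t ^ 2 + ε ^ 2) - ε ∧ √(t ^ 2 + ε ^ 2) - ε ≤ t ∧ t - ε ≤ √(t ^ 2 + ε ^ 2) - ε := by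
  refine ⟨?_, ?_, ?_⟩
  · rw [sub_nonneg]; exact Real.le_sqrt_of_sq_le (by nlinarith)
  · rw [sub_le_iff_le_add, Real.sqrt_le_left (by positivity)]; nlinarith
  · have : t ≤ √(t ^ 2 + ε ^ 2) := Real.le_sqrt_of_sq_le (by nlinarith)
    linarith

theorem tendsto_one_div_add_one : Tendsto (fun n : ℕ => 1 / ((n : ℝ) + 1)) atTop (𝓝 0) :=
  tendsto_one_div_add_atTop_nhds_zero_nat

theorem abs_inner_div_norm_le (v w : E) : |inner ℝ v w / ‖v‖| ≤ ‖w‖ := by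
  rcases eq_or_ne v 0 with rfl | hv
  · simp
  · rw [abs_div, abs_norm, div_le_iff₀ (norm_pos_iff.2 hv), mul_comm]
    exact abs_real_inner_le_norm v w

/-- The norm of a Sobolev function is a Sobolev function. -/
theorem IsSobolev.norm {f : Space d → E} {g : Fin d → Space d → E} (h : IsSobolev f g) :
    IsSobolev (fun x => ‖f x‖) (fun i x => inner ℝ (f x) (g i x) / ‖f x‖) := by
  have hin : ∀ i, AEStronglyMeasurable (fun x => inner ℝ (f x) (g i x)) volume := fun i =>
    h.memLp.1.inner (h.memLp_grad i).1
  refine IsSobolev.of_hasWeakPartial h.memLp.norm (fun i => (h.memLp_grad i).norm.mono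
    ((hin i).aemeasurable.div h.memLp.1.norm.aemeasurable).aestronglyMeasurable
    (Eventually.of_forall fun x => by
      rw [norm_norm]; exact abs_inner_div_norm_le (f x) (g i x))) fun i => ?_
  refine HasWeakPartial.of_dominated
    (fun n : ℕ => (h.regNorm (ε := 1 / ((n : ℝ) + 1)) (by positivity)).hasWeakPartial i)
    (U := fun x => ‖f x‖) (W := fun x => ‖g i x‖) (h.memLp.norm.locallyIntegrable (by norm_num))
    ((h.memLp_grad i).norm.locallyIntegrable (by norm_num)) ?_ ?_ ?_ ?_
  · intro n x
    have := regNorm_bounds ‖f x‖ (norm_nonneg _) (ε := 1 / ((n : ℝ) + 1)) (by positivity)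
    rw [Real.norm_of_nonneg this.1]
    exact this.2.1
  · intro n x
    rw [norm_div, Real.norm_of_nonneg (Real.sqrt_nonneg _), div_le_iff₀ (by positivity), mul_comm]
    refine (abs_real_inner_le_norm _ _).trans ?_
    gcongr
    exact Real.le_sqrt_of_sq_le (by nlinarith [sq_nonneg (1 / ((n : ℝ) + 1))])
  · intro x
    have := ((tendsto_const_nhds (x := ‖f x‖ ^ 2)).add (tendsto_one_div_add_one.pow 2)).sqrt.sub
      tendsto_one_div_add_one
    simpa using this
  · intro x
    -- At zeros of `f` every regularized gradient is zero, in agreement with the convention `x / 0 =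
    -- 0`.
    rcases eq_or_ne (f x) 0 with h0 | h0
    · simp [h0]
    · have := (tendsto_const_nhds (x := inner ℝ (f x) (g i x))).div ((tendsto_const_nhds
        (x := ‖f x‖ ^ 2)).add (tendsto_one_div_add_one.pow 2)).sqrt (by simpa using h0)
      simpa [Pi.div_def] using this

theorem IsSobolev.integrable_inner {f : Space d → E} {g : Fin d → Space d → E}
    (h : IsSobolev f g) (i : Fin d) : Integrable (fun x => inner ℝ (f x) (g i x)) := by
  refine (h.memLp.norm.integrable_mul (h.memLp_grad i).norm).mono'
    (h.memLp.1.inner (h.memLp_grad i).1) (Eventually.of_forall fun x => ?_)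
  exact abs_real_inner_le_norm _ _

/-- The weak gradient of `|f|²`. -/
theorem IsSobolev.hasWeakPartial_normSq {f : Space d → E} {g : Fin d → Space d → E}
    (h : IsSobolev f g) (i : Fin d) :
    HasWeakPartial Set.univ (fun x => ‖f x‖ ^ 2) i (fun x => 2 * inner ℝ (f x) (g i x)) := by
  have hlim : ∀ x, Tendsto (fun n : ℕ => 1 + 1 / ((n : ℝ) + 1) * ‖f x‖ ^ 2) atTop (𝓝 1) := by
    intro x
    have := (tendsto_const_nhds (x := (1 : ℝ))).add (tendsto_one_div_add_one.mul_const (‖f x‖ ^ 2))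
    simpa using this
  have h1 : ∀ (n : ℕ) x, 1 ≤ 1 + 1 / ((n : ℝ) + 1) * ‖f x‖ ^ 2 := fun n x => by
    have : 0 ≤ 1 / ((n : ℝ) + 1) * ‖f x‖ ^ 2 := by positivity
    linarith
  -- The limit is only a weak derivative: `2⟨f, g⟩` is integrable but need not be square integrable,
  -- so no membership in `H¹` is claimed here.
  refine HasWeakPartial.of_dominated
    (fun n : ℕ => (h.truncSq (c := 1 / ((n : ℝ) + 1)) (by positivity)).hasWeakPartial i)
    (U := fun x => ‖f x‖ ^ 2) (W := fun x => ‖2 * inner ℝ (f x) (g i x)‖)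
    (h.memLp.integrable_norm_pow two_ne_zero).locallyIntegrable
    ((h.integrable_inner i).const_mul 2).norm.locallyIntegrable ?_ ?_ ?_ ?_
  · intro n x
    rw [Real.norm_of_nonneg (by positivity)]
    exact div_le_self (by positivity) (h1 n x)
  · intro n x
    rw [norm_div]
    refine div_le_self (norm_nonneg _) ?_
    rw [Real.norm_of_nonneg (by positivity)]
    exact one_le_pow₀ (h1 n x)
  · intro x
    simpa [Pi.div_def] using (tendsto_const_nhds (x := ‖f x‖ ^ 2)).div (hlim x) one_ne_zero
  · intro x
    simpa [Pi.div_def] using (tendsto_const_nhds (x := 2 * inner ℝ (f x) (g i x))).div ((hlim x).pow 2) (by simp)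

/-! ### Translations and the Nash inequality -/

theorem enorm_clm_apply_sq_le (L : Space d →L[ℝ] E) (v : Space d) :
    ‖L v‖ₑ ^ 2 ≤ ‖v‖ₑ ^ 2 * ∑ i, ‖L (EuclideanSpace.single i 1)‖ₑ ^ 2 := by
  have h1 : L v = ∑ i, v i • L (EuclideanSpace.single i 1) := by
    conv_lhs => rw [← (EuclideanSpace.basisFun (Fin d) ℝ).sum_repr v]
    simp
  have h2 : ‖L v‖ ^ 2 ≤ ‖v‖ ^ 2 * ∑ i, ‖L (EuclideanSpace.single i 1)‖ ^ 2 := by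
    calc ‖L v‖ ^ 2 ≤ (∑ i, ‖v i‖ * ‖L (EuclideanSpace.single i 1)‖) ^ 2 := by
          rw [h1]
          gcongr
          refine (norm_sum_le _ _).trans (Finset.sum_le_sum fun i _ => ?_)
          rw [norm_smul]
      _ ≤ _ := by
          rw [EuclideanSpace.norm_sq_eq]
          exact Finset.sum_mul_sq_le_sq_mul_sq _ _ _
  simp only [← ofReal_norm, ← ENNReal.ofReal_pow (norm_nonneg _)]
  rw [← ENNReal.ofReal_sum_of_nonneg (fun i _ => by positivity),
    ← ENNReal.ofReal_mul (by positivity)]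
  exact ENNReal.ofReal_le_ofReal h2

/-- The square of the `L²` norm of a gradient. -/
def gradEnergy (g : Fin d → Space d → E) : ℝ≥0∞ := ∑ i, ∫⁻ x, ‖g i x‖ₑ ^ 2

/-- The fundamental theorem of calculus along the segment from `x` to `x - h`, Cauchy–Schwarz in the
parameter, then Tonelli and translation invariance. -/
theorem lintegral_translate_sub_le_of_contDiff {v : Space d → E} (hv : ContDiff ℝ ∞ v)
    (h : Space d) :
    ∫⁻ x, ‖v (x - h) - v x‖ₑ ^ 2
      ≤ ‖h‖ₑ ^ 2 * gradEnergy fun i x => fderiv ℝ v x (EuclideanSpace.single i 1) := by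
  have hfc : Continuous (fderiv ℝ v) := hv.continuous_fderiv (by simp)
  set G : Space d → ℝ≥0∞ := fun x => ∑ i, ‖fderiv ℝ v x (EuclideanSpace.single i 1)‖ₑ ^ 2 with hG
  have hGc : Continuous G := by
    refine continuous_finsetSum _ fun i _ => ?_
    exact (ENNReal.continuous_pow 2).comp (hfc.clm_apply continuous_const).enorm
  have hGi : ∫⁻ x, G x = gradEnergy fun i x => fderiv ℝ v x (EuclideanSpace.single i 1) := by
    rw [gradEnergy, lintegral_finsetSum' _ fun i _ => ?_]
    exact ((hfc.clm_apply continuous_const).enorm.measurable.pow_const 2).aemeasurable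
  have hpt : ∀ x, ‖v (x - h) - v x‖ₑ ^ 2
      ≤ ∫⁻ t in Set.Ioc (0 : ℝ) 1, ‖h‖ₑ ^ 2 * G (x - t • h) := by
    intro x
    have hder : ∀ t : ℝ, HasDerivAt (fun t : ℝ => v (x - t • h)) (-(fderiv ℝ v (x - t • h) h)) t := by
      intro t
      have h1 : HasDerivAt (fun t : ℝ => x - t • h) (-h) t := by
        simpa using ((hasDerivAt_id t).smul_const h).const_sub x
      have := ((hv.differentiable (by simp)) (x - t • h)).hasFDerivAt.comp_hasDerivAt t h1
      simpa [Function.comp_def] using this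
    have hcont : Continuous fun t : ℝ => -(fderiv ℝ v (x - t • h) h) :=
      ((hfc.comp (by fun_prop)).clm_apply continuous_const).neg
    have hftc := intervalIntegral.integral_eq_sub_of_hasDerivAt (a := 0) (b := 1)
      (fun t _ => hder t) (hcont.intervalIntegrable _ _)
    simp only [one_smul, zero_smul, sub_zero] at hftc
    rw [← hftc, intervalIntegral.integral_of_le zero_le_one]
    calc _ ≤ (∫⁻ t in Set.Ioc (0 : ℝ) 1, ‖-(fderiv ℝ v (x - t • h) h)‖ₑ) ^ 2 := by
          gcongr; exact enorm_integral_le_lintegral_enorm _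
      _ ≤ ∫⁻ t in Set.Ioc (0 : ℝ) 1, ‖-(fderiv ℝ v (x - t • h) h)‖ₑ ^ 2 := by
          refine (sq_lintegral_le hcont.enorm.measurable.aemeasurable).trans_eq ?_
          simp
      _ ≤ _ := by
          refine lintegral_mono fun t => ?_
          rw [enorm_neg]
          exact enorm_clm_apply_sq_le _ _
  have hm : Measurable fun p : Space d × ℝ => ‖h‖ₑ ^ 2 * G (p.1 - p.2 • h) :=
    (hGc.measurable.comp (by fun_prop)).const_mul _
  calc ∫⁻ x, ‖v (x - h) - v x‖ₑ ^ 2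
      ≤ ∫⁻ x, ∫⁻ t in Set.Ioc (0 : ℝ) 1, ‖h‖ₑ ^ 2 * G (x - t • h) := lintegral_mono hpt
    _ = ∫⁻ t in Set.Ioc (0 : ℝ) 1, ∫⁻ x, ‖h‖ₑ ^ 2 * G (x - t • h) :=
        lintegral_lintegral_swap hm.aemeasurable
    _ = ∫⁻ t in Set.Ioc (0 : ℝ) 1, ‖h‖ₑ ^ 2 * ∫⁻ x, G x := by
        refine lintegral_congr fun t => ?_
        rw [lintegral_const_mul' _ _ (by simp)]
        congr 1
        exact lintegral_sub_right_eq_self G (t • h)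
    _ = _ := by simp [hGi]

/-- Translations act on `H¹` in a Lipschitz way. -/
theorem IsSobolev.lintegral_translate_sub_le {u : Space d → E} {g : Fin d → Space d → E}
    (hu : IsSobolev u g) (h : Space d) :
    ∫⁻ x, ‖u (x - h) - u x‖ₑ ^ 2 ≤ ‖h‖ₑ ^ 2 * gradEnergy g := by
  have hli := hu.memLp.locallyIntegrable_two
  have hb : ∀ n, ∫⁻ x, ‖moll n u (x - h) - moll n u x‖ₑ ^ 2 ≤ ‖h‖ₑ ^ 2 * gradEnergy g := by
    intro n
    refine (lintegral_translate_sub_le_of_contDiff (contDiff_moll n hli) h).trans ?_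
    gcongr
    refine Finset.sum_le_sum fun i _ => ?_
    simp only [fderiv_moll hu]
    exact lintegral_moll_sq_le n (hu.memLp_grad i).1
  have hae := tendsto_moll_ae hli
  have hae' : ∀ᵐ x, Tendsto (fun n => moll n u (x - h)) atTop (𝓝 (u (x - h))) :=
    (measurePreserving_sub_right volume h).quasiMeasurePreserving.ae hae
  calc ∫⁻ x, ‖u (x - h) - u x‖ₑ ^ 2
      ≤ ∫⁻ x, liminf (fun n => ‖moll n u (x - h) - moll n u x‖ₑ ^ 2) atTop := by
        refine lintegral_mono_ae ?_
        filter_upwards [hae, hae'] with x h1 h2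
        rw [(ENNReal.Tendsto.pow (n := 2) (h2.sub h1).enorm).liminf_eq]
    _ ≤ liminf (fun n => ∫⁻ x, ‖moll n u (x - h) - moll n u x‖ₑ ^ 2) atTop := by
        refine lintegral_liminf_le' fun n => ?_
        have := (contDiff_moll n hli).continuous
        exact ((this.comp (continuous_sub_right h)).sub this).enorm.measurable.aemeasurable.pow_const 2
    _ ≤ _ := liminf_le_of_le (by isBoundedDefault) fun b hb' => by
        obtain ⟨n, hn⟩ := hb'.exists
        exact hn.trans (hb n)

theorem enorm_sq_le_sub_add {F : Type*} [NormedAddCommGroup F] (a b : F) :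
    ‖a‖ₑ ^ 2 ≤ ‖b - a‖ₑ ^ 2 + 2 * (‖a‖ₑ * ‖b‖ₑ) := by
  simp only [← ofReal_norm, ← ENNReal.ofReal_pow (norm_nonneg _),
    ← ENNReal.ofReal_mul (norm_nonneg _)]
  rw [show (2 : ℝ≥0∞) = ENNReal.ofReal 2 by simp, ← ENNReal.ofReal_mul (by positivity),
    ← ENNReal.ofReal_add (by positivity) (by positivity)]
  refine ENNReal.ofReal_le_ofReal ?_
  have h1 := abs_norm_sub_norm_le b a
  have h2 := sq_le_sq' (by linarith [abs_nonneg (‖b‖ - ‖a‖), norm_nonneg (b - a)]) h1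
  rw [sq_abs] at h2
  nlinarith [sq_nonneg ‖b‖]

/-- A Nash inequality: the `L²` norm is controlled by the gradient and the `L¹` norm. -/
theorem IsSobolev.nash {u : Space d → E} {g : Fin d → Space d → E} (hu : IsSobolev u g)
    (r : ℝ) :
    volume (Metric.ball (0 : Space d) r) * ∫⁻ x, ‖u x‖ₑ ^ 2
      ≤ volume (Metric.ball (0 : Space d) r) * (ENNReal.ofReal r ^ 2 * gradEnergy g)
        + 2 * (∫⁻ x, ‖u x‖ₑ) ^ 2 := by
  set B := Metric.ball (0 : Space d) r
  have hum := hu.memLp.1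
  have hsub : ∀ h : Space d, AEStronglyMeasurable (fun x => u (x - h)) volume := fun h =>
    hum.comp_measurePreserving (measurePreserving_sub_right volume h)
  have hm : AEMeasurable (fun p : Space d × Space d => ‖u p.2‖ₑ * ‖u (p.2 - p.1)‖ₑ)
      ((volume.restrict B).prod volume) := by
    have h1 : AEMeasurable (fun p : Space d × Space d => ‖u (p.2 - p.1)‖ₑ)
        (volume.prod volume) := by
      have := (hum.comp_quasiMeasurePreserving
        (quasiMeasurePreserving_sub (volume : Measure (Space d)) volume)).enorm
      exact this.comp_quasiMeasurePreserving Measure.measurePreserving_swap.quasiMeasurePreserving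
    have h2 : AEMeasurable (fun p : Space d × Space d => ‖u p.2‖ₑ) (volume.prod volume) :=
      hum.enorm.comp_quasiMeasurePreserving Measure.quasiMeasurePreserving_snd
    refine (h2.mul h1).mono_measure ?_
    exact Measure.prod_mono Measure.restrict_le_self le_rfl
  -- Integrate `|u(x)|² ≤ |u(x-h) - u(x)|² + 2|u(x)||u(x-h)|` over `x` and over `h ∈ B`.
  -- Translations are Lipschitz with `|h| ≤ r`, and the cross term integrates to at most `2‖u‖₁²`.
  calc volume B * ∫⁻ x, ‖u x‖ₑ ^ 2 = ∫⁻ _ in B, ∫⁻ x, ‖u x‖ₑ ^ 2 := by simp [mul_comm]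
    _ ≤ ∫⁻ h in B, ((ENNReal.ofReal r ^ 2 * gradEnergy g)
        + 2 * ∫⁻ x, ‖u x‖ₑ * ‖u (x - h)‖ₑ) := by
        refine setLIntegral_mono' Metric.isOpen_ball.measurableSet fun h hh => ?_
        calc ∫⁻ x, ‖u x‖ₑ ^ 2
            ≤ ∫⁻ x, (‖u (x - h) - u x‖ₑ ^ 2 + 2 * (‖u x‖ₑ * ‖u (x - h)‖ₑ)) :=
              lintegral_mono fun x => enorm_sq_le_sub_add _ _
          _ = (∫⁻ x, ‖u (x - h) - u x‖ₑ ^ 2) + 2 * ∫⁻ x, ‖u x‖ₑ * ‖u (x - h)‖ₑ := by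
              have m : AEMeasurable (fun x => ‖u (x - h) - u x‖ₑ ^ 2) volume :=
                ((hsub h).sub hum).enorm.pow_const 2
              rw [lintegral_add_left' m, lintegral_const_mul' _ _ (by simp)]
          _ ≤ _ := by
              gcongr
              refine (hu.lintegral_translate_sub_le h).trans ?_
              gcongr
              rw [← ofReal_norm]
              exact ENNReal.ofReal_le_ofReal (by simpa [B] using (mem_ball_zero_iff.1 hh).le)
    _ = volume B * (ENNReal.ofReal r ^ 2 * gradEnergy g)
        + 2 * ∫⁻ h in B, ∫⁻ x, ‖u x‖ₑ * ‖u (x - h)‖ₑ := by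
        rw [lintegral_add_left measurable_const, lintegral_const_mul' 2 _ (by simp),
          setLIntegral_const, mul_comm (volume B)]
    _ ≤ _ := by
        gcongr
        calc ∫⁻ h in B, ∫⁻ x, ‖u x‖ₑ * ‖u (x - h)‖ₑ
            = ∫⁻ x, ∫⁻ h in B, ‖u x‖ₑ * ‖u (x - h)‖ₑ := lintegral_lintegral_swap hm
          _ ≤ ∫⁻ x, ∫⁻ h, ‖u x‖ₑ * ‖u (x - h)‖ₑ :=
              lintegral_mono fun x => lintegral_mono' Measure.restrict_le_self le_rfl
          _ = ∫⁻ x, ‖u x‖ₑ * ∫⁻ y, ‖u y‖ₑ := by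
              refine lintegral_congr fun x => ?_
              rw [lintegral_const_mul' _ _ (by simp)]
              congr 1
              exact lintegral_sub_left_eq_self (fun y => ‖u y‖ₑ) x
          _ = _ := by rw [lintegral_mul_const'' _ hum.enorm, sq]

/-! ### Weak compactness -/

/-- Riesz representation moves the sequence to the dual space, where separability makes closed balls
weak-* sequentially compact. -/
theorem exists_weak_limit {H : Type*} [NormedAddCommGroup H] [InnerProductSpace ℝ H]
    [CompleteSpace H] [TopologicalSpace.SeparableSpace H] (x : ℕ → H) {M : ℝ}
    (hx : ∀ n, ‖x n‖ ≤ M) : ∃ (y : H) (s : ℕ → ℕ), StrictMono s ∧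
      ∀ h, Tendsto (fun n => inner ℝ (x (s n)) h) atTop (𝓝 (inner ℝ y h)) := by
  have hc := WeakDual.isSeqCompact_closedBall ℝ H 0 M
  let D : H → WeakDual ℝ H := fun v => StrongDual.toWeakDual (InnerProductSpace.toDual ℝ H v)
  have hD : ∀ n, D (x n) ∈ WeakDual.toStrongDual ⁻¹' Metric.closedBall (0 : StrongDual ℝ H) M := by
    intro n
    simpa [D] using hx n
  obtain ⟨a, -, s, hs, hlim⟩ := hc hD
  refine ⟨(InnerProductSpace.toDual ℝ H).symm (WeakDual.toStrongDual a), s, hs, fun h => ?_⟩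
  have h1 := ((WeakBilin.eval_continuous (topDualPairing ℝ H) h).tendsto a).comp hlim
  rw [InnerProductSpace.toDual_symm_apply]
  exact h1

/-- A finite exponent is what the separability of `L²` rests on, and `exists_weak_limit` needs that
separability. -/
instance : Fact ((2 : ℝ≥0∞) ≠ ⊤) := ⟨by norm_num⟩

/-- The Hilbert space `L² × (L²)^d`. -/
abbrev GradSpace (d : ℕ) (E : Type*) [NormedAddCommGroup E] : Type _ :=
  PiLp 2 (fun _ : Option (Fin d) => Lp E 2 (volume : Measure (Space d)))

/-- A Sobolev function and its gradient as an element of `L² × (L²)^d`. -/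
def IsSobolev.toGradSpace {f : Space d → E} {g : Fin d → Space d → E} (h : IsSobolev f g) :
    GradSpace d E :=
  WithLp.toLp 2 fun o => match o with
    | none => h.memLp.toLp f
    | some i => (h.memLp_grad i).toLp (g i)

theorem inner_toLp {f k : Space d → E} (hf : MemLp f 2) (hk : MemLp k 2) :
    inner ℝ (hf.toLp f) (hk.toLp k) = ∫ x, inner ℝ (f x) (k x) := by
  rw [L2.inner_def]
  refine integral_congr_ae ?_
  filter_upwards [hf.coeFn_toLp, hk.coeFn_toLp] with x h1 h2
  rw [h1, h2]

/-- `∑ᵢ ∫ |gᵢ|²` as a real number. -/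
def gradInt (g : Fin d → Space d → E) : ℝ := ∑ i, ∫ x, ‖g i x‖ ^ 2

theorem gradInt_nonneg (g : Fin d → Space d → E) : 0 ≤ gradInt g :=
  Finset.sum_nonneg fun _ _ => integral_nonneg fun _ => by positivity

theorem IsSobolev.gradEnergy_eq {f : Space d → E} {g : Fin d → Space d → E} (h : IsSobolev f g) :
    gradEnergy g = ENNReal.ofReal (gradInt g) := by
  rw [gradEnergy, gradInt, ENNReal.ofReal_sum_of_nonneg fun i _ =>
    integral_nonneg fun _ => by positivity]
  exact Finset.sum_congr rfl fun i _ => lintegral_enorm_sq (h.memLp_grad i)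

theorem IsSobolev.inner_toGradSpace {f f' : Space d → E} {g g' : Fin d → Space d → E}
    (h : IsSobolev f g) (h' : IsSobolev f' g') : inner ℝ h.toGradSpace h'.toGradSpace
      = (∫ x, inner ℝ (f x) (f' x)) + ∑ i, ∫ x, inner ℝ (g i x) (g' i x) := by
  rw [PiLp.inner_apply, Fintype.sum_option]
  simp only [toGradSpace]
  rw [inner_toLp]
  simp_rw [inner_toLp]

theorem IsSobolev.norm_toGradSpace_sq {f : Space d → E} {g : Fin d → Space d → E}
    (h : IsSobolev f g) : ‖h.toGradSpace‖ ^ 2 = (∫ x, ‖f x‖ ^ 2) + gradInt g := by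
  rw [← real_inner_self_eq_norm_sq, h.inner_toGradSpace, gradInt]
  simp only [real_inner_self_eq_norm_sq]

/-- Weak convergence in `L²`. -/
def WeakTendsto (f : ℕ → Space d → E) (f₀ : Space d → E) : Prop :=
  ∀ k : Space d → E, MemLp k 2 →
    Tendsto (fun n => ∫ x, inner ℝ (f n x) (k x)) atTop (𝓝 (∫ x, inner ℝ (f₀ x) (k x)))

/-- Bounded sequences in `H¹` are weakly relatively compact. -/
theorem exists_weak_limit_sobolev {f : ℕ → Space d → E} {g : ℕ → Fin d → Space d → E}
    (h : ∀ n, IsSobolev (f n) (g n)) {M : ℝ} (hf : ∀ n, ∫ x, ‖f n x‖ ^ 2 ≤ M)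
    (hg : ∀ n, gradInt (g n) ≤ M) :
    ∃ (f₀ : Space d → E) (g₀ : Fin d → Space d → E) (h₀ : IsSobolev f₀ g₀) (s : ℕ → ℕ),
      StrictMono s ∧
      (∀ y, Tendsto (fun n => inner ℝ (h (s n)).toGradSpace y) atTop
        (𝓝 (inner ℝ h₀.toGradSpace y))) ∧
      WeakTendsto (fun n => f (s n)) f₀ ∧ ∀ i, WeakTendsto (fun n => g (s n) i) (g₀ i) := by
  have hb : ∀ n, ‖(h n).toGradSpace‖ ≤ √(M + M) := fun n => by
    refine Real.le_sqrt_of_sq_le ?_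
    rw [(h n).norm_toGradSpace_sq]
    exact add_le_add (hf n) (hg n)
  obtain ⟨y, s, hs, hlim⟩ := exists_weak_limit _ hb
  -- Pairing with a vector that has a single nonzero component extracts the weak convergence of each
  -- component.
  have comp : ∀ (o : Option (Fin d)) (k : Space d → E) (hk : MemLp k 2) (z : GradSpace d E),
      inner ℝ z (WithLp.toLp 2 (Pi.single o (hk.toLp k)))
        = ∫ x, inner ℝ ((z o : Lp E 2 (volume : Measure (Space d))) x) (k x) := by
    intro o k hk z
    rw [PiLp.inner_apply, Finset.sum_eq_single o]
    · simp only [Pi.single_eq_same]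
      rw [L2.inner_def]
      refine integral_congr_ae ?_
      filter_upwards [hk.coeFn_toLp] with x h1
      rw [h1]
    · intro o' _ ho
      simp [Pi.single_eq_of_ne ho]
    · simp
  have compf : ∀ n (k : Space d → E) (hk : MemLp k 2),
      inner ℝ (h n).toGradSpace (WithLp.toLp 2 (Pi.single none (hk.toLp k)))
        = ∫ x, inner ℝ (f n x) (k x) := by
    intro n k hk
    rw [comp]
    refine integral_congr_ae ?_
    filter_upwards [(h n).memLp.coeFn_toLp] with x h1
    simp only [IsSobolev.toGradSpace]
    rw [h1]
  have compg : ∀ n i (k : Space d → E) (hk : MemLp k 2),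
      inner ℝ (h n).toGradSpace (WithLp.toLp 2 (Pi.single (some i) (hk.toLp k)))
        = ∫ x, inner ℝ (g n i x) (k x) := by
    intro n i k hk
    rw [comp]
    refine integral_congr_ae ?_
    filter_upwards [((h n).memLp_grad i).coeFn_toLp] with x h1
    simp only [IsSobolev.toGradSpace]
    rw [h1]
  have wf : WeakTendsto (fun n => f (s n)) (y none : Lp E 2 (volume : Measure (Space d))) := by
    intro k hk
    have := hlim (WithLp.toLp 2 (Pi.single none (hk.toLp k)))
    simpa only [compf, comp] using this
  have wg : ∀ i, WeakTendsto (fun n => g (s n) i)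
      (y (some i) : Lp E 2 (volume : Measure (Space d))) := by
    intro i k hk
    have := hlim (WithLp.toLp 2 (Pi.single (some i) (hk.toLp k)))
    simpa only [compg, comp] using this
  have h₀ : IsSobolev (y none : Lp E 2 (volume : Measure (Space d)))
      (fun i => (y (some i) : Lp E 2 (volume : Measure (Space d)))) := by
    refine ⟨Lp.memLp _, fun i => Lp.memLp _, fun i ψ h1 h2 => ?_⟩
    have hk1 := memLp_of_continuous_hasCompactSupport
      (continuous_fderiv_apply h1 (EuclideanSpace.single i 1)) (hasCompactSupport_fderiv_apply h2 _)
    have hk2 := memLp_of_continuous_hasCompactSupport h1.continuous h2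
    have key : ∀ {k : Space d → ℝ} (hk : MemLp k 2) {v : Space d → E} (hv : MemLp v 2) (e : E),
        ∫ x, inner ℝ (v x) (k x • e) = inner ℝ (∫ x, k x • v x) e := by
      intro k hk v hv e
      rw [real_inner_comm, ← integral_inner (integrable_smul_two hk hv)]
      refine integral_congr_ae (Eventually.of_forall fun x => ?_)
      simp [inner_smul_right, real_inner_comm]
    have hke : ∀ {k : Space d → ℝ} (hk : MemLp k 2) (e : E), MemLp (fun x => k x • e) 2 :=
      fun hk e => by
        simpa using hk.continuousLinearMap_comp (ContinuousLinearMap.toSpanSingleton ℝ e)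
    -- Weak convergence concerns scalar pairings, so the vector identity is tested against each
    -- fixed `e`; then both sides of the integration by parts pass to the limit.
    refine ext_inner_right ℝ fun e => ?_
    rw [inner_neg_left, ← key hk1 (Lp.memLp _), ← key hk2 (Lp.memLp _)]
    refine tendsto_nhds_unique (wf _ (hke hk1 e)) ?_
    have e1 : ∀ n, ∫ x, inner ℝ (f (s n) x) ((fderiv ℝ ψ x (EuclideanSpace.single i 1)) • e)
        = - ∫ x, inner ℝ (g (s n) i x) (ψ x • e) := by
      intro n
      rw [key hk1 (h _).memLp, key hk2 ((h _).memLp_grad i), (h _).integral_eq i ψ h1 h2,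
        inner_neg_left]
    simp_rw [e1]
    exact (wg i _ (hke hk2 e)).neg
  refine ⟨_, _, h₀, s, hs, fun z => ?_, wf, wg⟩
  have e2 : h₀.toGradSpace = y := by
    ext o : 1
    cases o <;> simp [IsSobolev.toGradSpace]
  rw [e2]
  exact hlim z

theorem integrable_inner_of_memLp {α : Type*} [MeasurableSpace α] {μ : Measure α} {f k : α → E}
    (hf : MemLp f 2 μ) (hk : MemLp k 2 μ) : Integrable (fun x => inner ℝ (f x) (k x)) μ :=
  (hf.norm.integrable_mul hk.norm).mono' (hf.1.inner hk.1)
    (Eventually.of_forall fun _ => abs_real_inner_le_norm _ _)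

/-- Weak lower semicontinuity of the Dirichlet integral. -/
theorem gradInt_le_of_weakTendsto {g : ℕ → Fin d → Space d → E} {g₀ : Fin d → Space d → E}
    (hg : ∀ n i, MemLp (g n i) 2) (hg₀ : ∀ i, MemLp (g₀ i) 2)
    (hw : ∀ i, WeakTendsto (fun n => g n i) (g₀ i)) {c : ℝ}
    (hc : Tendsto (fun n => gradInt (g n)) atTop (𝓝 c)) : gradInt g₀ ≤ c := by
  have h1 : Tendsto (fun n => ∑ i, ∫ x, inner ℝ (g n i x) (g₀ i x)) atTop (𝓝 (gradInt g₀)) := by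
    simp_rw [gradInt, ← real_inner_self_eq_norm_sq]
    exact tendsto_finsetSum _ fun i _ => hw i _ (hg₀ i)
  -- Testing with `g₀` itself and using `⟨a, b⟩ ≤ (|a|² + |b|²)/2` gives `gradInt g₀ ≤ (c + gradInt
  -- g₀)/2` in the limit.
  have h2 : ∀ n, ∑ i, ∫ x, inner ℝ (g n i x) (g₀ i x) ≤ (gradInt (g n) + gradInt g₀) / 2 := by
    intro n
    rw [gradInt, gradInt, ← Finset.sum_add_distrib, Finset.sum_div]
    refine Finset.sum_le_sum fun i _ => ?_
    have i1 := (hg n i).integrable_norm_pow two_ne_zero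
    have i2 := (hg₀ i).integrable_norm_pow two_ne_zero
    rw [← integral_add i1 i2, ← integral_div]
    refine integral_mono (integrable_inner_of_memLp (hg n i) (hg₀ i)) ((i1.add i2).div_const 2)
      fun x => ?_
    have := real_inner_le_norm (g n i x) (g₀ i x)
    nlinarith [sq_nonneg (‖g n i x‖ - ‖g₀ i x‖)]
  have := le_of_tendsto_of_tendsto' h1 ((hc.add_const (gradInt g₀)).div_const 2) h2
  linarith

theorem WeakTendsto.of_tendsto {f : ℕ → Space d → E} {f₀ : Space d → E} (hf : ∀ n, MemLp (f n) 2)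
    (hf₀ : MemLp f₀ 2) (h : Tendsto (fun n => ∫⁻ x, ‖f n x - f₀ x‖ₑ ^ 2) atTop (𝓝 0)) :
    WeakTendsto f f₀ := by
  intro k hk
  have hl : Tendsto (fun n => hf n |>.toLp) atTop (𝓝 (hf₀.toLp)) := by
    rw [Lp.tendsto_Lp_iff_tendsto_eLpNorm'']
    exact tendsto_eLpNorm_two_zero_iff.2 h
  have := hl.inner (tendsto_const_nhds (x := hk.toLp)) (𝕜 := ℝ)
  simpa only [inner_toLp] using this

theorem WeakTendsto.ae_unique {f : ℕ → Space d → E} {f₀ f₁ : Space d → E}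
    (hf₀ : MemLp f₀ 2) (hf₁ : MemLp f₁ 2) (h₀ : WeakTendsto f f₀) (h₁ : WeakTendsto f f₁) :
    f₀ =ᵐ[volume] f₁ := by
  have hk := hf₀.sub hf₁
  have e := tendsto_nhds_unique (h₀ _ hk) (h₁ _ hk)
  have e2 : ∫ x, ‖(f₀ - f₁) x‖ ^ 2 = 0 := by
    rw [← sub_eq_zero, ← integral_sub (integrable_inner_of_memLp hf₀ hk)
      (integrable_inner_of_memLp hf₁ hk)] at e
    rw [← e]
    refine integral_congr_ae (Eventually.of_forall fun x => ?_)
    simp only [Pi.sub_apply]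
    rw [← inner_sub_left, real_inner_self_eq_norm_sq]
  rw [integral_eq_zero_iff_of_nonneg (fun _ => by positivity)
    (hk.integrable_norm_pow two_ne_zero)] at e2
  filter_upwards [e2] with x hx
  simpa [sub_eq_zero] using hx

theorem WeakTendsto.comp {f : ℕ → Space d → E} {f₀ : Space d → E} (h : WeakTendsto f f₀)
    {s : ℕ → ℕ} (hs : StrictMono s) : WeakTendsto (fun n => f (s n)) f₀ :=
  fun k hk => (h k hk).comp hs.tendsto_atTop

/-- A sequence which is bounded in `H¹` and converges in `L²` has a subsequence which converges
weakly in `H¹`, and the limit lies in `H¹`. -/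
theorem exists_isSobolev_of_tendsto {f : ℕ → Space d → E} {g : ℕ → Fin d → Space d → E}
    (h : ∀ n, IsSobolev (f n) (g n)) {f₀ : Space d → E} (hf₀ : MemLp f₀ 2)
    (hf : Tendsto (fun n => ∫⁻ x, ‖f n x - f₀ x‖ₑ ^ 2) atTop (𝓝 0)) {M : ℝ}
    (hM : ∀ n, ∫ x, ‖f n x‖ ^ 2 ≤ M) (hg : ∀ n, gradInt (g n) ≤ M) :
    ∃ (g₀ : Fin d → Space d → E) (h₀ : IsSobolev f₀ g₀) (s : ℕ → ℕ), StrictMono s ∧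
      (∀ y, Tendsto (fun n => inner ℝ (h (s n)).toGradSpace y) atTop
        (𝓝 (inner ℝ h₀.toGradSpace y))) ∧ ∀ i, WeakTendsto (fun n => g (s n) i) (g₀ i) := by
  obtain ⟨f₁, g₁, h₁, s, hs, w0, w1, w2⟩ := exists_weak_limit_sobolev h hM hg
  have hae : f₁ =ᵐ[volume] f₀ := (((WeakTendsto.of_tendsto (fun n => (h n).memLp) hf₀ hf).comp
    hs).ae_unique hf₀ h₁.memLp w1).symm
  have h₀ : IsSobolev f₀ g₁ := h₁.congr hae fun _ => EventuallyEq.rfl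
  have e : h₀.toGradSpace = h₁.toGradSpace := by
    ext o : 1
    cases o with
    | none => exact MemLp.toLp_congr h₀.memLp h₁.memLp hae.symm
    | some i => rfl
  exact ⟨g₁, h₀, s, hs, by rwa [e], w2⟩

/-- Lower semicontinuity of the Dirichlet integral under `L²` convergence. -/
theorem gradInt_le_of_tendsto {f : ℕ → Space d → E} {g : ℕ → Fin d → Space d → E}
    (h : ∀ n, IsSobolev (f n) (g n)) {f₀ : Space d → E} {g₀ : Fin d → Space d → E}
    (h₀ : IsSobolev f₀ g₀)
    (hf : Tendsto (fun n => ∫⁻ x, ‖f n x - f₀ x‖ₑ ^ 2) atTop (𝓝 0)) {M c : ℝ}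
    (hM : ∀ n, ∫ x, ‖f n x‖ ^ 2 ≤ M) (hc : Tendsto (fun n => gradInt (g n)) atTop (𝓝 c)) :
    gradInt g₀ ≤ c := by
  obtain ⟨B, hB⟩ := hc.bddAbove_range
  obtain ⟨g₁, h₁, s, hs, -, w⟩ := exists_isSobolev_of_tendsto h h₀.memLp hf (M := max M B)
    (fun n => (hM n).trans (le_max_left _ _))
    (fun n => (hB (Set.mem_range_self n)).trans (le_max_right _ _))
  have e : gradInt g₀ = gradInt g₁ := Finset.sum_congr rfl fun i _ => integral_congr_ae (by
    filter_upwards [h₀.ae_unique h₁ EventuallyEq.rfl i] with x hx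
    rw [hx])
  rw [e]
  exact gradInt_le_of_weakTendsto (fun n i => (h (s n)).memLp_grad i) h₁.memLp_grad w
    (hc.comp hs.tendsto_atTop)

/-! ### Local compactness -/

theorem tendsto_zero_of_inner {v : ℕ → E}
    (h : ∀ e : E, Tendsto (fun n => inner ℝ (v n) e) atTop (𝓝 0)) : Tendsto v atTop (𝓝 0) := by
  have b := stdOrthonormalBasis ℝ E
  have e : ∀ n, v n = ∑ i, inner ℝ (v n) (b i) • b i := fun n => by
    conv_lhs => rw [← b.sum_repr' (v n)]
    simp_rw [real_inner_comm]
  rw [show v = fun n => ∑ i, inner ℝ (v n) (b i) • b i from funext e]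
  have := tendsto_finsetSum Finset.univ fun i _ => (h (b i)).smul_const (b i)
  simpa using this

/-- The average of a function over the ball of radius `r` around `x`. -/
def ballAvg (r : ℝ) (w : Space d → E) (x : Space d) : E :=
  (volume (Metric.ball (0 : Space d) r)).toReal⁻¹ • ∫ h in Metric.ball (0 : Space d) r, w (x - h)

section ballAvg

variable {w : Space d → E} {r : ℝ}

theorem enorm_ballAvg_sq_le (hr : 0 < r) {v : Space d → E} (hv : AEStronglyMeasurable v) :
    ‖(volume (Metric.ball (0 : Space d) r)).toReal⁻¹ • ∫ h in Metric.ball (0 : Space d) r, v h‖ₑ ^ 2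
      ≤ (volume (Metric.ball (0 : Space d) r))⁻¹ *
        ∫⁻ h in Metric.ball (0 : Space d) r, ‖v h‖ₑ ^ 2 := by
  set b := volume (Metric.ball (0 : Space d) r)
  have hb0 : b ≠ 0 := (Metric.measure_ball_pos _ _ hr).ne'
  have hbt : b ≠ ⊤ := measure_ball_lt_top.ne
  have hb : ‖b.toReal⁻¹‖ₑ = b⁻¹ := by
    rw [Real.enorm_of_nonneg (by positivity), ENNReal.ofReal_inv_of_pos
      (ENNReal.toReal_pos hb0 hbt), ENNReal.ofReal_toReal hbt]
  rw [enorm_smul, hb, mul_pow]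
  calc b⁻¹ ^ 2 * ‖∫ h in Metric.ball (0 : Space d) r, v h‖ₑ ^ 2
      ≤ b⁻¹ ^ 2 * (b * ∫⁻ h in Metric.ball (0 : Space d) r, ‖v h‖ₑ ^ 2) := by
        gcongr
        refine (pow_le_pow_left' (enorm_integral_le_lintegral_enorm _) 2).trans ?_
        refine (sq_lintegral_le hv.restrict.enorm).trans_eq ?_
        simp [b]
    _ = _ := by
        rw [sq, ← mul_assoc, mul_assoc b⁻¹ b⁻¹ b, ENNReal.inv_mul_cancel hb0 hbt, mul_one]

theorem aestronglyMeasurable_ballAvg (hw : AEStronglyMeasurable w) :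
    AEStronglyMeasurable (ballAvg r w) := by
  have h1 : AEStronglyMeasurable (fun p : Space d × Space d => w (p.1 - p.2))
      (volume.prod (volume.restrict (Metric.ball (0 : Space d) r))) :=
    (hw.comp_quasiMeasurePreserving (quasiMeasurePreserving_sub volume volume)).mono_measure
      (Measure.prod_mono le_rfl Measure.restrict_le_self)
  exact h1.integral_prod_right'.const_smul _

theorem comp_sub_left_aestronglyMeasurable (hw : AEStronglyMeasurable w) (x : Space d) :
    AEStronglyMeasurable (fun h => w (x - h)) volume :=
  hw.comp_measurePreserving (Measure.measurePreserving_sub_left volume x)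

/-- A bound uniform in `x`: it provides the constant majorant for dominated convergence on a ball.
-/
theorem enorm_ballAvg_sq_le' (hr : 0 < r) (hw : AEStronglyMeasurable w) (x : Space d) :
    ‖ballAvg r w x‖ₑ ^ 2 ≤ (volume (Metric.ball (0 : Space d) r))⁻¹ * ∫⁻ y, ‖w y‖ₑ ^ 2 := by
  refine (enorm_ballAvg_sq_le hr (comp_sub_left_aestronglyMeasurable hw x)).trans ?_
  refine mul_le_mul' le_rfl ?_
  refine (lintegral_mono' Measure.restrict_le_self le_rfl).trans_eq ?_
  exact lintegral_sub_left_eq_self (fun y => ‖w y‖ₑ ^ 2) x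

/-- The deviation from the average is an average of translation errors, each of size at most `r`
times the gradient norm. -/
theorem IsSobolev.lintegral_sub_ballAvg_le {g : Fin d → Space d → E} (h : IsSobolev w g)
    (hr : 0 < r) :
    ∫⁻ x, ‖ballAvg r w x - w x‖ₑ ^ 2 ≤ ENNReal.ofReal r ^ 2 * gradEnergy g := by
  set B := Metric.ball (0 : Space d) r
  have hb0 : volume B ≠ 0 := (Metric.measure_ball_pos _ _ hr).ne'
  have hbt : volume B ≠ ⊤ := measure_ball_lt_top.ne
  have hwm := h.memLp.1
  have hpt : ∀ x, ‖ballAvg r w x - w x‖ₑ ^ 2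
      ≤ (volume B)⁻¹ * ∫⁻ h in B, ‖w (x - h) - w x‖ₑ ^ 2 := by
    intro x
    have hi : IntegrableOn (fun h => w (x - h)) B := by
      have : MemLp (fun h => w (x - h)) 2 volume :=
        h.memLp.comp_measurePreserving (Measure.measurePreserving_sub_left volume x)
      have : Fact (volume B < ⊤) := ⟨hbt.lt_top⟩
      exact MemLp.integrable (q := 2) (by norm_num) (MemLp.restrict B ‹_›)
    have e : ballAvg r w x - w x = (volume B).toReal⁻¹ • ∫ h in B, (w (x - h) - w x) := by
      rw [integral_sub hi (integrableOn_const hbt), setIntegral_const, smul_sub, smul_smul,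
        measureReal_def, inv_mul_cancel₀ (ENNReal.toReal_pos hb0 hbt).ne', one_smul]
      rfl
    rw [e]
    exact enorm_ballAvg_sq_le hr
      ((comp_sub_left_aestronglyMeasurable hwm x).sub aestronglyMeasurable_const)
  have hm : AEMeasurable (fun p : Space d × Space d => ‖w (p.1 - p.2) - w p.1‖ₑ ^ 2)
      (volume.prod (volume.restrict B)) := by
    refine AEMeasurable.mono_measure ?_ (Measure.prod_mono le_rfl Measure.restrict_le_self)
    exact ((hwm.comp_quasiMeasurePreserving (quasiMeasurePreserving_sub volume volume)).sub
      (hwm.comp_quasiMeasurePreserving Measure.quasiMeasurePreserving_fst)).enorm.pow_const 2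
  calc ∫⁻ x, ‖ballAvg r w x - w x‖ₑ ^ 2
      ≤ ∫⁻ x, (volume B)⁻¹ * ∫⁻ h in B, ‖w (x - h) - w x‖ₑ ^ 2 := lintegral_mono hpt
    _ = (volume B)⁻¹ * ∫⁻ h in B, ∫⁻ x, ‖w (x - h) - w x‖ₑ ^ 2 := by
        rw [lintegral_const_mul' _ _ (by simpa using hb0), lintegral_lintegral_swap hm]
    _ ≤ (volume B)⁻¹ * ∫⁻ _ in B, ENNReal.ofReal r ^ 2 * gradEnergy g := by
        refine mul_le_mul' le_rfl ?_
        refine setLIntegral_mono' Metric.isOpen_ball.measurableSet fun y hy => ?_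
        refine (h.lintegral_translate_sub_le y).trans ?_
        gcongr
        rw [← ofReal_norm]
        exact ENNReal.ofReal_le_ofReal (by simpa [B] using (mem_ball_zero_iff.1 hy).le)
    _ = _ := by
        rw [setLIntegral_const, mul_comm _ (volume B), ← mul_assoc,
          ENNReal.inv_mul_cancel hb0 hbt, one_mul]

/-- For fixed `x` the average is a pairing with the indicator of a ball around `x`, an `L²`
function, so weak convergence becomes pointwise convergence. -/
theorem tendsto_ballAvg {w : ℕ → Space d → E} (hw : ∀ n, MemLp (w n) 2)
    (hl : WeakTendsto w fun _ => 0) (x : Space d) :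
    Tendsto (fun n => ballAvg r (w n) x) atTop (𝓝 0) := by
  set B := Metric.ball (0 : Space d) r
  have hBm : MeasurableSet B := Metric.isOpen_ball.measurableSet
  set k : Space d → ℝ := fun y => B.indicator (fun _ => (1 : ℝ)) (x - y) with hk
  have hkm : MemLp k 2 := (memLp_indicator_const 2 hBm (1 : ℝ)
    (Or.inr measure_ball_lt_top.ne)).comp_measurePreserving
      (Measure.measurePreserving_sub_left volume x)
  have e : ∀ n, ∫ h in B, w n (x - h) = ∫ y, k y • w n y := by
    intro n
    rw [← integral_sub_left_eq_self (fun y => k y • w n y) volume x, ← integral_indicator hBm]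
    refine integral_congr_ae (Eventually.of_forall fun h => ?_)
    by_cases hh : h ∈ B <;> simp [hk, hh]
  suffices h : Tendsto (fun n => ∫ y, k y • w n y) atTop (𝓝 0) by
    have := h.const_smul (volume B).toReal⁻¹
    simp only [← e, smul_zero] at this
    exact this
  refine tendsto_zero_of_inner fun v => ?_
  have hkv : MemLp (fun y => k y • v) 2 := by
    simpa using hkm.continuousLinearMap_comp (ContinuousLinearMap.toSpanSingleton ℝ v)
  have := hl _ hkv
  simp only [inner_zero_left, integral_zero] at this
  refine this.congr fun n => ?_
  rw [real_inner_comm, ← integral_inner (integrable_smul_two hkm (hw n))]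
  refine integral_congr_ae (Eventually.of_forall fun y => ?_)
  simp [inner_smul_right, real_inner_comm]

end ballAvg

theorem enorm_sub_sq_le {F : Type*} [NormedAddCommGroup F] (a b : F) :
    ‖a - b‖ₑ ^ 2 ≤ 2 * ‖a‖ₑ ^ 2 + 2 * ‖b‖ₑ ^ 2 := by
  simpa [sub_eq_add_neg] using enorm_add_sq_le a (-b)

/-- Write `w n` as its average at scale `r` plus a remainder. The remainder is `O(r)` in `L²`
uniformly in `n`; for fixed `r` the averages tend to zero in `L²` of the ball by dominated
convergence. -/
theorem tendsto_lintegral_ball_of_weakTendsto_zero {w : ℕ → Space d → E}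
    {g : ℕ → Fin d → Space d → E} (h : ∀ n, IsSobolev (w n) (g n)) {S : ℝ≥0∞} (hS : S ≠ ⊤)
    (hw : ∀ n, ∫⁻ x, ‖w n x‖ₑ ^ 2 ≤ S) (hg : ∀ n, gradEnergy (g n) ≤ S)
    (hl : WeakTendsto w fun _ => 0) (R : ℝ) :
    Tendsto (fun n => ∫⁻ x in Metric.ball 0 R, ‖w n x‖ₑ ^ 2) atTop (𝓝 0) := by
  rw [ENNReal.tendsto_nhds_zero]
  intro ε hε
  have hr : ∃ r : ℝ, 0 < r ∧ 2 * (ENNReal.ofReal r ^ 2 * S) ≤ ε / 2 := by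
    have h1 : Tendsto (fun r : ℝ => 2 * (ENNReal.ofReal r ^ 2 * S)) (𝓝[>] 0) (𝓝 0) := by
      have h2 : Tendsto (fun r : ℝ => ENNReal.ofReal r ^ 2) (𝓝[>] 0) (𝓝 0) := by
        have := ENNReal.Tendsto.pow (n := 2) (ENNReal.tendsto_ofReal (tendsto_id (x := 𝓝 (0 : ℝ))))
        simpa using this.mono_left nhdsWithin_le_nhds
      have h3 := ENNReal.Tendsto.mul_const h2 (b := S) (Or.inr hS)
      rw [zero_mul] at h3
      simpa using ENNReal.Tendsto.const_mul h3 (a := 2) (Or.inr (by simp))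
    have h4 := h1.eventually_le_const (show (0 : ℝ≥0∞) < ε / 2 from ENNReal.half_pos hε.ne')
    obtain ⟨r, h5, h6⟩ := (h4.and self_mem_nhdsWithin).exists
    exact ⟨r, h6, h5⟩
  obtain ⟨r, hr0, hr⟩ := hr
  have hb0 : volume (Metric.ball (0 : Space d) r) ≠ 0 := (Metric.measure_ball_pos _ _ hr0).ne'
  have hA : Tendsto (fun n => 2 * ∫⁻ x in Metric.ball 0 R, ‖ballAvg r (w n) x‖ₑ ^ 2)
      atTop (𝓝 0) := by
    have h1 : Tendsto (fun n => ∫⁻ x in Metric.ball (0 : Space d) R, ‖ballAvg r (w n) x‖ₑ ^ 2)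
        atTop (𝓝 (∫⁻ x in Metric.ball (0 : Space d) R, 0)) := by
      refine tendsto_lintegral_of_dominated_convergence'
        (fun _ => (volume (Metric.ball (0 : Space d) r))⁻¹ * S) (fun n => ?_) (fun n => ?_) ?_ ?_
      · exact (aestronglyMeasurable_ballAvg (h n).memLp.1).restrict.enorm.pow_const 2
      · refine Eventually.of_forall fun x => (enorm_ballAvg_sq_le' hr0 (h n).memLp.1 x).trans ?_
        exact mul_le_mul' le_rfl (hw n)
      · rw [setLIntegral_const]
        exact ENNReal.mul_ne_top (ENNReal.mul_ne_top (ENNReal.inv_ne_top.2 hb0) hS)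
          measure_ball_lt_top.ne
      · refine Eventually.of_forall fun x => ?_
        have := tendsto_ballAvg (r := r) (fun n => (h n).memLp) hl x
        simpa using ENNReal.Tendsto.pow (n := 2) this.enorm
    rw [lintegral_zero] at h1
    simpa using ENNReal.Tendsto.const_mul h1 (a := 2) (Or.inr (by simp))
  filter_upwards [hA.eventually_le_const (show (0 : ℝ≥0∞) < ε / 2 from ENNReal.half_pos hε.ne')]
    with n hn
  have hbm := (aestronglyMeasurable_ballAvg (r := r) (h n).memLp.1)
  have m : AEMeasurable (fun x => ‖ballAvg r (w n) x - w n x‖ₑ ^ 2)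
      (volume.restrict (Metric.ball 0 R)) := (hbm.sub (h n).memLp.1).restrict.enorm.pow_const 2
  calc ∫⁻ x in Metric.ball 0 R, ‖w n x‖ₑ ^ 2
      ≤ ∫⁻ x in Metric.ball 0 R, (2 * ‖ballAvg r (w n) x‖ₑ ^ 2
        + 2 * ‖ballAvg r (w n) x - w n x‖ₑ ^ 2) := lintegral_mono fun x => by
          simpa using enorm_sub_sq_le (ballAvg r (w n) x) (ballAvg r (w n) x - w n x)
    _ = 2 * (∫⁻ x in Metric.ball 0 R, ‖ballAvg r (w n) x‖ₑ ^ 2)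
        + 2 * ∫⁻ x in Metric.ball 0 R, ‖ballAvg r (w n) x - w n x‖ₑ ^ 2 := by
          rw [lintegral_add_right' _ (m.const_mul 2), lintegral_const_mul' _ _ (by simp),
            lintegral_const_mul' _ _ (by simp)]
    _ ≤ ε / 2 + ε / 2 := by
        gcongr
        refine le_trans ?_ hr
        gcongr
        refine (lintegral_mono' Measure.restrict_le_self le_rfl).trans ?_
        refine ((h n).lintegral_sub_ballAvg_le hr0).trans ?_
        gcongr
        exact hg n
    _ = ε := ENNReal.add_halves ε

/-- **Rellich's theorem**: weak convergence in `H¹` implies strong convergence in `L²` on balls. -/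
theorem tendsto_lintegral_ball_of_weakTendsto {f : ℕ → Space d → E}
    {g : ℕ → Fin d → Space d → E} (h : ∀ n, IsSobolev (f n) (g n)) {f₀ : Space d → E}
    {g₀ : Fin d → Space d → E} (h₀ : IsSobolev f₀ g₀) {M : ℝ}
    (hf : ∀ n, ∫ x, ‖f n x‖ ^ 2 ≤ M) (hg : ∀ n, gradInt (g n) ≤ M) (hl : WeakTendsto f f₀)
    (R : ℝ) : Tendsto (fun n => ∫⁻ x in Metric.ball 0 R, ‖f n x - f₀ x‖ₑ ^ 2) atTop (𝓝 0) := by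
  have key : ∀ {u v : Space d → E}, MemLp u 2 → MemLp v 2 →
      ∫⁻ x, ‖u x - v x‖ₑ ^ 2 ≤ 2 * (∫⁻ x, ‖u x‖ₑ ^ 2) + 2 * ∫⁻ x, ‖v x‖ₑ ^ 2 := by
    intro u v hu hv
    rw [← lintegral_const_mul' _ _ (by simp), ← lintegral_const_mul' _ _ (by simp),
      ← lintegral_add_right' _ ((hv.1.enorm.pow_const 2).const_mul 2)]
    exact lintegral_mono fun x => enorm_sub_sq_le _ _
  have hw := fun n => (h n).sub h₀
  refine tendsto_lintegral_ball_of_weakTendsto_zero hw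
    (S := (2 * ENNReal.ofReal M + 2 * ∫⁻ x, ‖f₀ x‖ₑ ^ 2)
      + (2 * ENNReal.ofReal M + 2 * gradEnergy g₀)) ?_ (fun n => ?_) (fun n => ?_) ?_ R
  · rw [h₀.gradEnergy_eq, lintegral_enorm_sq h₀.memLp]
    finiteness
  · refine (key (h n).memLp h₀.memLp).trans (le_add_right ?_)
    gcongr
    rw [lintegral_enorm_sq (h n).memLp]
    exact ENNReal.ofReal_le_ofReal (hf n)
  · refine le_trans ?_ le_add_self
    calc gradEnergy (fun i x => g n i x - g₀ i x)
        ≤ ∑ i, (2 * (∫⁻ x, ‖g n i x‖ₑ ^ 2) + 2 * ∫⁻ x, ‖g₀ i x‖ₑ ^ 2) :=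
          Finset.sum_le_sum fun i _ => key ((h n).memLp_grad i) (h₀.memLp_grad i)
      _ = 2 * gradEnergy (g n) + 2 * gradEnergy g₀ := by
          rw [Finset.sum_add_distrib, ← Finset.mul_sum, ← Finset.mul_sum]; rfl
      _ ≤ _ := by
          gcongr
          rw [(h n).gradEnergy_eq]
          exact ENNReal.ofReal_le_ofReal (hg n)
  · intro k hk
    have h1 := (hl k hk).sub_const (∫ x, inner ℝ (f₀ x) (k x))
    simp only [sub_self] at h1
    simp only [inner_zero_left, integral_zero]
    refine h1.congr fun n => ?_
    rw [← integral_sub (integrable_inner_of_memLp (h n).memLp hk)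
      (integrable_inner_of_memLp h₀.memLp hk)]
    simp only [inner_sub_left]

/-! ### The closure of the test functions -/

/-- `u ∈ C_c^∞(Ω)`. -/
def IsTest (Ω : Set (Space d)) (u : Space d → E) : Prop :=
  ContDiff ℝ ∞ u ∧ HasCompactSupport u ∧ tsupport u ⊆ Ω

/-- The classical gradient. -/
def classicalGrad (u : Space d → E) (i : Fin d) (x : Space d) : E :=
  fderiv ℝ u x (EuclideanSpace.single i 1)

theorem isSobolev_of_contDiff {u : Space d → E} (hu : ContDiff ℝ ∞ u) (hc : HasCompactSupport u) :
    IsSobolev u (classicalGrad u) := by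
  refine ⟨memLp_of_continuous_hasCompactSupport hu.continuous hc, fun i =>
    memLp_of_continuous_hasCompactSupport (continuous_fderiv_apply hu _)
      (hasCompactSupport_fderiv_apply hc _), fun i ψ h1 h2 => ?_⟩
  have := integral_smul_fderiv_eq_neg_fderiv_smul_of_integrable (𝕜 := ℝ) (μ := volume)
    (f := ψ) (g := u) (v := EuclideanSpace.single i 1) ?_ ?_ ?_ ?_ ?_
  · simp only [classicalGrad]
    rw [this, neg_neg]
  · exact ((continuous_fderiv_apply h1 _).smul hu.continuous).integrable_of_hasCompactSupport
      (hasCompactSupport_fderiv_apply h2 _).smul_right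
  · exact (h1.continuous.smul (continuous_fderiv_apply hu _)).integrable_of_hasCompactSupport
      h2.smul_right
  · exact (h1.continuous.smul hu.continuous).integrable_of_hasCompactSupport h2.smul_right
  · exact fun x _ => h1.differentiable (by simp) x
  · exact fun x _ => hu.differentiable (by simp) x

theorem IsTest.isSobolev {Ω : Set (Space d)} {u : Space d → E} (hu : IsTest Ω u) :
    IsSobolev u (classicalGrad u) := isSobolev_of_contDiff hu.1 hu.2.1

/-- The test functions as a subspace of `L² × (L²)^d`. -/
def testSpace (Ω : Set (Space d)) (E : Type*) [NormedAddCommGroup E] [InnerProductSpace ℝ E]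
    [FiniteDimensional ℝ E] : Submodule ℝ (GradSpace d E) where
  carrier := {z | ∃ (u : Space d → E) (hu : IsTest Ω u), hu.isSobolev.toGradSpace = z}
  add_mem' := by
    rintro _ _ ⟨u, hu, rfl⟩ ⟨v, hv, rfl⟩
    have huv : IsTest Ω (u + v) := ⟨hu.1.add hv.1, hu.2.1.add hv.2.1,
      (tsupport_add u v).trans (Set.union_subset hu.2.2 hv.2.2)⟩
    refine ⟨u + v, huv, ?_⟩
    ext o : 1
    cases o with
    | none => exact MemLp.toLp_add hu.isSobolev.memLp hv.isSobolev.memLp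
    | some i =>
      refine Eq.trans ?_ (MemLp.toLp_add (hu.isSobolev.memLp_grad i) (hv.isSobolev.memLp_grad i))
      refine MemLp.toLp_congr (huv.isSobolev.memLp_grad i) ((hu.isSobolev.memLp_grad i).add
        (hv.isSobolev.memLp_grad i)) (Eventually.of_forall fun x => ?_)
      simp only [classicalGrad, Pi.add_apply]
      rw [fderiv_add (hu.1.differentiable (by simp) x) (hv.1.differentiable (by simp) x)]
      rfl
  zero_mem' := by
    have h0 : IsTest Ω (0 : Space d → E) :=
      ⟨contDiff_zero_fun, HasCompactSupport.zero, by simp [tsupport]⟩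
    refine ⟨0, h0, ?_⟩
    ext o : 1
    cases o with
    | none =>
      refine (Lp.eq_zero_iff_ae_eq_zero (f := h0.isSobolev.memLp.toLp)).2 ?_
      filter_upwards [h0.isSobolev.memLp.coeFn_toLp] with x hx
      rw [hx]
    | some i =>
      refine (Lp.eq_zero_iff_ae_eq_zero (f := (h0.isSobolev.memLp_grad i).toLp)).2 ?_
      filter_upwards [(h0.isSobolev.memLp_grad i).coeFn_toLp] with x hx
      rw [hx]
      simp [classicalGrad]
  smul_mem' := by
    rintro c _ ⟨u, hu, rfl⟩
    have hcu : IsTest Ω (c • u) := ⟨hu.1.const_smul c, hu.2.1.smul_left (f := fun _ => c),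
      (tsupport_smul_subset_right (fun _ => c) u).trans hu.2.2⟩
    refine ⟨c • u, hcu, ?_⟩
    ext o : 1
    cases o with
    | none => exact MemLp.toLp_const_smul c hu.isSobolev.memLp
    | some i =>
      refine Eq.trans ?_ (MemLp.toLp_const_smul c (hu.isSobolev.memLp_grad i))
      refine MemLp.toLp_congr (hcu.isSobolev.memLp_grad i)
        ((hu.isSobolev.memLp_grad i).const_smul c) (Eventually.of_forall fun x => ?_)
      simp only [classicalGrad, Pi.smul_apply]
      rw [fderiv_const_smul (hu.1.differentiable (by simp) x)]
      rfl

theorem mem_testSpace {Ω : Set (Space d)} {z : GradSpace d E} : z ∈ testSpace Ω E ↔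
    ∃ (u : Space d → E) (hu : IsTest Ω u), hu.isSobolev.toGradSpace = z := Iff.rfl

/-- Functions on the whole space which are limits in `H¹` of test functions on `Ω`. -/
def MemTestClosure (Ω : Set (Space d)) (f : Space d → E) : Prop :=
  ∃ g, IsSobolev f g ∧ ∃ u : ℕ → Space d → E, (∀ n, IsTest Ω (u n)) ∧
    Tendsto (fun n => ∫⁻ x, ‖u n x - f x‖ₑ ^ 2) atTop (𝓝 0) ∧
    ∀ i, Tendsto (fun n => ∫⁻ x, ‖classicalGrad (u n) i x - g i x‖ₑ ^ 2) atTop (𝓝 0)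

theorem tendsto_toGradSpace_iff {f : ℕ → Space d → E} {g : ℕ → Fin d → Space d → E}
    (h : ∀ n, IsSobolev (f n) (g n)) {f₀ : Space d → E} {g₀ : Fin d → Space d → E}
    (h₀ : IsSobolev f₀ g₀) :
    Tendsto (fun n => (h n).toGradSpace) atTop (𝓝 h₀.toGradSpace) ↔
      Tendsto (fun n => ∫⁻ x, ‖f n x - f₀ x‖ₑ ^ 2) atTop (𝓝 0) ∧
      ∀ i, Tendsto (fun n => ∫⁻ x, ‖g n i x - g₀ i x‖ₑ ^ 2) atTop (𝓝 0) := by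
  have hf : Tendsto (fun n => (h n).memLp.toLp) atTop (𝓝 h₀.memLp.toLp) ↔
      Tendsto (fun n => ∫⁻ x, ‖f n x - f₀ x‖ₑ ^ 2) atTop (𝓝 0) := by
    rw [Lp.tendsto_Lp_iff_tendsto_eLpNorm'', ← tendsto_eLpNorm_two_zero_iff]
    rfl
  have hg : ∀ i, Tendsto (fun n => ((h n).memLp_grad i).toLp) atTop
      (𝓝 (h₀.memLp_grad i).toLp) ↔
      Tendsto (fun n => ∫⁻ x, ‖g n i x - g₀ i x‖ₑ ^ 2) atTop (𝓝 0) := fun i => by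
    rw [Lp.tendsto_Lp_iff_tendsto_eLpNorm'', ← tendsto_eLpNorm_two_zero_iff]
    rfl
  rw [← hf]
  simp_rw [← hg]
  constructor
  · intro hl
    have h1 : ∀ o, Tendsto (fun n => (h n).toGradSpace o) atTop (𝓝 (h₀.toGradSpace o)) := fun o =>
      ((PiLp.continuous_apply 2 _ o).tendsto _).comp hl
    exact ⟨h1 none, fun i => h1 (some i)⟩
  · rintro ⟨h1, h2⟩
    refine ((PiLp.continuous_toLp 2 _).tendsto _).comp (tendsto_pi_nhds.2 fun o => ?_)
    cases o with
    | none => exact h1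
    | some i => exact h2 i

/-- This turns the class into a closed linear subspace of a Hilbert space, so that orthogonality
arguments apply. -/
theorem memTestClosure_iff {Ω : Set (Space d)} {f : Space d → E} {g : Fin d → Space d → E}
    (h : IsSobolev f g) :
    MemTestClosure Ω f ↔ h.toGradSpace ∈ (testSpace Ω E).topologicalClosure := by
  rw [← SetLike.mem_coe, Submodule.topologicalClosure_coe, mem_closure_iff_seq_limit]
  constructor
  · rintro ⟨g', h', u, hu, h1, h2⟩
    refine ⟨fun n => (hu n).isSobolev.toGradSpace, fun n => mem_testSpace.2 ⟨u n, hu n, rfl⟩, ?_⟩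
    rw [tendsto_toGradSpace_iff]
    refine ⟨h1, fun i => (h2 i).congr fun n => lintegral_congr_ae ?_⟩
    filter_upwards [h'.ae_unique h EventuallyEq.rfl i] with x hx
    rw [hx]
  · rintro ⟨z, hz, hl⟩
    choose u hu hz using fun n => mem_testSpace.1 (hz n)
    exact ⟨g, h, u, hu, (tendsto_toGradSpace_iff (fun n => (hu n).isSobolev) h).1
      (hl.congr fun n => (hz n).symm)⟩

theorem IsTest.memTestClosure {Ω : Set (Space d)} {u : Space d → E} (hu : IsTest Ω u) :
    MemTestClosure Ω u :=
  (memTestClosure_iff hu.isSobolev).2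
    (Submodule.le_topologicalClosure _ (mem_testSpace.2 ⟨u, hu, rfl⟩))

/-- The closure of the test functions is closed under weak convergence. -/
theorem MemTestClosure.of_tendsto {Ω : Set (Space d)} {f : ℕ → Space d → E}
    {g : ℕ → Fin d → Space d → E} (hf : ∀ n, MemTestClosure Ω (f n))
    (h : ∀ n, IsSobolev (f n) (g n)) {f₀ : Space d → E} (hf₀ : MemLp f₀ 2)
    (hlim : Tendsto (fun n => ∫⁻ x, ‖f n x - f₀ x‖ₑ ^ 2) atTop (𝓝 0)) {M : ℝ}
    (hM : ∀ n, ∫ x, ‖f n x‖ ^ 2 ≤ M) (hg : ∀ n, gradInt (g n) ≤ M) : MemTestClosure Ω f₀ := by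
  obtain ⟨g₀, h₀, s, -, hw, -⟩ := exists_isSobolev_of_tendsto h hf₀ hlim hM hg
  -- The closure of a subspace is its double orthogonal complement, hence weakly closed; strong
  -- convergence of the gradients is not needed.
  rw [memTestClosure_iff h₀, ← Submodule.orthogonal_orthogonal_eq_closure,
    Submodule.mem_orthogonal']
  intro y hy
  refine tendsto_nhds_unique (hw y) (tendsto_const_nhds.congr fun n => ?_)
  have h1 := (memTestClosure_iff (h (s n))).1 (hf (s n))
  rw [← Submodule.orthogonal_orthogonal_eq_closure, Submodule.mem_orthogonal'] at h1
  exact (h1 y hy).symm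

theorem MemTestClosure.congr {Ω : Set (Space d)} {f f' : Space d → E} (h : MemTestClosure Ω f)
    (hff' : f =ᵐ[volume] f') : MemTestClosure Ω f' := by
  obtain ⟨g, hg, u, hu, h1, h2⟩ := h
  refine ⟨g, hg.congr hff' fun _ => EventuallyEq.rfl, u, hu, h1.congr fun n => ?_, h2⟩
  refine lintegral_congr_ae ?_
  filter_upwards [hff'] with x hx
  rw [hx]

/-- Two linear maps at once cover forming pairs and, with `L' = 0`, changing the target space from
`ℝ` to `ℂ`. -/
theorem MemTestClosure.clm_add {Ω : Set (Space d)} {f : Space d → E} {f' : Space d → E'}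
    {G : Type*} [NormedAddCommGroup G] [InnerProductSpace ℝ G] [FiniteDimensional ℝ G]
    (hf : MemTestClosure Ω f) (hf' : MemTestClosure Ω f') (L : E →L[ℝ] G) (L' : E' →L[ℝ] G) :
    MemTestClosure Ω (fun x => L (f x) + L' (f' x)) := by
  obtain ⟨g, hg, u, hu, h1, h2⟩ := hf
  obtain ⟨g', hg', u', hu', h1', h2'⟩ := hf'
  have key : ∀ {v v₀ : Space d → E} {v' v₀' : Space d → E'}, MemLp (fun x => v' x - v₀' x) 2 →
      ∫⁻ x, ‖L (v x) + L' (v' x) - (L (v₀ x) + L' (v₀' x))‖ₑ ^ 2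
        ≤ 2 * ‖L‖ₑ ^ 2 * (∫⁻ x, ‖v x - v₀ x‖ₑ ^ 2)
          + 2 * ‖L'‖ₑ ^ 2 * ∫⁻ x, ‖v' x - v₀' x‖ₑ ^ 2 := by
    intro v v₀ v' v₀' hm
    rw [← lintegral_const_mul' _ _ (by finiteness), ← lintegral_const_mul' _ _ (by finiteness),
      ← lintegral_add_right' _ ((hm.1.enorm.pow_const 2).const_mul _)]
    refine lintegral_mono fun x => ?_
    have e : L (v x) + L' (v' x) - (L (v₀ x) + L' (v₀' x)) = L (v x - v₀ x) + L' (v' x - v₀' x) := by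
      simp only [map_sub]; abel
    rw [e]
    refine (enorm_add_sq_le _ _).trans ?_
    rw [mul_assoc, mul_assoc, ← mul_pow, ← mul_pow]
    gcongr
    · exact L.le_opENorm _
    · exact L'.le_opENorm _
  have lim : ∀ {a b : ℕ → ℝ≥0∞} {c : ℕ → ℝ≥0∞}, Tendsto a atTop (𝓝 0) → Tendsto b atTop (𝓝 0) →
      (∀ n, c n ≤ 2 * ‖L‖ₑ ^ 2 * a n + 2 * ‖L'‖ₑ ^ 2 * b n) → Tendsto c atTop (𝓝 0) := by
    intro a b c ha hb hc
    have h := (ENNReal.Tendsto.const_mul (a := 2 * ‖L‖ₑ ^ 2) ha (Or.inr (by finiteness))).add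
      (ENNReal.Tendsto.const_mul (a := 2 * ‖L'‖ₑ ^ 2) hb (Or.inr (by finiteness)))
    simp only [mul_zero, add_zero] at h
    exact tendsto_of_tendsto_of_tendsto_of_le_of_le tendsto_const_nhds h (fun _ => zero_le) hc
  have hcg : ∀ n i x, classicalGrad (fun x => L (u n x) + L' (u' n x)) i x
      = L (classicalGrad (u n) i x) + L' (classicalGrad (u' n) i x) := by
    intro n i x
    have d1 := ((hu n).1.differentiable (by simp) x).hasFDerivAt
    have d2 := ((hu' n).1.differentiable (by simp) x).hasFDerivAt
    have := (L.hasFDerivAt.comp x d1).add (L'.hasFDerivAt.comp x d2)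
    rw [classicalGrad, HasFDerivAt.fderiv (f := fun x => L (u n x) + L' (u' n x)) this]
    rfl
  refine ⟨_, (hg.clm L).add (hg'.clm L'), fun n x => L (u n x) + L' (u' n x), fun n => ?_, ?_, ?_⟩
  · refine ⟨(L.contDiff.comp (hu n).1).add (L'.contDiff.comp (hu' n).1),
      ((hu n).2.1.comp_left (g := L) (map_zero L)).add
        ((hu' n).2.1.comp_left (g := L') (map_zero L')), ?_⟩
    refine (tsupport_add (fun x => L (u n x)) (fun x => L' (u' n x))).trans
      (Set.union_subset ?_ ?_)
    · exact (closure_mono (Function.support_comp_subset (map_zero L) _)).trans (hu n).2.2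
    · exact (closure_mono (Function.support_comp_subset (map_zero L') _)).trans (hu' n).2.2
  · exact lim h1 h1' fun n => key ((hu' n).isSobolev.memLp.sub hg'.memLp)
  · intro i
    simp only [hcg]
    exact lim (h2 i) (h2' i) fun n => key (((hu' n).isSobolev.memLp_grad i).sub (hg'.memLp_grad i))

theorem abs_inner_div_sqrt_le (v w : E) {ε : ℝ} (hε : 0 < ε) :
    |inner ℝ v w / √(‖v‖ ^ 2 + ε ^ 2)| ≤ ‖w‖ := by
  rw [abs_div, abs_of_nonneg (Real.sqrt_nonneg _), div_le_iff₀ (by positivity), mul_comm]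
  refine (abs_real_inner_le_norm _ _).trans ?_
  gcongr
  exact Real.le_sqrt_of_sq_le (by nlinarith)

theorem gradInt_le_of_norm_le {g : Fin d → Space d → E} {g' : Fin d → Space d → E'}
    (hg : ∀ i, MemLp (g i) 2) (hg' : ∀ i, MemLp (g' i) 2)
    (h : ∀ i x, ‖g i x‖ ≤ ‖g' i x‖) : gradInt g ≤ gradInt g' :=
  Finset.sum_le_sum fun i _ => integral_mono ((hg i).integrable_norm_pow two_ne_zero)
    ((hg' i).integrable_norm_pow two_ne_zero) fun x => by
      have := h i x
      dsimp only
      gcongr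

theorem integral_sq_le_of_norm_le {f : Space d → E} {f' : Space d → E'}
    (hf : MemLp f 2) (hf' : MemLp f' 2) (h : ∀ x, ‖f x‖ ≤ ‖f' x‖) :
    ∫ x, ‖f x‖ ^ 2 ≤ ∫ x, ‖f' x‖ ^ 2 :=
  integral_mono (hf.integrable_norm_pow two_ne_zero) (hf'.integrable_norm_pow two_ne_zero)
    fun x => by
      have := h x
      dsimp only
      gcongr

theorem regNorm_lipschitz (v w : E) {ε : ℝ} (hε : 0 < ε) :
    ‖(√(‖v‖ ^ 2 + ε ^ 2) - ε) - (√(‖w‖ ^ 2 + ε ^ 2) - ε)‖ ≤ ‖v - w‖ := by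
  have h1 : 0 < √(‖v‖ ^ 2 + ε ^ 2) := by positivity
  have h2 : 0 < √(‖w‖ ^ 2 + ε ^ 2) := by positivity
  have s1 : √(‖v‖ ^ 2 + ε ^ 2) ^ 2 = ‖v‖ ^ 2 + ε ^ 2 := Real.sq_sqrt (by positivity)
  have s2 : √(‖w‖ ^ 2 + ε ^ 2) ^ 2 = ‖w‖ ^ 2 + ε ^ 2 := Real.sq_sqrt (by positivity)
  have l1 : ‖v‖ ≤ √(‖v‖ ^ 2 + ε ^ 2) := Real.le_sqrt_of_sq_le (by nlinarith)
  have l2 : ‖w‖ ≤ √(‖w‖ ^ 2 + ε ^ 2) := Real.le_sqrt_of_sq_le (by nlinarith)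
  have h3 := abs_le.1 (abs_norm_sub_norm_le v w)
  have h4 : (√(‖v‖ ^ 2 + ε ^ 2) - √(‖w‖ ^ 2 + ε ^ 2)) * (√(‖v‖ ^ 2 + ε ^ 2) + √(‖w‖ ^ 2 + ε ^ 2))
      = (‖v‖ - ‖w‖) * (‖v‖ + ‖w‖) := by nlinarith
  have hn := norm_nonneg (v - w)
  rw [Real.norm_eq_abs, abs_le]
  have hvw : 0 ≤ ‖v‖ + ‖w‖ := by positivity
  have hs : ‖v‖ + ‖w‖ ≤ √(‖v‖ ^ 2 + ε ^ 2) + √(‖w‖ ^ 2 + ε ^ 2) := add_le_add l1 l2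
  have hs0 := add_pos h1 h2
  constructor
  · have : -‖v - w‖ * (√(‖v‖ ^ 2 + ε ^ 2) + √(‖w‖ ^ 2 + ε ^ 2)) ≤
      (√(‖v‖ ^ 2 + ε ^ 2) - √(‖w‖ ^ 2 + ε ^ 2)) *
        (√(‖v‖ ^ 2 + ε ^ 2) + √(‖w‖ ^ 2 + ε ^ 2)) := by
      rw [h4]; nlinarith
    have := le_of_mul_le_mul_right this hs0
    linarith
  · have : (√(‖v‖ ^ 2 + ε ^ 2) - √(‖w‖ ^ 2 + ε ^ 2)) *
        (√(‖v‖ ^ 2 + ε ^ 2) + √(‖w‖ ^ 2 + ε ^ 2)) ≤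
        ‖v - w‖ * (√(‖v‖ ^ 2 + ε ^ 2) + √(‖w‖ ^ 2 + ε ^ 2)) := by
      rw [h4]; nlinarith
    have := le_of_mul_le_mul_right this hs0
    linarith

theorem MemTestClosure.norm {Ω : Set (Space d)} {f : Space d → E} (hf : MemTestClosure Ω f) :
    MemTestClosure Ω (fun x => ‖f x‖) := by
  obtain ⟨g, hg, u, hu, h1, h2⟩ := hf
  -- For fixed `ε` the regularized norm of a test function is smooth and keeps its support, so it is
  -- again a test function. The limit is taken first along the approximating test functions and then
  -- as `ε → 0`; bounded gradients suffice both times.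
  have hreg : ∀ ε : ℝ, 0 < ε → MemTestClosure Ω (fun x => √(‖f x‖ ^ 2 + ε ^ 2) - ε) := by
    intro ε hε
    have hb := (((tendsto_toGradSpace_iff (fun n => (hu n).isSobolev) hg).2 ⟨h1, h2⟩).norm.pow
      2).bddAbove_range
    obtain ⟨M, hM⟩ := hb
    have hM' : ∀ n, (∫ x, ‖u n x‖ ^ 2) + gradInt (classicalGrad (u n)) ≤ M := fun n => by
      rw [← (hu n).isSobolev.norm_toGradSpace_sq]
      exact hM (Set.mem_range_self n)
    have hs := fun n => (hu n).isSobolev.regNorm hε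
    have ht : ∀ n, IsTest Ω (fun x => √(‖u n x‖ ^ 2 + ε ^ 2) - ε) := by
      intro n
      have hz : √(‖(0 : E)‖ ^ 2 + ε ^ 2) - ε = 0 := by simp [Real.sqrt_sq hε.le]
      refine ⟨?_, (hu n).2.1.comp_left (g := fun v => √(‖v‖ ^ 2 + ε ^ 2) - ε) hz, ?_⟩
      · refine (ContDiff.sqrt (((hu n).1.norm_sq ℝ).add contDiff_const) fun x => ?_).sub
          contDiff_const
        positivity
      · exact (closure_mono (Function.support_comp_subset
          (g := fun v : E => √(‖v‖ ^ 2 + ε ^ 2) - ε) hz _)).trans (hu n).2.2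
    refine MemTestClosure.of_tendsto (fun n => (ht n).memTestClosure) hs (hg.regNorm hε).memLp
      ?_ (M := M) (fun n => ?_) fun n => ?_
    · refine tendsto_of_tendsto_of_tendsto_of_le_of_le tendsto_const_nhds h1 (fun _ => zero_le)
        fun n => lintegral_mono fun x => ?_
      gcongr
      rw [← ofReal_norm, ← ofReal_norm]
      exact ENNReal.ofReal_le_ofReal (regNorm_lipschitz _ _ hε)
    · refine (integral_sq_le_of_norm_le (hs n).memLp (hu n).isSobolev.memLp fun x => ?_).trans
        (le_trans (le_add_of_nonneg_right (gradInt_nonneg _)) (hM' n))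
      have := regNorm_bounds ‖u n x‖ (norm_nonneg _) hε.le
      rw [Real.norm_of_nonneg this.1]
      exact this.2.1
    · refine (gradInt_le_of_norm_le (hs n).memLp_grad (hu n).isSobolev.memLp_grad
        fun i x => ?_).trans (le_trans (le_add_of_nonneg_left
          (integral_nonneg fun _ => by positivity)) (hM' n))
      exact abs_inner_div_sqrt_le _ _ hε
  have hpos : ∀ n : ℕ, 0 < 1 / ((n : ℝ) + 1) := fun n => by positivity
  refine MemTestClosure.of_tendsto (fun n => hreg (1 / ((n : ℝ) + 1)) (hpos n))
    (fun n => hg.regNorm (hpos n)) hg.memLp.norm ?_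
    (M := (∫ x, ‖f x‖ ^ 2) + gradInt g) (fun n => ?_) fun n => ?_
  · have := tendsto_lintegral_of_dominated_convergence' (μ := volume) (f := fun _ => 0)
      (F := fun (n : ℕ) x => ‖√(‖f x‖ ^ 2 + (1 / ((n : ℝ) + 1)) ^ 2) - 1 / ((n : ℝ) + 1)
        - ‖f x‖‖ₑ ^ 2) (fun x => ‖f x‖ₑ ^ 2) (fun n => ?_) (fun n => ?_) ?_ ?_
    · simpa using this
    · exact (((hg.regNorm (hpos n)).memLp.sub hg.memLp.norm).1.enorm.pow_const 2)
    · refine Eventually.of_forall fun x => ?_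
      dsimp only
      gcongr
      rw [← ofReal_norm, ← ofReal_norm]
      refine ENNReal.ofReal_le_ofReal ?_
      have := regNorm_bounds ‖f x‖ (norm_nonneg _) (hpos n).le
      rw [Real.norm_eq_abs, abs_le]
      constructor <;> linarith [norm_nonneg (f x)]
    · exact (memLp_two_iff_lintegral.1 hg.memLp).2.ne
    · refine Eventually.of_forall fun x => ?_
      have := (((tendsto_const_nhds (x := ‖f x‖ ^ 2)).add
        (tendsto_one_div_add_one.pow 2)).sqrt.sub tendsto_one_div_add_one).sub_const ‖f x‖
      simpa using ENNReal.Tendsto.pow (n := 2) this.enorm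
  · refine (integral_sq_le_of_norm_le (hg.regNorm (hpos n)).memLp hg.memLp fun x => ?_).trans
      (le_add_of_nonneg_right (gradInt_nonneg _))
    have := regNorm_bounds ‖f x‖ (norm_nonneg _) (hpos n).le
    rw [Real.norm_of_nonneg this.1]
    exact this.2.1
  · refine (gradInt_le_of_norm_le (hg.regNorm (hpos n)).memLp_grad hg.memLp_grad
      fun i x => ?_).trans (le_add_of_nonneg_left (integral_nonneg fun _ => by positivity))
    exact abs_inner_div_sqrt_le _ _ (hpos n)

/-! ### The energy of Sobolev functions -/

/-- `weakPartial` is an arbitrary choice; this replaces it by any explicit weak derivative. -/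
theorem weakPartial_ae_eq {F : Type*} [NormedAddCommGroup F] [NormedSpace ℝ F] [CompleteSpace F]
    {Ω : Set (Space d)} (hΩ : IsOpen Ω) {f : Space d → F} {i : Fin d}
    {g : Space d → F} (h : HasWeakPartial Ω f i g) :
    weakPartial Ω f i =ᵐ[volume.restrict Ω] g := by
  have hex : ∃ g, HasWeakPartial Ω f i g := ⟨g, h⟩
  have hs : HasWeakPartial Ω f i (weakPartial Ω f i) := by
    rw [weakPartial, dif_pos hex]
    exact hex.choose_spec
  exact hs.ae_eq hΩ h

theorem gradSq_ae_eq {F : Type*} [NormedAddCommGroup F] [NormedSpace ℝ F] [CompleteSpace F]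
    {Ω : Set (Space d)} (hΩ : IsOpen Ω) {f : Space d → F}
    {g : Fin d → Space d → F} (h : ∀ i, HasWeakPartial Ω f i (g i)) :
    gradSq Ω f =ᵐ[volume.restrict Ω] fun x => ∑ i, ‖g i x‖ ^ 2 := by
  filter_upwards [ae_all_iff.2 fun i => weakPartial_ae_eq hΩ (h i)] with x hx
  simp only [gradSq, hx]

/-- The gradient of `|φ|²` in terms of the gradient of `φ`. -/
def rhoGrad (φ : Space d → E) (g : Fin d → Space d → E) (i : Fin d) (x : Space d) : ℝ :=
  2 * inner ℝ (φ x) (g i x)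

/-- The energy density in terms of a given gradient. -/
def density (V : Space d → ℝ) (β δ : ℝ) (φ : Space d → ℂ) (g : Fin d → Space d → ℂ)
    (x : Space d) : ℝ :=
  1 / 2 * (∑ i, ‖g i x‖ ^ 2) + V x * ‖φ x‖ ^ 2 + β / 2 * ‖φ x‖ ^ 4
    + δ / 2 * ∑ i, ‖rhoGrad φ g i x‖ ^ 2

theorem IsSobolev.energyDensity_ae_eq {φ : Space d → ℂ} {g : Fin d → Space d → ℂ}
    (h : IsSobolev φ g) (V : Space d → ℝ) (β δ : ℝ) :
    energyDensity Set.univ V β δ φ =ᵐ[volume] density V β δ φ g := by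
  have h1 := gradSq_ae_eq isOpen_univ h.hasWeakPartial
  have h2 := gradSq_ae_eq isOpen_univ h.hasWeakPartial_normSq
  rw [Measure.restrict_univ] at h1 h2
  filter_upwards [h1, h2] with x e1 e2
  rw [energyDensity, e1, e2]
  rfl

theorem IsSobolev.memH1 {φ : Space d → ℂ} {g : Fin d → Space d → ℂ} (h : IsSobolev φ g) :
    MemH1 Set.univ φ := by
  rw [MemH1, Measure.restrict_univ]
  exact ⟨h.memLp, fun i => ⟨g i, h.hasWeakPartial i, h.memLp_grad i⟩⟩

theorem MemH1.exists_isSobolev {φ : Space d → ℂ} (h : MemH1 Set.univ φ) :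
    ∃ g, IsSobolev φ g := by
  rw [MemH1, Measure.restrict_univ] at h
  choose g hg hg' using h.2
  exact ⟨g, .of_hasWeakPartial h.1 hg' hg⟩

theorem IsSobolev.mem_constraintSet_iff {φ : Space d → ℂ} {g : Fin d → Space d → ℂ}
    (h : IsSobolev φ g) (V : Space d → ℝ) (β δ : ℝ) :
    φ ∈ constraintSet Set.univ V β δ ↔ Integrable (fun x => V x * ‖φ x‖ ^ 2) ∧
      ∫ x, ‖φ x‖ ^ 2 = 1 ∧ Integrable (density V β δ φ g) := by
  rw [constraintSet, Set.mem_ofPred_eq, MemX, integrableOn_univ, integrableOn_univ,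
    Measure.restrict_univ, integrable_congr (h.energyDensity_ae_eq V β δ)]
  simp [h.memH1]

theorem IsSobolev.energy_eq {φ : Space d → ℂ} {g : Fin d → Space d → ℂ}
    (h : IsSobolev φ g) (V : Space d → ℝ) (β δ : ℝ) :
    energy Set.univ V β δ φ = ∫ x, density V β δ φ g x := by
  rw [energy, Measure.restrict_univ]
  exact integral_congr_ae (h.energyDensity_ae_eq V β δ)

/-- Functions satisfying the constraints, with all the terms of the energy finite. -/
structure Admissible (V : Space d → ℝ) (φ : Space d → ℂ) (g : Fin d → Space d → ℂ) : Prop where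
  isSobolev : IsSobolev φ g
  integrable_pot : Integrable fun x => V x * ‖φ x‖ ^ 2
  mass : ∫ x, ‖φ x‖ ^ 2 = 1
  isSobolev_sq : IsSobolev (fun x => ‖φ x‖ ^ 2) (rhoGrad φ g)

/-- The energy, term by term. -/
def splitEnergy (V : Space d → ℝ) (β δ : ℝ) (φ : Space d → ℂ) (g : Fin d → Space d → ℂ) : ℝ :=
  1 / 2 * gradInt g + (∫ x, V x * ‖φ x‖ ^ 2) + β / 2 * (∫ x, ‖φ x‖ ^ 4)
    + δ / 2 * gradInt (rhoGrad φ g)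

theorem integrable_sum_sq {g : Fin d → Space d → E} (hg : ∀ i, MemLp (g i) 2) :
    Integrable fun x => ∑ i, ‖g i x‖ ^ 2 :=
  integrable_finsetSum _ fun i _ => (hg i).integrable_norm_pow two_ne_zero

theorem integral_sum_sq {g : Fin d → Space d → E} (hg : ∀ i, MemLp (g i) 2) :
    ∫ x, ∑ i, ‖g i x‖ ^ 2 = gradInt g :=
  integral_finsetSum _ fun i _ => (hg i).integrable_norm_pow two_ne_zero

namespace Admissible

variable {V : Space d → ℝ} {φ : Space d → ℂ} {g : Fin d → Space d → ℂ}

theorem integrable_four (h : Admissible V φ g) : Integrable fun x => ‖φ x‖ ^ 4 := by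
  have := h.isSobolev_sq.memLp.integrable_norm_pow two_ne_zero
  refine this.congr (Eventually.of_forall fun x => ?_)
  simp only [norm_pow, norm_norm]
  ring

theorem integrable_sq (h : Admissible V φ g) : Integrable fun x => ‖φ x‖ ^ 2 :=
  h.isSobolev.memLp.integrable_norm_pow two_ne_zero

theorem integrable_density (h : Admissible V φ g) (β δ : ℝ) : Integrable (density V β δ φ g) :=
  ((((integrable_sum_sq h.isSobolev.memLp_grad).const_mul _).add h.integrable_pot).add
    (h.integrable_four.const_mul _)).add
    ((integrable_sum_sq h.isSobolev_sq.memLp_grad).const_mul _)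

theorem integral_density (h : Admissible V φ g) (β δ : ℝ) :
    ∫ x, density V β δ φ g x = splitEnergy V β δ φ g := by
  have h1 := (integrable_sum_sq h.isSobolev.memLp_grad).const_mul (1 / 2)
  have h2 := h.integrable_four.const_mul (β / 2)
  have h3 := (integrable_sum_sq h.isSobolev_sq.memLp_grad).const_mul (δ / 2)
  have h12 := h1.add h.integrable_pot
  have e1 := integral_add (h12.add h2) h3
  have e2 := integral_add h12 h2
  have e3 := integral_add h1 h.integrable_pot
  simp only [Pi.add_apply] at e1 e2
  simp only [density]
  rw [e1, e2, e3, integral_const_mul, integral_const_mul, integral_const_mul,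
    integral_sum_sq h.isSobolev.memLp_grad, integral_sum_sq h.isSobolev_sq.memLp_grad]
  rfl

theorem energy_eq (h : Admissible V φ g) (β δ : ℝ) :
    energy Set.univ V β δ φ = splitEnergy V β δ φ g := by
  rw [h.isSobolev.energy_eq, h.integral_density]

theorem mem_constraintSet (h : Admissible V φ g) (β δ : ℝ) :
    φ ∈ constraintSet Set.univ V β δ :=
  (h.isSobolev.mem_constraintSet_iff V β δ).2
    ⟨h.integrable_pot, h.mass, h.integrable_density β δ⟩

end Admissible

/-- Nash's inequality with real integrals. -/
theorem IsSobolev.nash_real {u : Space d → E} {g : Fin d → Space d → E} (hu : IsSobolev u g)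
    (hi : Integrable u) {r : ℝ} (hr : 0 < r) :
    ∫ x, ‖u x‖ ^ 2 ≤ r ^ 2 * gradInt g
      + 2 / (volume (Metric.ball (0 : Space d) r)).toReal * (∫ x, ‖u x‖) ^ 2 := by
  set b := volume (Metric.ball (0 : Space d) r) with hb
  have hb0 : b ≠ 0 := (Metric.measure_ball_pos _ _ hr).ne'
  have hbt : b ≠ ⊤ := measure_ball_lt_top.ne
  have hb' : 0 < b.toReal := ENNReal.toReal_pos hb0 hbt
  have h := hu.nash r
  have hI : 0 ≤ ∫ x, ‖u x‖ := integral_nonneg fun _ => norm_nonneg _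
  have hJ : 0 ≤ ∫ x, ‖u x‖ ^ 2 := integral_nonneg fun _ => by positivity
  have hG := gradInt_nonneg g
  have h2 : 2 * ENNReal.ofReal ((∫ x, ‖u x‖) ^ 2) = ENNReal.ofReal (2 * (∫ x, ‖u x‖) ^ 2) := by
    rw [ENNReal.ofReal_mul (by norm_num)]; simp
  rw [← hb, lintegral_enorm_sq hu.memLp, hu.gradEnergy_eq,
    ← ofReal_integral_norm_eq_lintegral_enorm hi, ← ENNReal.ofReal_toReal hbt,
    ← ENNReal.ofReal_pow hr.le, ← ENNReal.ofReal_pow hI, ← ENNReal.ofReal_mul hb'.le,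
    ← ENNReal.ofReal_mul (by positivity), ← ENNReal.ofReal_mul hb'.le, h2,
    ← ENNReal.ofReal_add (by positivity) (by positivity),
    ENNReal.ofReal_le_ofReal_iff (by positivity)] at h
  rw [div_mul_eq_mul_div, ← sub_le_iff_le_add', le_div_iff₀ hb']
  linarith

/-- The `L²` norm is controlled by a small multiple of the gradient and the `L¹` norm. -/
theorem exists_nash (d : ℕ) {ε : ℝ} (hε : 0 < ε) : ∃ C : ℝ, 0 ≤ C ∧
    ∀ (u : Space d → ℝ) (g : Fin d → Space d → ℝ), IsSobolev u g → Integrable u →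
      ∫ x, ‖u x‖ ^ 2 ≤ ε * gradInt g + C * (∫ x, ‖u x‖) ^ 2 := by
  refine ⟨2 / (volume (Metric.ball (0 : Space d) √ε)).toReal, by positivity,
    fun u g hu hi => ?_⟩
  simpa [Real.sq_sqrt hε.le] using hu.nash_real hi (Real.sqrt_pos.2 hε)

theorem lintegral_liminf_le_of_le {α : Type*} [MeasurableSpace α] {μ : Measure α}
    {f : ℕ → α → ℝ≥0∞} {f₀ : α → ℝ≥0∞} (hf : ∀ n, AEMeasurable (f n) μ)
    (hlim : ∀ᵐ x ∂μ, Tendsto (fun n => f n x) atTop (𝓝 (f₀ x))) {K : ℝ≥0∞}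
    (hK : ∃ᶠ n in atTop, ∫⁻ x, f n x ∂μ ≤ K) : ∫⁻ x, f₀ x ∂μ ≤ K := by
  calc ∫⁻ x, f₀ x ∂μ = ∫⁻ x, liminf (fun n => f n x) atTop ∂μ := lintegral_congr_ae (by
        filter_upwards [hlim] with x hx
        rw [hx.liminf_eq])
    _ ≤ liminf (fun n => ∫⁻ x, f n x ∂μ) atTop := lintegral_liminf_le' hf
    _ ≤ K := liminf_le_of_frequently_le hK

/-- Finite energy implies that `|φ|²` lies in `H¹`. -/
theorem IsSobolev.admissible {V : Space d → ℝ} {φ : Space d → ℂ} {g : Fin d → Space d → ℂ}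
    (h : IsSobolev φ g) {β δ : ℝ} (hδ : 0 < δ) (hφ : φ ∈ constraintSet Set.univ V β δ) :
    Admissible V φ g := by
  obtain ⟨hV, hmass, hdens⟩ := (h.mem_constraintSet_iff V β δ).1 hφ
  refine ⟨h, hV, hmass, ?_⟩
  have hρ : Integrable fun x => ‖φ x‖ ^ 2 := h.memLp.integrable_norm_pow two_ne_zero
  set R : Space d → ℝ := fun x => ∑ i, ‖rhoGrad φ g i x‖ ^ 2 with hR
  have hR0 : ∀ x, 0 ≤ R x := fun x => Finset.sum_nonneg fun _ _ => by positivity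
  -- Removing the kinetic and potential terms from the density leaves `D` integrable. For `β < 0`
  -- its two summands could cancel, so their separate integrability has to be proved.
  set D : Space d → ℝ := fun x => β / 2 * ‖φ x‖ ^ 4 + δ / 2 * R x with hD
  have hDi : Integrable D := by
    refine (hdens.sub (((integrable_sum_sq h.memLp_grad).const_mul (1 / 2)).add hV)).congr
      (Eventually.of_forall fun x => ?_)
    simp only [density, hD, hR, Pi.sub_apply, Pi.add_apply]
    ring
  -- Chosen so that `|β|/2` times this constant is at most `δ/4`, half of the coefficient of the `δ`
  -- term.
  obtain ⟨C, hC0, hC⟩ := exists_nash d (ε := δ / (2 * (|β| + 1))) (by positivity)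
  set K : ℝ := ∫ x, ‖D x‖ with hK
  have hK0 : 0 ≤ K := integral_nonneg fun _ => norm_nonneg _
  set c : ℕ → ℝ := fun n => 1 / ((n : ℝ) + 1) with hc
  have hcpos : ∀ n, 0 < c n := fun n => by simp only [hc]; positivity
  have hone : ∀ n x, 1 ≤ 1 + c n * ‖φ x‖ ^ 2 := fun n x => by
    have : 0 ≤ c n * ‖φ x‖ ^ 2 := mul_nonneg (hcpos n).le (by positivity)
    linarith
  set T : ℕ → Space d → ℝ := fun n x => ‖φ x‖ ^ 2 / (1 + c n * ‖φ x‖ ^ 2) with hT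
  set G : ℕ → Fin d → Space d → ℝ :=
    fun n i x => 2 * inner ℝ (φ x) (g i x) / (1 + c n * ‖φ x‖ ^ 2) ^ 2 with hG
  have hS : ∀ n, IsSobolev (T n) (G n) := fun n => h.truncSq (hcpos n)
  -- One weight serves both terms: `T² = w |φ|⁴` and `∇T = w ∇|φ|²`, so that `|∇T|² ≤ w R` because
  -- `w ≤ 1`.
  set w : ℕ → Space d → ℝ := fun n x => 1 / (1 + c n * ‖φ x‖ ^ 2) ^ 2 with hw
  have hw0 : ∀ n x, 0 ≤ w n x := fun n x => by
    have := hone n x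
    simp only [hw]; positivity
  have hw1 : ∀ n x, w n x ≤ 1 := fun n x => by
    have := one_le_pow₀ (n := 2) (hone n x)
    simp only [hw]
    rw [div_le_one (by positivity)]
    exact this
  have hwm : ∀ n, AEStronglyMeasurable (w n) volume := fun n => by
    have h1 : AEMeasurable (fun x => ‖φ x‖ ^ 2) volume := hρ.1.aemeasurable
    exact (((h1.const_mul (c n)).const_add 1).pow_const 2).const_div 1 |>.aestronglyMeasurable
  have hwlim : ∀ x, Tendsto (fun n => w n x) atTop (𝓝 1) := fun x => by
    have h1 : Tendsto (fun n => (1 + c n * ‖φ x‖ ^ 2) ^ 2) atTop (𝓝 1) := by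
      have := (((tendsto_one_div_add_one.mul_const (‖φ x‖ ^ 2)).const_add 1).pow 2)
      simpa [hc] using this
    simpa [hw] using h1.inv₀ one_ne_zero
  have hT2 : ∀ n x, ‖T n x‖ ^ 2 = w n x * ‖φ x‖ ^ 4 := fun n x => by
    simp only [hT, hw, Real.norm_eq_abs, sq_abs]
    rw [div_pow]
    ring
  have hT1 : ∀ n, ∫ x, ‖T n x‖ ≤ 1 := fun n => by
    rw [← hmass]
    refine integral_mono_of_nonneg (Eventually.of_forall fun _ => norm_nonneg _) hρ
      (Eventually.of_forall fun x => ?_)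
    have := hone n x
    simp only [hT]
    rw [Real.norm_of_nonneg (by positivity)]
    exact div_le_self (by positivity) this
  have hTi : ∀ n, Integrable (T n) := fun n =>
    hρ.mono (hS n).memLp.1 (Eventually.of_forall fun x => by
      have := hone n x
      simp only [hT]
      rw [Real.norm_of_nonneg (by positivity), Real.norm_of_nonneg (by positivity)]
      exact div_le_self (by positivity) this)
  have hT2i : ∀ n, Integrable fun x => w n x * ‖φ x‖ ^ 4 := fun n => by
    simpa only [hT2] using (hS n).memLp.integrable_norm_pow two_ne_zero
  have hwD : ∀ n, Integrable fun x => w n x * D x := fun n =>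
    hDi.bdd_mul (c := 1) (hwm n) (Eventually.of_forall fun x => by
      rw [Real.norm_of_nonneg (hw0 n x)]; exact hw1 n x)
  have hwR : ∀ n, Integrable fun x => w n x * R x := fun n => by
    refine (((hwD n).sub ((hT2i n).const_mul (β / 2))).const_mul (2 / δ)).congr
      (Eventually.of_forall fun x => ?_)
    simp only [hD, Pi.sub_apply]
    field_simp
    ring
  have hgrad : ∀ n, gradInt (G n) ≤ ∫ x, w n x * R x := fun n => by
    rw [← integral_sum_sq (hS n).memLp_grad]
    refine integral_mono (integrable_sum_sq (hS n).memLp_grad) (hwR n) fun x => ?_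
    simp only [hR, Finset.mul_sum]
    refine Finset.sum_le_sum fun i _ => ?_
    have e : G n i x = w n x * rhoGrad φ g i x := by
      simp only [hG, hw, rhoGrad]; ring
    rw [e, norm_mul, mul_pow, Real.norm_of_nonneg (hw0 n x)]
    refine mul_le_mul_of_nonneg_right ?_ (by positivity)
    nlinarith [hw0 n x, hw1 n x]
  -- From `δ/2 ∫ w R = ∫ w D - β/2 ∫ w|φ|⁴` and Nash for `T`, half of the left side is absorbed.
  -- This is legitimate because the truncated integrals are finite, and the resulting bound does not
  -- depend on `n`.
  have hbound : ∀ n, ∫ x, w n x * R x ≤ (K + |β| / 2 * C) * (4 / δ) := fun n => by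
    have e1 : δ / 2 * ∫ x, w n x * R x
        = (∫ x, w n x * D x) - β / 2 * ∫ x, w n x * ‖φ x‖ ^ 4 := by
      rw [← integral_const_mul, ← integral_const_mul, ← integral_sub (hwD n)
        ((hT2i n).const_mul _)]
      refine integral_congr_ae (Eventually.of_forall fun x => ?_)
      simp only [hD]
      ring
    have e2 : ∫ x, w n x * D x ≤ K := by
      refine integral_mono (hwD n) hDi.norm fun x => ?_
      refine (le_abs_self _).trans ?_
      rw [abs_mul, abs_of_nonneg (hw0 n x)]
      exact mul_le_of_le_one_left (abs_nonneg _) (hw1 n x)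
    have e3 : ∫ x, w n x * ‖φ x‖ ^ 4 ≤ δ / (2 * (|β| + 1)) * (∫ x, w n x * R x) + C := by
      have := hC _ _ (hS n) (hTi n)
      simp only [hT2] at this
      refine this.trans (add_le_add ?_ ?_)
      · exact mul_le_mul_of_nonneg_left (hgrad n) (by positivity)
      · refine mul_le_of_le_one_right hC0 (pow_le_one₀ (integral_nonneg fun _ => norm_nonneg _)
          (hT1 n))
    have h4 : 0 ≤ ∫ x, w n x * ‖φ x‖ ^ 4 :=
      integral_nonneg fun x => mul_nonneg (hw0 n x) (by positivity)
    have h5 : 0 ≤ ∫ x, w n x * R x := integral_nonneg fun x => mul_nonneg (hw0 n x) (hR0 x)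
    have e4 : -(β / 2 * ∫ x, w n x * ‖φ x‖ ^ 4)
        ≤ |β| / 2 * (δ / (2 * (|β| + 1)) * (∫ x, w n x * R x) + C) := by
      have a1 : -(β / 2 * ∫ x, w n x * ‖φ x‖ ^ 4) ≤ |β| / 2 * ∫ x, w n x * ‖φ x‖ ^ 4 := by
        nlinarith [neg_abs_le β]
      exact a1.trans (mul_le_mul_of_nonneg_left e3 (by positivity))
    have e5 : |β| / 2 * (δ / (2 * (|β| + 1))) ≤ δ / 4 := by
      rw [div_mul_div_comm, div_le_div_iff₀ (by positivity) (by norm_num)]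
      nlinarith [abs_nonneg β]
    have e6 : |β| / 2 * (δ / (2 * (|β| + 1))) * (∫ x, w n x * R x)
        ≤ δ / 4 * ∫ x, w n x * R x := mul_le_mul_of_nonneg_right e5 h5
    rw [mul_div_assoc', le_div_iff₀ hδ]
    nlinarith
  -- As the truncation is removed `w` tends to one, and Fatou's lemma carries the uniform bounds to
  -- the limit.
  have hRlim : ∫⁻ x, ENNReal.ofReal (R x) ≤ ENNReal.ofReal ((K + |β| / 2 * C) * (4 / δ)) := by
    refine lintegral_liminf_le_of_le (f := fun n x => ENNReal.ofReal (w n x * R x))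
      (fun n => (hwR n).1.aemeasurable.ennreal_ofReal) ?_
      (Eventually.of_forall fun n => ?_).frequently
    · refine Eventually.of_forall fun x => ENNReal.tendsto_ofReal ?_
      simpa using (hwlim x).mul_const (R x)
    · rw [← ofReal_integral_eq_lintegral_ofReal (hwR n)
        (Eventually.of_forall fun x => mul_nonneg (hw0 n x) (hR0 x))]
      exact ENNReal.ofReal_le_ofReal (hbound n)
  have hQlim : ∫⁻ x, ‖‖φ x‖ ^ 2‖ₑ ^ 2 ≤ ENNReal.ofReal
      (δ / (2 * (|β| + 1)) * ((K + |β| / 2 * C) * (4 / δ)) + C) := by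
    refine lintegral_liminf_le_of_le (f := fun n x => ‖T n x‖ₑ ^ 2)
      (fun n => (hS n).memLp.1.enorm.pow_const 2) ?_ (Eventually.of_forall fun n => ?_).frequently
    · refine Eventually.of_forall fun x => ENNReal.Tendsto.pow (Tendsto.enorm ?_)
      have h1 : Tendsto (fun n => 1 + c n * ‖φ x‖ ^ 2) atTop (𝓝 1) := by
        simpa [hc] using (tendsto_one_div_add_one.mul_const (‖φ x‖ ^ 2)).const_add 1
      simpa [Pi.div_def] using (tendsto_const_nhds (x := ‖φ x‖ ^ 2)).div h1 one_ne_zero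
    · rw [lintegral_enorm_sq (hS n).memLp]
      refine ENNReal.ofReal_le_ofReal ((hC _ _ (hS n) (hTi n)).trans (add_le_add ?_ ?_))
      · exact mul_le_mul_of_nonneg_left ((hgrad n).trans (hbound n)) (by positivity)
      · refine mul_le_of_le_one_right hC0 (pow_le_one₀ (integral_nonneg fun _ => norm_nonneg _)
          (hT1 n))
  refine IsSobolev.of_hasWeakPartial
    (memLp_two_iff_lintegral.2 ⟨hρ.1, hQlim.trans_lt ENNReal.ofReal_lt_top⟩) (fun i => ?_)
    fun i => h.hasWeakPartial_normSq i
  refine memLp_two_iff_lintegral.2 ⟨((h.integrable_inner i).const_mul 2).1, lt_of_le_of_lt ?_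
    (hRlim.trans_lt ENNReal.ofReal_lt_top)⟩
  refine lintegral_mono fun x => ?_
  rw [← ofReal_norm, ← ENNReal.ofReal_pow (norm_nonneg _)]
  refine ENNReal.ofReal_le_ofReal ?_
  exact Finset.single_le_sum (f := fun i => ‖rhoGrad φ g i x‖ ^ 2) (fun _ _ => by positivity)
    (Finset.mem_univ i)

/-! ### Existence of minimizers -/

theorem gradInt_sub_le {g g' : Fin d → Space d → E} (hg : ∀ i, MemLp (g i) 2)
    (hg' : ∀ i, MemLp (g' i) 2) :
    gradInt (fun i x => g i x - g' i x) ≤ 2 * gradInt g + 2 * gradInt g' := by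
  rw [gradInt, gradInt, gradInt, Finset.mul_sum, Finset.mul_sum, ← Finset.sum_add_distrib]
  refine Finset.sum_le_sum fun i _ => ?_
  have i1 := (hg i).integrable_norm_pow two_ne_zero
  have i2 := (hg' i).integrable_norm_pow two_ne_zero
  rw [← integral_const_mul, ← integral_const_mul, ← integral_add (i1.const_mul _) (i2.const_mul _)]
  refine integral_mono (((hg i).sub (hg' i)).integrable_norm_pow two_ne_zero)
    ((i1.const_mul _).add (i2.const_mul _)) fun x => ?_
  have := norm_sub_le (g i x) (g' i x)
  nlinarith [sq_nonneg (‖g i x‖ - ‖g' i x‖), norm_nonneg (g i x - g' i x)]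

/-- By Nash's inequality, `L¹` convergence of a sequence with bounded gradients is `L²`
convergence. -/
theorem tendsto_lintegral_sq_of_tendsto_integral {u : ℕ → Space d → ℝ}
    {g : ℕ → Fin d → Space d → ℝ} {u₀ : Space d → ℝ} (h : ∀ n, IsSobolev (u n) (g n))
    (hi : ∀ n, Integrable (u n)) (hi₀ : Integrable u₀) {M : ℝ} (hM : ∀ n, gradInt (g n) ≤ M)
    (hae : ∀ᵐ x, Tendsto (fun n => u n x) atTop (𝓝 (u₀ x)))
    (hL : Tendsto (fun n => ∫ x, ‖u n x - u₀ x‖) atTop (𝓝 0)) :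
    MemLp u₀ 2 ∧ Tendsto (fun n => ∫⁻ x, ‖u n x - u₀ x‖ₑ ^ 2) atTop (𝓝 0) := by
  have hM0 : 0 ≤ M := (gradInt_nonneg _).trans (hM 0)
  have key : ∀ η : ℝ, 0 < η → ∀ᶠ n in atTop, ∫⁻ x, ‖u n x - u₀ x‖ₑ ^ 2 ≤ ENNReal.ofReal η := by
    intro η hη
    -- The gradient of a difference of two members costs at most `4M` and its `L¹` norm at most
    -- `2t`; the constants make each contribution at most `η/2`.
    obtain ⟨C, hC0, hC⟩ := exists_nash d (ε := η / (8 * (M + 1))) (by positivity)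
    have ht : 0 < √(η / (8 * (C + 1))) := by positivity
    set t := √(η / (8 * (C + 1)))
    have ht2 : t ^ 2 = η / (8 * (C + 1)) := Real.sq_sqrt (by positivity)
    obtain ⟨N, hN⟩ := eventually_atTop.1 (hL.eventually_le_const ht)
    refine eventually_atTop.2 ⟨N, fun n hn => ?_⟩
    -- Nash needs Sobolev functions, which `u₀` is not yet known to be. It is applied to `u n - u
    -- m`, and Fatou's lemma lets `m → ∞`.
    refine lintegral_liminf_le_of_le (f := fun m x => ‖u n x - u m x‖ₑ ^ 2)
      (fun m => ((h n).memLp.1.sub (h m).memLp.1).enorm.pow_const 2) ?_ ?_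
    · filter_upwards [hae] with x hx
      exact ENNReal.Tendsto.pow (hx.const_sub _).enorm
    · refine (eventually_atTop.2 ⟨N, fun m hm => ?_⟩).frequently
      have hs := (h n).sub (h m)
      rw [lintegral_enorm_sq hs.memLp]
      refine ENNReal.ofReal_le_ofReal ((hC _ _ hs ((hi n).sub (hi m))).trans ?_)
      have a1 : ∫ x, ‖u n x - u m x‖ ≤ 2 * t := by
        calc ∫ x, ‖u n x - u m x‖ ≤ ∫ x, (‖u n x - u₀ x‖ + ‖u m x - u₀ x‖) :=
              integral_mono ((hi n).sub (hi m)).norm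
                (((hi n).sub hi₀).norm.add ((hi m).sub hi₀).norm) fun x => by
                  have := norm_sub_le (u n x - u₀ x) (u m x - u₀ x)
                  simpa using this
          _ = (∫ x, ‖u n x - u₀ x‖) + ∫ x, ‖u m x - u₀ x‖ :=
              integral_add ((hi n).sub hi₀).norm ((hi m).sub hi₀).norm
          _ ≤ 2 * t := by linarith [hN n hn, hN m hm]
      have a2 : gradInt (fun i x => g n i x - g m i x) ≤ 4 * M := by
        have := gradInt_sub_le (h n).memLp_grad (h m).memLp_grad
        linarith [hM n, hM m]
      have a3 : (∫ x, ‖u n x - u m x‖) ^ 2 ≤ (2 * t) ^ 2 :=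
        pow_le_pow_left₀ (integral_nonneg fun _ => norm_nonneg _) a1 2
      have b1 : η / (8 * (M + 1)) * (4 * M) ≤ η / 2 := by
        rw [div_mul_eq_mul_div, div_le_div_iff₀ (by positivity) (by norm_num)]
        nlinarith
      have b2 : C * (2 * t) ^ 2 ≤ η / 2 := by
        rw [mul_pow, ht2, ← mul_assoc, mul_div_assoc', div_le_div_iff₀ (by positivity)
          (by norm_num)]
        nlinarith
      calc _ ≤ η / (8 * (M + 1)) * (4 * M) + C * (2 * t) ^ 2 := by gcongr
        _ ≤ η := by linarith
  refine ⟨?_, ENNReal.tendsto_nhds_zero.2 fun ε hε => ?_⟩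
  · obtain ⟨n, hn⟩ := (key 1 one_pos).exists
    have : MemLp (fun x => u n x - u₀ x) 2 := memLp_two_iff_lintegral.2
      ⟨(h n).memLp.1.sub hi₀.1, hn.trans_lt ENNReal.ofReal_lt_top⟩
    exact ((h n).memLp.sub this).ae_eq (Eventually.of_forall fun x => sub_sub_cancel _ _)
  · rcases eq_or_ne ε ⊤ with rfl | hε'
    · simp
    · have := key ε.toReal (ENNReal.toReal_pos hε.ne' hε')
      rwa [ENNReal.ofReal_toReal hε'] at this

/-- A class of functions in `H¹` over which the energy can be minimized. -/
structure SobolevClass (A : (Space d → ℂ) → Prop) : Prop where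
  exists_grad : ∀ {φ}, A φ → ∃ g, IsSobolev φ g
  closed : ∀ {φ : ℕ → Space d → ℂ} {g : ℕ → Fin d → Space d → ℂ} {φ₀ : Space d → ℂ} {M : ℝ},
    (∀ n, A (φ n)) → (∀ n, IsSobolev (φ n) (g n)) → MemLp φ₀ 2 →
    Tendsto (fun n => ∫⁻ x, ‖φ n x - φ₀ x‖ₑ ^ 2) atTop (𝓝 0) →
    (∀ n, ∫ x, ‖φ n x‖ ^ 2 ≤ M) → (∀ n, gradInt (g n) ≤ M) → A φ₀
  mean : ∀ {φ₁ φ₂ : Space d → ℂ}, A φ₁ → A φ₂ →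
    A fun x => ((√((‖φ₁ x‖ ^ 2 + ‖φ₂ x‖ ^ 2) / 2) : ℝ) : ℂ)

theorem exists_ball_lintegral_compl_le {f : Space d → E} (hf : MemLp f 2) {ε : ℝ≥0∞}
    (hε : 0 < ε) : ∃ R₀ : ℝ, ∀ R, R₀ ≤ R → ∫⁻ x in (Metric.ball (0 : Space d) R)ᶜ, ‖f x‖ₑ ^ 2 ≤ ε := by
  have h := tendsto_lintegral_of_dominated_convergence' (μ := volume) (f := fun _ => 0)
    (F := fun (n : ℕ) => (Metric.ball (0 : Space d) n)ᶜ.indicator fun x => ‖f x‖ₑ ^ 2)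
    (fun x => ‖f x‖ₑ ^ 2)
    (fun n => (hf.1.enorm.pow_const 2).indicator Metric.isOpen_ball.measurableSet.compl)
    (fun n => Eventually.of_forall fun x => Set.indicator_le_self _ _ _)
    (memLp_two_iff_lintegral.1 hf).2.ne
    (Eventually.of_forall fun x => by
      obtain ⟨N, hN⟩ := exists_nat_gt ‖x‖
      refine tendsto_const_nhds.congr' (eventually_atTop.2 ⟨N, fun n hn => ?_⟩)
      have : x ∈ Metric.ball (0 : Space d) n := by
        rw [mem_ball_zero_iff]
        exact hN.trans_le (by exact_mod_cast hn)
      simp [this])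
  simp only [lintegral_zero] at h
  obtain ⟨n, hn⟩ := ((ENNReal.tendsto_nhds_zero.1 h) ε hε).exists
  rw [lintegral_indicator Metric.isOpen_ball.measurableSet.compl] at hn
  refine ⟨n, fun R hR => le_trans ?_ hn⟩
  exact lintegral_mono_set (Set.compl_subset_compl.2 (Metric.ball_subset_ball hR))

/-- Sequences with bounded gradients and bounded potential energy are compact in `L²`. -/
theorem exists_strong_limit {V : Space d → ℝ} (hV0 : ∀ x, 0 ≤ V x)
    (hVc : Tendsto V (cocompact (Space d)) atTop) {φ : ℕ → Space d → ℂ}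
    {g : ℕ → Fin d → Space d → ℂ} (h : ∀ n, Admissible V (φ n) (g n)) {B : ℝ}
    (hg : ∀ n, gradInt (g n) ≤ B) (hP : ∀ n, ∫ x, V x * ‖φ n x‖ ^ 2 ≤ B) :
    ∃ (φ₀ : Space d → ℂ) (g₀ : Fin d → Space d → ℂ) (s : ℕ → ℕ), StrictMono s ∧
      IsSobolev φ₀ g₀ ∧ Tendsto (fun n => ∫⁻ x, ‖φ (s n) x - φ₀ x‖ₑ ^ 2) atTop (𝓝 0) := by
  have hB0 : 0 ≤ B := (gradInt_nonneg _).trans (hg 0)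
  have hS := fun n => (h n).isSobolev
  obtain ⟨φ₀, g₀, h₀, s, hs, -, hw, -⟩ := exists_weak_limit_sobolev hS (M := max 1 B)
    (fun n => (h n).mass.le.trans (le_max_left _ _)) (fun n => (hg n).trans (le_max_right _ _))
  refine ⟨φ₀, g₀, s, hs, h₀, ENNReal.tendsto_nhds_zero.2 fun ε hε => ?_⟩
  rcases eq_or_ne ε ⊤ with rfl | hεt
  · simp
  -- The tails of `φ (s n)` and of `φ₀` each enter with a factor `2`, adding up to `ε / 2`.
  have h4 : 0 < ε / 8 := ENNReal.div_pos hε.ne' (by simp)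
  have h4' : ε / 8 ≠ ⊤ := ENNReal.div_ne_top hεt (by simp)
  obtain ⟨R₀, hR₀⟩ := exists_ball_lintegral_compl_le h₀.memLp h4
  set e := (ε / 8).toReal with he
  have he0 : 0 < e := ENNReal.toReal_pos h4.ne' h4'
  obtain ⟨R₁, hR₁⟩ := Metric.closedBall_compl_subset_of_mem_cocompact
    (hVc.eventually_ge_atTop ((B + 1) / e)) 0
  -- The `+ 1` puts the complement of the open ball of radius `R` inside the complement of the
  -- closed ball of radius `R₁`.
  set R := max R₀ (R₁ + 1)
  have hVR : ∀ x ∈ (Metric.ball (0 : Space d) R)ᶜ, (B + 1) / e ≤ V x := fun x hx => hR₁ (by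
    simp only [Set.mem_compl_iff, Metric.mem_ball, not_lt, Metric.mem_closedBall, not_le] at hx ⊢
    have := le_max_right R₀ (R₁ + 1)
    linarith)
  have hBm : MeasurableSet (Metric.ball (0 : Space d) R) := Metric.isOpen_ball.measurableSet
  -- Chebyshev's inequality: outside the ball `V ≥ (B + 1)/e`, while the potential energy is at most
  -- `B`.
  have tail : ∀ n, ∫⁻ x in (Metric.ball (0 : Space d) R)ᶜ, ‖φ n x‖ₑ ^ 2 ≤ ε / 8 := by
    intro n
    have hint : Integrable fun x => e / (B + 1) * (V x * ‖φ n x‖ ^ 2) :=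
      (h n).integrable_pot.const_mul _
    calc ∫⁻ x in (Metric.ball (0 : Space d) R)ᶜ, ‖φ n x‖ₑ ^ 2
        ≤ ∫⁻ x in (Metric.ball (0 : Space d) R)ᶜ,
            ENNReal.ofReal (e / (B + 1) * (V x * ‖φ n x‖ ^ 2)) := by
          refine setLIntegral_mono' hBm.compl fun x hx => ?_
          rw [← ofReal_norm, ← ENNReal.ofReal_pow (norm_nonneg _)]
          refine ENNReal.ofReal_le_ofReal ?_
          have h1 := hVR x hx
          rw [div_le_iff₀ he0] at h1
          rw [div_mul_eq_mul_div, le_div_iff₀ (by positivity)]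
          nlinarith [mul_le_mul_of_nonneg_right h1 (sq_nonneg ‖φ n x‖)]
      _ ≤ ∫⁻ x, ENNReal.ofReal (e / (B + 1) * (V x * ‖φ n x‖ ^ 2)) :=
          lintegral_mono' Measure.restrict_le_self le_rfl
      _ = ENNReal.ofReal (e / (B + 1) * ∫ x, V x * ‖φ n x‖ ^ 2) := by
          rw [← ofReal_integral_eq_lintegral_ofReal hint (Eventually.of_forall fun x => ?_),
            integral_const_mul]
          have := hV0 x
          dsimp only
          positivity
      _ ≤ ENNReal.ofReal e := by
          refine ENNReal.ofReal_le_ofReal ?_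
          rw [div_mul_eq_mul_div, div_le_iff₀ (by positivity)]
          nlinarith [hP n]
      _ = ε / 8 := ENNReal.ofReal_toReal h4'
  have hloc := tendsto_lintegral_ball_of_weakTendsto (fun n => hS (s n)) h₀ (M := max 1 B)
    (fun n => (h (s n)).mass.le.trans (le_max_left _ _))
    (fun n => (hg (s n)).trans (le_max_right _ _)) hw R
  filter_upwards [(ENNReal.tendsto_nhds_zero.1 hloc) (ε / 2) (ENNReal.half_pos hε.ne')] with n hn
  have m0 : AEMeasurable (fun x => ‖φ₀ x‖ₑ ^ 2)
      (volume.restrict (Metric.ball (0 : Space d) R)ᶜ) :=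
    h₀.memLp.1.restrict.enorm.pow_const 2
  calc ∫⁻ x, ‖φ (s n) x - φ₀ x‖ₑ ^ 2
      = (∫⁻ x in Metric.ball 0 R, ‖φ (s n) x - φ₀ x‖ₑ ^ 2)
        + ∫⁻ x in (Metric.ball 0 R)ᶜ, ‖φ (s n) x - φ₀ x‖ₑ ^ 2 := (lintegral_add_compl _ hBm).symm
    _ ≤ ε / 2 + (2 * (∫⁻ x in (Metric.ball 0 R)ᶜ, ‖φ (s n) x‖ₑ ^ 2)
        + 2 * ∫⁻ x in (Metric.ball 0 R)ᶜ, ‖φ₀ x‖ₑ ^ 2) := by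
        refine add_le_add hn ?_
        rw [← lintegral_const_mul' _ _ (by simp), ← lintegral_const_mul' _ _ (by simp),
          ← lintegral_add_right' _ (m0.const_mul 2)]
        exact lintegral_mono fun x => enorm_sub_sq_le _ _
    _ ≤ ε / 2 + (2 * (ε / 8) + 2 * (ε / 8)) := by
        gcongr
        · exact tail _
        · exact hR₀ R (le_max_left _ _)
    _ = ε := by
        have : 2 * (ε / 8) + 2 * (ε / 8) = ε / 2 := by
          rw [← add_mul, mul_comm, ENNReal.div_eq_inv_mul, ENNReal.div_eq_inv_mul, mul_right_comm]
          congr 1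
          rw [show (8 : ℝ≥0∞) = 4 * 2 by norm_num, ENNReal.mul_inv (by simp) (by simp),
            mul_right_comm, show (2 : ℝ≥0∞) + 2 = 4 by norm_num,
            ENNReal.inv_mul_cancel (by simp) (by simp), one_mul]
        rw [this, ENNReal.add_halves]

theorem integral_pot_nonneg {V : Space d → ℝ} (hV0 : ∀ x, 0 ≤ V x) (φ : Space d → ℂ) :
    0 ≤ ∫ x, V x * ‖φ x‖ ^ 2 :=
  integral_nonneg fun x => mul_nonneg (hV0 x) (by positivity)

/-- The energy is coercive. -/
theorem exists_energy_lower_bound (d : ℕ) (β : ℝ) {δ : ℝ} (hδ : 0 < δ) : ∃ C : ℝ,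
    ∀ (V : Space d → ℝ) (φ : Space d → ℂ) (g : Fin d → Space d → ℂ), Admissible V φ g →
      1 / 2 * gradInt g + (∫ x, V x * ‖φ x‖ ^ 2) + δ / 4 * gradInt (rhoGrad φ g) - C
        ≤ splitEnergy V β δ φ g := by
  -- Nash is applied to the density, whose `L¹` norm is the mass one; the constant lets the quartic
  -- term consume at most half of the `δ` term.
  obtain ⟨C, hC0, hC⟩ := exists_nash d (ε := δ / (2 * (|β| + 1))) (by positivity)
  refine ⟨|β| / 2 * C, fun V φ g h => ?_⟩
  have h1 := hC _ _ h.isSobolev_sq h.integrable_sq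
  have e1 : ∫ x, ‖‖φ x‖ ^ 2‖ ^ 2 = ∫ x, ‖φ x‖ ^ 4 := by
    congr 1; ext x; simp only [norm_pow, norm_norm]; ring
  have e2 : ∫ x, ‖‖φ x‖ ^ 2‖ = 1 := by
    rw [← h.mass]; congr 1; ext x; simp
  rw [e1, e2, one_pow, mul_one] at h1
  have h4 : 0 ≤ ∫ x, ‖φ x‖ ^ 4 := integral_nonneg fun x => by positivity
  have hG := gradInt_nonneg (rhoGrad φ g)
  have a1 : -(β / 2 * ∫ x, ‖φ x‖ ^ 4) ≤ |β| / 2 * ∫ x, ‖φ x‖ ^ 4 := by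
    nlinarith [neg_abs_le β]
  have a2 := mul_le_mul_of_nonneg_left h1 (show 0 ≤ |β| / 2 by positivity)
  have e5 : |β| / 2 * (δ / (2 * (|β| + 1))) ≤ δ / 4 := by
    rw [div_mul_div_comm, div_le_div_iff₀ (by positivity) (by norm_num)]
    nlinarith [abs_nonneg β]
  have a3 := mul_le_mul_of_nonneg_right e5 hG
  rw [splitEnergy]
  nlinarith

theorem sq_lintegral_mul_le_mul {α : Type*} [MeasurableSpace α] {μ : Measure α} {a b : α → ℝ≥0∞}
    (ha : AEMeasurable a μ) (hb : AEMeasurable b μ) :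
    (∫⁻ x, a x * b x ∂μ) ^ 2 ≤ (∫⁻ x, a x ^ 2 ∂μ) * ∫⁻ x, b x ^ 2 ∂μ := by
  have h := pow_le_pow_left' (ENNReal.lintegral_mul_le_Lp_mul_Lq μ Real.HolderConjugate.two_two
    ha hb) 2
  rw [mul_pow, ← ENNReal.rpow_natCast (_ ^ _), ← ENNReal.rpow_natCast (_ ^ _), ← ENNReal.rpow_mul,
    ← ENNReal.rpow_mul] at h
  simpa using h

/-- Cauchy–Schwarz applied to `||a|² - |b|²| ≤ |a - b| (|a| + |b|)`. -/
theorem tendsto_integral_abs_sq_sub {φ : ℕ → Space d → E} {φ₀ : Space d → E}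
    (h : ∀ n, MemLp (φ n) 2) (h₀ : MemLp φ₀ 2) {M : ℝ} (hM : ∀ n, ∫ x, ‖φ n x‖ ^ 2 ≤ M)
    (hlim : Tendsto (fun n => ∫⁻ x, ‖φ n x - φ₀ x‖ₑ ^ 2) atTop (𝓝 0)) :
    Tendsto (fun n => ∫ x, ‖‖φ n x‖ ^ 2 - ‖φ₀ x‖ ^ 2‖) atTop (𝓝 0) := by
  set K : ℝ := 2 * M + 2 * ∫ x, ‖φ₀ x‖ ^ 2 with hK
  have hsum : ∀ n, MemLp (fun x => ‖φ n x‖ + ‖φ₀ x‖) 2 := fun n => (h n).norm.add h₀.norm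
  have hb : ∀ n, ∫⁻ x, ‖‖φ n x‖ + ‖φ₀ x‖‖ₑ ^ 2 ≤ ENNReal.ofReal K := by
    intro n
    rw [lintegral_enorm_sq (hsum n)]
    refine ENNReal.ofReal_le_ofReal ?_
    have i1 := (h n).integrable_norm_pow two_ne_zero
    have i2 := h₀.integrable_norm_pow two_ne_zero
    calc ∫ x, ‖‖φ n x‖ + ‖φ₀ x‖‖ ^ 2 ≤ ∫ x, (2 * ‖φ n x‖ ^ 2 + 2 * ‖φ₀ x‖ ^ 2) :=
          integral_mono ((hsum n).integrable_norm_pow two_ne_zero)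
            ((i1.const_mul 2).add (i2.const_mul 2)) fun x => by
              simp only [Real.norm_eq_abs, sq_abs]
              nlinarith [sq_nonneg (‖φ n x‖ - ‖φ₀ x‖)]
      _ = 2 * (∫ x, ‖φ n x‖ ^ 2) + 2 * ∫ x, ‖φ₀ x‖ ^ 2 := by
          rw [integral_add (i1.const_mul 2) (i2.const_mul 2), integral_const_mul,
            integral_const_mul]
      _ ≤ K := by rw [hK]; linarith [hM n]
  have hint : ∀ n, Integrable fun x => ‖φ n x‖ ^ 2 - ‖φ₀ x‖ ^ 2 := fun n =>
    ((h n).integrable_norm_pow two_ne_zero).sub (h₀.integrable_norm_pow two_ne_zero)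
  have hsq : Tendsto (fun n => ENNReal.ofReal ((∫ x, ‖‖φ n x‖ ^ 2 - ‖φ₀ x‖ ^ 2‖) ^ 2))
      atTop (𝓝 0) := by
    have hc : Tendsto (fun n => (∫⁻ x, ‖φ n x - φ₀ x‖ₑ ^ 2) * ENNReal.ofReal K) atTop (𝓝 0) := by
      simpa using ENNReal.Tendsto.mul_const hlim (b := ENNReal.ofReal K)
        (Or.inr ENNReal.ofReal_ne_top)
    refine tendsto_of_tendsto_of_tendsto_of_le_of_le tendsto_const_nhds hc (fun _ => zero_le)
      fun n => ?_
    dsimp only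
    rw [ENNReal.ofReal_pow (integral_nonneg fun _ => norm_nonneg _),
      ofReal_integral_norm_eq_lintegral_enorm (hint n)]
    calc (∫⁻ x, ‖‖φ n x‖ ^ 2 - ‖φ₀ x‖ ^ 2‖ₑ) ^ 2
        ≤ (∫⁻ x, ‖φ n x - φ₀ x‖ₑ * ‖‖φ n x‖ + ‖φ₀ x‖‖ₑ) ^ 2 := by
          gcongr with x
          rw [sq_sub_sq, mul_comm, enorm_mul]
          gcongr
          rw [← ofReal_norm, ← ofReal_norm]
          exact ENNReal.ofReal_le_ofReal (abs_norm_sub_norm_le _ _)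
      _ ≤ (∫⁻ x, ‖φ n x - φ₀ x‖ₑ ^ 2) * ∫⁻ x, ‖‖φ n x‖ + ‖φ₀ x‖‖ₑ ^ 2 :=
          sq_lintegral_mul_le_mul ((h n).sub h₀).1.enorm (hsum n).1.enorm
      _ ≤ _ := by gcongr; exact hb n
  have := ((ENNReal.tendsto_toReal (a := 0) (by simp)).comp hsq).sqrt
  simp only [ENNReal.toReal_zero, Real.sqrt_zero] at this
  refine this.congr fun n => ?_
  simp only [Function.comp_apply]
  rw [ENNReal.toReal_ofReal (sq_nonneg _), Real.sqrt_sq (integral_nonneg fun _ => norm_nonneg _)]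

theorem tendsto_integral_sq {φ : ℕ → Space d → E} {φ₀ : Space d → E}
    (h : ∀ n, MemLp (φ n) 2) (h₀ : MemLp φ₀ 2)
    (hlim : Tendsto (fun n => ∫⁻ x, ‖φ n x - φ₀ x‖ₑ ^ 2) atTop (𝓝 0)) :
    Tendsto (fun n => ∫ x, ‖φ n x‖ ^ 2) atTop (𝓝 (∫ x, ‖φ₀ x‖ ^ 2)) := by
  have hl : Tendsto (fun n => (h n).toLp) atTop (𝓝 h₀.toLp) := by
    rw [Lp.tendsto_Lp_iff_tendsto_eLpNorm'']
    exact tendsto_eLpNorm_two_zero_iff.2 hlim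
  have := hl.inner hl (𝕜 := ℝ)
  simp only [inner_toLp] at this
  simpa only [real_inner_self_eq_norm_sq] using this

theorem exists_ae_subseq {φ : ℕ → Space d → E} {φ₀ : Space d → E}
    (h : ∀ n, MemLp (φ n) 2) (h₀ : MemLp φ₀ 2)
    (hlim : Tendsto (fun n => ∫⁻ x, ‖φ n x - φ₀ x‖ₑ ^ 2) atTop (𝓝 0)) :
    ∃ s : ℕ → ℕ, StrictMono s ∧ ∀ᵐ x, Tendsto (fun n => φ (s n) x) atTop (𝓝 (φ₀ x)) :=
  (tendstoInMeasure_of_tendsto_eLpNorm two_ne_zero (fun n => (h n).1) h₀.1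
    (tendsto_eLpNorm_two_zero_iff.2 hlim)).exists_seq_tendsto_ae

/-- The energy is lower semicontinuous along strongly converging sequences. -/
theorem splitEnergy_le_of_tendsto {V : Space d → ℝ} (hV0 : ∀ x, 0 ≤ V x)
    (hVm : AEStronglyMeasurable V) {β δ : ℝ} (hδ : 0 < δ) {φ : ℕ → Space d → ℂ}
    {g : ℕ → Fin d → Space d → ℂ} (h : ∀ n, Admissible V (φ n) (g n)) {φ₀ : Space d → ℂ}
    {g₀ : Fin d → Space d → ℂ} (h₀ : IsSobolev φ₀ g₀)
    (hlim : Tendsto (fun n => ∫⁻ x, ‖φ n x - φ₀ x‖ₑ ^ 2) atTop (𝓝 0))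
    (hae : ∀ᵐ x, Tendsto (fun n => φ n x) atTop (𝓝 (φ₀ x))) {a b c m : ℝ}
    (ha : Tendsto (fun n => gradInt (g n)) atTop (𝓝 a))
    (hb : Tendsto (fun n => ∫ x, V x * ‖φ n x‖ ^ 2) atTop (𝓝 b))
    (hc : Tendsto (fun n => gradInt (rhoGrad (φ n) (g n))) atTop (𝓝 c))
    (hm : Tendsto (fun n => splitEnergy V β δ (φ n) (g n)) atTop (𝓝 m)) :
    Admissible V φ₀ g₀ ∧ splitEnergy V β δ φ₀ g₀ ≤ m := by
  have hS := fun n => (h n).isSobolev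
  have hmass : ∫ x, ‖φ₀ x‖ ^ 2 = 1 := by
    have := tendsto_integral_sq (fun n => (hS n).memLp) h₀.memLp hlim
    simp only [fun n => (h n).mass] at this
    exact tendsto_nhds_unique this tendsto_const_nhds
  have hsq₀ : Integrable fun x => ‖φ₀ x‖ ^ 2 := h₀.memLp.integrable_norm_pow two_ne_zero
  have hL1 := tendsto_integral_abs_sq_sub (fun n => (hS n).memLp) h₀.memLp
    (fun n => (h n).mass.le) hlim
  have haeρ : ∀ᵐ x, Tendsto (fun n => ‖φ n x‖ ^ 2) atTop (𝓝 (‖φ₀ x‖ ^ 2)) := by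
    filter_upwards [hae] with x hx
    exact hx.norm.pow 2
  obtain ⟨M, hM⟩ := hc.bddAbove_range
  have hM' : ∀ n, gradInt (rhoGrad (φ n) (g n)) ≤ M := fun n => hM (Set.mem_range_self n)
  -- The coefficient `β` may be negative, so lower semicontinuity of the quartic term would not
  -- suffice: the densities have to converge strongly in `L²`.
  obtain ⟨hρ2, hρlim⟩ := tendsto_lintegral_sq_of_tendsto_integral (fun n => (h n).isSobolev_sq)
    (fun n => (h n).integrable_sq) hsq₀ hM' haeρ hL1
  have hρint := tendsto_integral_sq (fun n => (h n).isSobolev_sq.memLp) hρ2 hρlim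
  obtain ⟨M', hM2⟩ := hρint.bddAbove_range
  have hM2' : ∀ n, ∫ x, ‖‖φ n x‖ ^ 2‖ ^ 2 ≤ M' := fun n => hM2 (Set.mem_range_self n)
  have hρS : IsSobolev (fun x => ‖φ₀ x‖ ^ 2) (rhoGrad φ₀ g₀) := by
    obtain ⟨r, hr, -⟩ := exists_isSobolev_of_tendsto (fun n => (h n).isSobolev_sq) hρ2 hρlim
      (M := max M' M) (fun n => (hM2' n).trans (le_max_left _ _))
      (fun n => (hM' n).trans (le_max_right _ _))
    -- The weak limit of the density gradients is identified with `rhoGrad φ₀ g₀` by uniqueness of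
    -- weak derivatives.
    refine hr.congr EventuallyEq.rfl fun i => ?_
    have := (hr.hasWeakPartial i).ae_eq isOpen_univ (h₀.hasWeakPartial_normSq i)
    rwa [Measure.restrict_univ] at this
  have ec : gradInt (rhoGrad φ₀ g₀) ≤ c :=
    gradInt_le_of_tendsto (fun n => (h n).isSobolev_sq) hρS hρlim hM2' hc
  have ea : gradInt g₀ ≤ a :=
    gradInt_le_of_tendsto hS h₀ hlim (fun n => (h n).mass.le) ha
  have hpm : AEStronglyMeasurable (fun x => V x * ‖φ₀ x‖ ^ 2) := hVm.mul hsq₀.1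
  have hp0 : ∀ (ψ : Space d → ℂ) x, 0 ≤ V x * ‖ψ x‖ ^ 2 := fun ψ x =>
    mul_nonneg (hV0 x) (by positivity)
  have hb0 : 0 ≤ b := ge_of_tendsto' hb fun n => integral_nonneg (hp0 _)
  -- Convergence to `b` only puts the potential energies eventually below `b + ε`; the slack is
  -- removed afterwards.
  have hfat : ∀ ε : ℝ, 0 < ε → ∫⁻ x, ENNReal.ofReal (V x * ‖φ₀ x‖ ^ 2) ≤ ENNReal.ofReal (b + ε) := by
    intro ε hε
    refine lintegral_liminf_le_of_le (f := fun n x => ENNReal.ofReal (V x * ‖φ n x‖ ^ 2))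
      (fun n => (h n).integrable_pot.1.aemeasurable.ennreal_ofReal) ?_ ?_
    · filter_upwards [haeρ] with x hx
      exact ENNReal.tendsto_ofReal (hx.const_mul _)
    · refine Eventually.frequently ?_
      filter_upwards [hb.eventually_le_const (show b < b + ε by linarith)] with n hn
      rw [← ofReal_integral_eq_lintegral_ofReal (h n).integrable_pot
        (Eventually.of_forall (hp0 _))]
      exact ENNReal.ofReal_le_ofReal hn
  have hpi : Integrable fun x => V x * ‖φ₀ x‖ ^ 2 := by
    refine ⟨hpm, ?_⟩
    rw [hasFiniteIntegral_iff_ofReal (Eventually.of_forall (hp0 _))]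
    exact (hfat 1 one_pos).trans_lt ENNReal.ofReal_lt_top
  have eb : ∫ x, V x * ‖φ₀ x‖ ^ 2 ≤ b := by
    refine le_of_forall_pos_le_add fun ε hε => ?_
    have := hfat ε hε
    rwa [← ofReal_integral_eq_lintegral_ofReal hpi (Eventually.of_forall (hp0 _)),
      ENNReal.ofReal_le_ofReal_iff (by positivity)] at this
  refine ⟨⟨h₀, hpi, hmass, hρS⟩, ?_⟩
  have e4 : ∀ ψ : Space d → ℂ, ∫ x, ‖‖ψ x‖ ^ 2‖ ^ 2 = ∫ x, ‖ψ x‖ ^ 4 := fun ψ => by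
    congr 1; ext x; simp only [norm_pow, norm_norm]; ring
  simp only [e4] at hρint
  have hlimE := (((ha.const_mul (1 / 2)).add hb).add (hρint.const_mul (β / 2))).add
    (hc.const_mul (δ / 2))
  have := tendsto_nhds_unique hm hlimE
  rw [this, splitEnergy]
  gcongr

theorem exists_subseq_tendsto_three {a b c : ℕ → ℝ} {B : ℝ} (ha : ∀ n, a n ∈ Set.Icc 0 B)
    (hb : ∀ n, b n ∈ Set.Icc 0 B) (hc : ∀ n, c n ∈ Set.Icc 0 B) :
    ∃ (s : ℕ → ℕ) (a₀ b₀ c₀ : ℝ), StrictMono s ∧ Tendsto (fun n => a (s n)) atTop (𝓝 a₀) ∧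
      Tendsto (fun n => b (s n)) atTop (𝓝 b₀) ∧ Tendsto (fun n => c (s n)) atTop (𝓝 c₀) := by
  obtain ⟨⟨a₀, b₀, c₀⟩, -, s, hs, hl⟩ :=
    ((isCompact_Icc (a := (0 : ℝ)) (b := B)).prod
      ((isCompact_Icc (a := (0 : ℝ)) (b := B)).prod isCompact_Icc)).tendsto_subseq
      (x := fun n => (a n, b n, c n)) fun n => ⟨ha n, hb n, hc n⟩
  rw [nhds_prod_eq, nhds_prod_eq, tendsto_prod_iff', tendsto_prod_iff'] at hl
  exact ⟨s, a₀, b₀, c₀, hs, hl.1, hl.2.1, hl.2.2⟩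

/-- The energy has a minimizer in every class of Sobolev functions. -/
theorem SobolevClass.exists_minimizer {A : (Space d → ℂ) → Prop} (hA : SobolevClass A)
    {V : Space d → ℝ} (hV0 : ∀ x, 0 ≤ V x) (hVm : AEStronglyMeasurable V)
    (hVc : Tendsto V (cocompact (Space d)) atTop) (β : ℝ) {δ : ℝ} (hδ : 0 < δ)
    (hne : ∃ φ, A φ ∧ φ ∈ constraintSet Set.univ V β δ) :
    ∃ φ, (A φ ∧ φ ∈ constraintSet Set.univ V β δ) ∧
      ∀ χ, A χ → χ ∈ constraintSet Set.univ V β δ →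
        energy Set.univ V β δ φ ≤ energy Set.univ V β δ χ := by
  obtain ⟨C, hC⟩ := exists_energy_lower_bound d β hδ
  set 𝓔 : Set ℝ := {t | ∃ φ g, A φ ∧ Admissible V φ g ∧ splitEnergy V β δ φ g = t} with h𝓔
  have hsub : ∀ χ, A χ → χ ∈ constraintSet Set.univ V β δ → energy Set.univ V β δ χ ∈ 𝓔 := by
    intro χ h1 h2
    obtain ⟨g, hg⟩ := hA.exists_grad h1
    have := hg.admissible hδ h2
    exact ⟨χ, g, h1, this, (this.energy_eq β δ).symm⟩
  have hnonneg : ∀ {φ g}, Admissible V φ g → 0 ≤ gradInt g ∧ 0 ≤ (∫ x, V x * ‖φ x‖ ^ 2) ∧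
      0 ≤ gradInt (rhoGrad φ g) := fun _ =>
    ⟨gradInt_nonneg _, integral_pot_nonneg hV0 _, gradInt_nonneg _⟩
  have hbdd : BddBelow 𝓔 := by
    refine ⟨-C, ?_⟩
    rintro _ ⟨φ, g, -, h, rfl⟩
    obtain ⟨h1, h2, h3⟩ := hnonneg h
    have := hC V φ g h
    nlinarith
  have hne' : 𝓔.Nonempty := by
    obtain ⟨φ, h1, h2⟩ := hne
    exact ⟨_, hsub φ h1 h2⟩
  obtain ⟨t, -, htl, ht⟩ := exists_seq_tendsto_sInf hne' hbdd
  choose φ g hφA hφ hφt using ht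
  obtain ⟨B, hB⟩ := htl.bddAbove_range
  have hE : ∀ n, 1 / 2 * gradInt (g n) + (∫ x, V x * ‖φ n x‖ ^ 2)
      + δ / 4 * gradInt (rhoGrad (φ n) (g n)) ≤ B + C := fun n => by
    have h1 := hC V _ _ (hφ n)
    have h2 : t n ≤ B := hB (Set.mem_range_self n)
    rw [hφt n] at h1
    linarith
  have hBC : 0 ≤ B + C := by
    obtain ⟨h1, h2, h3⟩ := hnonneg (hφ 0)
    have := hE 0
    nlinarith
  -- One constant dominating the three bounds `2(B + C)`, `B + C` and `4/δ (B + C)`.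
  set K := 2 * (B + C) + 4 / δ * (B + C) with hK
  have hK0 : 0 ≤ 4 / δ * (B + C) := by positivity
  have hg1 : ∀ n, gradInt (g n) ≤ K := fun n => by
    obtain ⟨h1, h2, h3⟩ := hnonneg (hφ n)
    have := hE n
    nlinarith
  have hg2 : ∀ n, ∫ x, V x * ‖φ n x‖ ^ 2 ≤ K := fun n => by
    obtain ⟨h1, h2, h3⟩ := hnonneg (hφ n)
    have := hE n
    nlinarith
  have hg3 : ∀ n, gradInt (rhoGrad (φ n) (g n)) ≤ K := fun n => by
    obtain ⟨h1, h2, h3⟩ := hnonneg (hφ n)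
    have h4 := hE n
    have h5 : gradInt (rhoGrad (φ n) (g n)) ≤ 4 / δ * (B + C) := by
      rw [div_mul_eq_mul_div, le_div_iff₀ hδ]
      nlinarith
    linarith
  obtain ⟨φ₀, g₀, s, hs, h₀, hlim⟩ := exists_strong_limit hV0 hVc hφ hg1 hg2
  obtain ⟨s', hs', hae⟩ := exists_ae_subseq (fun n => (hφ (s n)).isSobolev.memLp) h₀.memLp hlim
  obtain ⟨s'', a, b, c, hs'', ha, hb, hc⟩ := exists_subseq_tendsto_three (B := K)
    (fun n => ⟨gradInt_nonneg (g (s (s' n))), hg1 _⟩)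
    (fun n => ⟨(hnonneg (hφ (s (s' n)))).2.1, hg2 _⟩)
    (fun n => ⟨(hnonneg (hφ (s (s' n)))).2.2, hg3 _⟩)
  -- Three nested extractions: strong `L²` convergence, almost everywhere convergence, and
  -- convergence of the three nonnegative parts of the energy.
  set σ : ℕ → ℕ := fun n => s (s' (s'' n)) with hσ
  have hσm : StrictMono σ := hs.comp (hs'.comp hs'')
  have hm : Tendsto (fun n => splitEnergy V β δ (φ (σ n)) (g (σ n))) atTop (𝓝 (sInf 𝓔)) := by
    simp only [hφt]
    exact htl.comp hσm.tendsto_atTop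
  have hlim' : Tendsto (fun n => ∫⁻ x, ‖φ (σ n) x - φ₀ x‖ₑ ^ 2) atTop (𝓝 0) :=
    hlim.comp (hs'.comp hs'').tendsto_atTop
  obtain ⟨hadm, hle⟩ := splitEnergy_le_of_tendsto hV0 hVm hδ (fun n => hφ (σ n)) h₀ hlim'
    (hae.mono fun x hx => hx.comp hs''.tendsto_atTop) ha hb hc hm
  refine ⟨φ₀, ⟨?_, hadm.mem_constraintSet β δ⟩, fun χ h1 h2 => ?_⟩
  · exact hA.closed (fun n => hφA (σ n)) (fun n => (hφ (σ n)).isSobolev) h₀.memLp hlim'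
      (M := max 1 K) (fun n => (hφ (σ n)).mass.le.trans (le_max_left _ _))
      (fun n => (hg1 (σ n)).trans (le_max_right _ _))
  · rw [hadm.energy_eq]
    exact hle.trans (csInf_le hbdd (hsub χ h1 h2))

/-! ### Convexity of the energy in the density -/

/-- The function whose density is the mean of the densities of `φ₁` and `φ₂`. -/
def rootMean (φ₁ φ₂ : Space d → ℂ) (x : Space d) : ℂ :=
  ((√((‖φ₁ x‖ ^ 2 + ‖φ₂ x‖ ^ 2) / 2) : ℝ) : ℂ)

theorem norm_rootMean_sq (φ₁ φ₂ : Space d → ℂ) (x : Space d) :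
    ‖rootMean φ₁ φ₂ x‖ ^ 2 = (‖φ₁ x‖ ^ 2 + ‖φ₂ x‖ ^ 2) / 2 := by
  rw [rootMean, Complex.norm_real, Real.norm_eq_abs, sq_abs, Real.sq_sqrt (by positivity)]

theorem rootMean_self (φ : Space d → ℂ) (x : Space d) :
    rootMean φ φ x = ((‖φ x‖ : ℝ) : ℂ) := by
  rw [rootMean, add_self_div_two, Real.sqrt_sq (norm_nonneg _)]

/-- Seen as the length of a vector-valued function, the mean inherits Sobolev regularity and the
gradient bound for norms. -/
theorem rootMean_eq_norm (φ₁ φ₂ : Space d → ℂ) (x : Space d) :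
    rootMean φ₁ φ₂ x = ((‖(√(1 / 2) : ℝ) • WithLp.toLp 2 (φ₁ x, φ₂ x)‖ : ℝ) : ℂ) := by
  rw [rootMean, norm_smul, WithLp.prod_norm_eq_of_L2, Real.norm_of_nonneg (Real.sqrt_nonneg _),
    ← Real.sqrt_mul (by norm_num), div_eq_inv_mul, one_div]
  rfl

/-- Convexity of the kinetic energy in the density: the gradient of a norm is pointwise at most the
gradient, here that of `(φ₁, φ₂)/√2`. -/
theorem IsSobolev.rootMean {φ₁ φ₂ : Space d → ℂ} {g₁ g₂ : Fin d → Space d → ℂ}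
    (h₁ : IsSobolev φ₁ g₁) (h₂ : IsSobolev φ₂ g₂) :
    ∃ G, IsSobolev (rootMean φ₁ φ₂) G ∧ gradInt G ≤ (gradInt g₁ + gradInt g₂) / 2 := by
  have hf := (h₁.pair h₂).const_smul √(1 / 2)
  have hG := hf.norm.clm Complex.ofRealCLM
  refine ⟨_, hG.congr (Eventually.of_forall fun x => (rootMean_eq_norm φ₁ φ₂ x).symm)
    fun i => EventuallyEq.rfl, ?_⟩
  refine (gradInt_le_of_norm_le hG.memLp_grad hf.memLp_grad fun i x => ?_).trans_eq ?_
  · rw [Complex.ofRealCLM_apply, Complex.norm_real]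
    exact abs_inner_div_norm_le _ _
  · rw [gradInt, gradInt, gradInt, ← Finset.sum_add_distrib, Finset.sum_div]
    refine Finset.sum_congr rfl fun i _ => ?_
    have i1 := (h₁.memLp_grad i).integrable_norm_pow two_ne_zero
    have i2 := (h₂.memLp_grad i).integrable_norm_pow two_ne_zero
    rw [← integral_add i1 i2, ← integral_div]
    congr 1; ext x
    rw [norm_smul, mul_pow, WithLp.prod_norm_sq_eq_of_L2, Real.norm_of_nonneg (Real.sqrt_nonneg _),
      Real.sq_sqrt (by norm_num)]
    change 1 / 2 * (‖g₁ i x‖ ^ 2 + ‖g₂ i x‖ ^ 2) = _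
    ring

theorem integral_parallelogram {f g : Space d → ℝ} (hf : MemLp f 2) (hg : MemLp g 2) :
    ∫ x, ‖(1 / 2 : ℝ) • (f x + g x)‖ ^ 2 = 1 / 2 * (∫ x, ‖f x‖ ^ 2) + 1 / 2 * (∫ x, ‖g x‖ ^ 2)
      - 1 / 4 * ∫ x, ‖f x - g x‖ ^ 2 := by
  have i1 := (hf.integrable_norm_pow two_ne_zero).const_mul (1 / 2)
  have i2 := (hg.integrable_norm_pow two_ne_zero).const_mul (1 / 2)
  have i3 := ((hf.sub hg).integrable_norm_pow two_ne_zero).const_mul (1 / 4)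
  have e1 := integral_sub (i1.add i2) i3
  simp only [Pi.add_apply, Pi.sub_apply] at e1
  rw [← integral_const_mul, ← integral_const_mul, ← integral_const_mul, ← integral_add i1 i2, ← e1]
  congr 1; ext x
  simp only [Real.norm_eq_abs, sq_abs, smul_eq_mul]
  ring

theorem gradInt_parallelogram {f g : Fin d → Space d → ℝ} (hf : ∀ i, MemLp (f i) 2)
    (hg : ∀ i, MemLp (g i) 2) :
    gradInt (fun i x => (1 / 2 : ℝ) • (f i x + g i x)) = 1 / 2 * gradInt f + 1 / 2 * gradInt g
      - 1 / 4 * gradInt (fun i x => f i x - g i x) := by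
  simp only [gradInt, Finset.mul_sum]
  rw [← Finset.sum_add_distrib, ← Finset.sum_sub_distrib]
  exact Finset.sum_congr rfl fun i _ => integral_parallelogram (hf i) (hg i)

theorem gradInt_congr {f g : Fin d → Space d → E} (h : ∀ i, f i =ᵐ[volume] g i) :
    gradInt f = gradInt g :=
  Finset.sum_congr rfl fun i _ => integral_congr_ae (by filter_upwards [h i] with x hx; rw [hx])

/-- The energy is convex as a function of the density `|φ|²`. -/
theorem Admissible.rootMean {V : Space d → ℝ} {φ₁ φ₂ : Space d → ℂ} {g₁ g₂ : Fin d → Space d → ℂ}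
    (h₁ : Admissible V φ₁ g₁) (h₂ : Admissible V φ₂ g₂) (β δ : ℝ) :
    ∃ G, Admissible V (rootMean φ₁ φ₂) G ∧ splitEnergy V β δ (MGPE.rootMean φ₁ φ₂) G ≤
      (splitEnergy V β δ φ₁ g₁ + splitEnergy V β δ φ₂ g₂) / 2 -
        (β * (∫ x, ‖‖φ₁ x‖ ^ 2 - ‖φ₂ x‖ ^ 2‖ ^ 2)
          + δ * gradInt (fun i x => rhoGrad φ₁ g₁ i x - rhoGrad φ₂ g₂ i x)) / 8 := by
  obtain ⟨G, hG, hGle⟩ := h₁.isSobolev.rootMean h₂.isSobolev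
  have hS := (h₁.isSobolev_sq.add h₂.isSobolev_sq).const_smul (1 / 2)
  have hfun : (fun x => (1 / 2 : ℝ) • (‖φ₁ x‖ ^ 2 + ‖φ₂ x‖ ^ 2)) =ᵐ[volume]
      fun x => ‖MGPE.rootMean φ₁ φ₂ x‖ ^ 2 := Eventually.of_forall fun x => by
    simp only [norm_rootMean_sq, smul_eq_mul]
    ring
  have hS' := hS.congr hfun fun _ => EventuallyEq.rfl
  have hgr : ∀ i, (fun x => (1 / 2 : ℝ) • (rhoGrad φ₁ g₁ i x + rhoGrad φ₂ g₂ i x)) =ᵐ[volume]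
      rhoGrad (MGPE.rootMean φ₁ φ₂) G i := fun i => by
    have := (hS'.hasWeakPartial i).ae_eq isOpen_univ (hG.hasWeakPartial_normSq i)
    rwa [Measure.restrict_univ] at this
  have e4 : ∀ ψ : Space d → ℂ, ∫ x, ‖‖ψ x‖ ^ 2‖ ^ 2 = ∫ x, ‖ψ x‖ ^ 4 := fun ψ => by
    congr 1; ext x; simp only [norm_pow, norm_norm]; ring
  have hpot : ∀ x, V x * ‖MGPE.rootMean φ₁ φ₂ x‖ ^ 2
      = 1 / 2 * (V x * ‖φ₁ x‖ ^ 2) + 1 / 2 * (V x * ‖φ₂ x‖ ^ 2) := fun x => by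
    rw [norm_rootMean_sq]; ring
  have i1 := h₁.integrable_pot.const_mul (1 / 2)
  have i2 := h₂.integrable_pot.const_mul (1 / 2)
  refine ⟨G, ⟨hG, ?_, ?_, hS'.congr EventuallyEq.rfl hgr⟩, ?_⟩
  · simp only [hpot]
    exact i1.add i2
  · simp only [norm_rootMean_sq]
    rw [integral_div, integral_add h₁.integrable_sq h₂.integrable_sq, h₁.mass, h₂.mass]
    norm_num
  -- Quartic and `δ` terms are squared norms of the density and of its gradient, so the
  -- parallelogram identity is exact. The factor `1/8` is the coefficient `1/2` times the `1/4` of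
  -- the identity.
  · have hq : ∫ x, ‖MGPE.rootMean φ₁ φ₂ x‖ ^ 4 = _ :=
      ((e4 _).symm.trans (integral_congr_ae (by filter_upwards [hfun] with x hx; rw [hx]))).trans
        (integral_parallelogram h₁.isSobolev_sq.memLp h₂.isSobolev_sq.memLp)
    have hr := (gradInt_congr hgr).symm.trans
      (gradInt_parallelogram h₁.isSobolev_sq.memLp_grad h₂.isSobolev_sq.memLp_grad)
    rw [e4, e4] at hq
    simp only [splitEnergy]
    rw [hq, hr]
    simp only [hpot]
    rw [integral_add i1 i2, integral_const_mul, integral_const_mul]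
    linarith

/-- Passing to the absolute value does not increase the energy. -/
theorem Admissible.norm {V : Space d → ℝ} {φ : Space d → ℂ} {g : Fin d → Space d → ℂ}
    (h : Admissible V φ g) (β δ : ℝ) : ∃ G, Admissible V (fun x => ((‖φ x‖ : ℝ) : ℂ)) G ∧
      splitEnergy V β δ (fun x => ((‖φ x‖ : ℝ) : ℂ)) G ≤ splitEnergy V β δ φ g := by
  -- The mean of `φ` with itself is `|φ|`, and the defect vanishes.
  obtain ⟨G, hG, hle⟩ := h.rootMean h β δ
  rw [show MGPE.rootMean φ φ = fun x => ((‖φ x‖ : ℝ) : ℂ) from funext (rootMean_self φ)] at hG hle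
  refine ⟨G, hG, hle.trans_eq ?_⟩
  simp [gradInt]

/-- Two minimizers have the same density, if the quadratic part of the energy is positive
definite. -/
theorem SobolevClass.norm_ae_eq {A : (Space d → ℂ) → Prop} (hA : SobolevClass A)
    {V : Space d → ℝ} {β δ : ℝ} (hδ : 0 < δ)
    (hpos : ∀ {φ₁ φ₂ : Space d → ℂ} {r : Fin d → Space d → ℝ}, A φ₁ → A φ₂ →
      IsSobolev (fun x => ‖φ₁ x‖ ^ 2 - ‖φ₂ x‖ ^ 2) r →
      β * (∫ x, ‖‖φ₁ x‖ ^ 2 - ‖φ₂ x‖ ^ 2‖ ^ 2) + δ * gradInt r ≤ 0 →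
      ∫ x, ‖‖φ₁ x‖ ^ 2 - ‖φ₂ x‖ ^ 2‖ ^ 2 = 0)
    {φ₁ φ₂ : Space d → ℂ} (hA₁ : A φ₁) (hA₂ : A φ₂)
    (h₁ : φ₁ ∈ constraintSet Set.univ V β δ) (h₂ : φ₂ ∈ constraintSet Set.univ V β δ)
    (hmin₁ : ∀ χ, A χ → χ ∈ constraintSet Set.univ V β δ →
      energy Set.univ V β δ φ₁ ≤ energy Set.univ V β δ χ)
    (hmin₂ : ∀ χ, A χ → χ ∈ constraintSet Set.univ V β δ →
      energy Set.univ V β δ φ₂ ≤ energy Set.univ V β δ χ) : ∀ᵐ x, ‖φ₁ x‖ = ‖φ₂ x‖ := by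
  obtain ⟨g₁, hg₁⟩ := hA.exists_grad hA₁
  obtain ⟨g₂, hg₂⟩ := hA.exists_grad hA₂
  have a₁ := hg₁.admissible hδ h₁
  have a₂ := hg₂.admissible hδ h₂
  obtain ⟨G, hG, hle⟩ := a₁.rootMean a₂ β δ
  -- The mean is a competitor for both minimizers; as it cannot have lower energy than either, the
  -- convexity defect is nonpositive.
  have m₁ := hmin₁ _ (hA.mean hA₁ hA₂) (hG.mem_constraintSet β δ)
  have m₂ := hmin₂ _ (hA.mean hA₁ hA₂) (hG.mem_constraintSet β δ)
  rw [show (fun x => ((√((‖φ₁ x‖ ^ 2 + ‖φ₂ x‖ ^ 2) / 2) : ℝ) : ℂ)) = MGPE.rootMean φ₁ φ₂ from rfl,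
    hG.energy_eq] at m₁ m₂
  rw [a₁.energy_eq] at m₁
  rw [a₂.energy_eq] at m₂
  have hS := a₁.isSobolev_sq.sub a₂.isSobolev_sq
  have h0 := hpos hA₁ hA₂ hS (by linarith)
  rw [integral_eq_zero_iff_of_nonneg (fun x => by positivity)
    (hS.memLp.integrable_norm_pow two_ne_zero)] at h0
  filter_upwards [h0] with x hx
  have : ‖φ₁ x‖ ^ 2 - ‖φ₂ x‖ ^ 2 = 0 := by simpa using hx
  exact (pow_left_inj₀ (norm_nonneg _) (norm_nonneg _) two_ne_zero).1 (by linarith)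

theorem eq_norm_of_nonneg {z : ℂ} (h : 0 ≤ z.re ∧ z.im = 0) : z = ((‖z‖ : ℝ) : ℂ) := by
  have : z = ((z.re : ℝ) : ℂ) := Complex.ext rfl (by simp [h.2])
  rw [this, Complex.norm_real, Real.norm_of_nonneg h.1]

/-- `H¹(ℝ^d)` as a class of functions over which the energy can be minimized. -/
theorem sobolevClass_memH1 : SobolevClass (d := d) (MemH1 Set.univ) where
  exists_grad h := h.exists_isSobolev
  closed _ h h₀ hlim hM hg := by
    obtain ⟨g₀, h₀, -⟩ := exists_isSobolev_of_tendsto h h₀ hlim hM hg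
    exact h₀.memH1
  mean h₁ h₂ := by
    obtain ⟨g₁, h₁⟩ := h₁.exists_isSobolev
    obtain ⟨g₂, h₂⟩ := h₂.exists_isSobolev
    obtain ⟨G, hG, -⟩ := h₁.rootMean h₂
    exact hG.memH1

/-- The closure of the test functions as a class of functions over which the energy can be
minimized. -/
theorem sobolevClass_memTestClosure (Ω : Set (Space d)) :
    SobolevClass (MemTestClosure (E := ℂ) Ω) where
  exists_grad := by
    rintro φ ⟨g, hg, -⟩
    exact ⟨g, hg⟩
  closed hA h h₀ hlim hM hg := MemTestClosure.of_tendsto hA h h₀ hlim hM hg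
  mean {φ₁ φ₂} h₁ h₂ := by
    -- The mean is the norm of the scaled pair, and both pairing and norm preserve the closure; a
    -- last linear map returns from `ℝ` to `ℂ`.
    let e : (ℂ × ℂ) →L[ℝ] WithLp 2 (ℂ × ℂ) :=
      (√(1 / 2) : ℝ) • (WithLp.prodContinuousLinearEquiv 2 ℝ ℂ ℂ).symm.toContinuousLinearMap
    have h := (h₁.clm_add h₂ (e.comp (ContinuousLinearMap.inl ℝ ℂ ℂ))
      (e.comp (ContinuousLinearMap.inr ℝ ℂ ℂ))).norm
    refine (h.clm_add h Complex.ofRealCLM 0).congr (Eventually.of_forall fun x => ?_)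
    refine Eq.trans ?_ (rootMean_eq_norm φ₁ φ₂ x).symm
    simp [e, ← smul_add, ← WithLp.toLp_add]

/-! ### Poincaré inequalities and test functions -/

/-- The volume scales as `r ^ d`, and `r ^ d ≥ r` for `r ≥ 1` and `d ≥ 1`. -/
theorem exists_le_volume_ball (hd : 1 ≤ d) (K : ℝ) :
    ∃ r : ℝ, 0 < r ∧ K ≤ (volume (Metric.ball (0 : Space d) r)).toReal := by
  set b := (volume (Metric.ball (0 : Space d) 1)).toReal with hb
  have hb0 : 0 < b := ENNReal.toReal_pos (Metric.measure_ball_pos _ _ one_pos).ne'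
    measure_ball_lt_top.ne
  have h1 : 1 ≤ max 1 (K / b) := le_max_left _ _
  refine ⟨max 1 (K / b), by positivity, ?_⟩
  rw [Measure.addHaar_ball_of_pos _ _ (by positivity), ENNReal.toReal_mul, ← hb,
    ENNReal.toReal_ofReal (by positivity), finrank_euclideanSpace_fin]
  rw [← div_le_iff₀ hb0]
  exact (le_max_right _ _).trans (le_self_pow₀ h1 (by omega))

/-- With no gradient, Nash leaves only the `L¹` term, which tends to zero as the radius grows. -/
theorem IsSobolev.integral_sq_eq_zero (hd : 1 ≤ d) {u : Space d → E} {g : Fin d → Space d → E}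
    (h : IsSobolev u g) (hi : Integrable u) (hg : gradInt g ≤ 0) : ∫ x, ‖u x‖ ^ 2 = 0 := by
  refine le_antisymm (le_of_forall_pos_le_add fun ε hε => ?_) (integral_nonneg fun _ => by positivity)
  obtain ⟨r, hr, hv⟩ := exists_le_volume_ball hd (2 * (∫ x, ‖u x‖) ^ 2 / ε)
  have h1 := h.nash_real hi hr
  have hb : 0 < (volume (Metric.ball (0 : Space d) r)).toReal :=
    ENNReal.toReal_pos (Metric.measure_ball_pos _ _ hr).ne' measure_ball_lt_top.ne
  have h2 : 2 / (volume (Metric.ball (0 : Space d) r)).toReal * (∫ x, ‖u x‖) ^ 2 ≤ ε := by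
    rw [div_mul_eq_mul_div, div_le_iff₀ hb]
    rw [div_le_iff₀ hε] at hv
    linarith
  nlinarith [sq_nonneg r]

theorem sq_integral_norm_le {u : Space d → E} (hu : MemLp u 2) (hi : Integrable u)
    {Ω : Set (Space d)} (hΩ : MeasurableSet Ω) (hΩf : volume Ω ≠ ⊤) (h0 : ∀ᵐ x, x ∉ Ω → u x = 0) :
    (∫ x, ‖u x‖) ^ 2 ≤ (volume Ω).toReal * ∫ x, ‖u x‖ ^ 2 := by
  have h := sq_lintegral_mul_le_mul (μ := volume) (a := fun x => ‖u x‖ₑ)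
    (b := Ω.indicator fun _ => 1) hu.1.enorm (aemeasurable_const.indicator hΩ)
  have e1 : ∫⁻ x, ‖u x‖ₑ * Ω.indicator (fun _ => 1) x = ∫⁻ x, ‖u x‖ₑ := lintegral_congr_ae (by
    filter_upwards [h0] with x hx
    by_cases hxΩ : x ∈ Ω
    · simp [hxΩ]
    · simp [hx hxΩ])
  have e2 : ∫⁻ x, (Ω.indicator (fun _ => (1 : ℝ≥0∞)) x) ^ 2 = volume Ω := by
    rw [← lintegral_indicator_one hΩ]
    congr 1; ext x
    by_cases hxΩ : x ∈ Ω <;> simp [hxΩ]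
  rw [e1, e2, lintegral_enorm_sq hu, ← ofReal_integral_norm_eq_lintegral_enorm hi,
    ← ENNReal.ofReal_pow (integral_nonneg fun _ => norm_nonneg _), ← ENNReal.ofReal_toReal hΩf,
    ← ENNReal.ofReal_mul (integral_nonneg fun _ => by positivity),
    ENNReal.ofReal_le_ofReal_iff (by positivity), mul_comm] at h
  exact h

/-- Poincaré's inequality. -/
theorem exists_poincare (hd : 1 ≤ d) {Ω : Set (Space d)} (hΩ : MeasurableSet Ω)
    (hΩf : volume Ω ≠ ⊤) : ∃ C : ℝ, 0 < C ∧ ∀ (u : Space d → ℝ) (g : Fin d → Space d → ℝ),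
      IsSobolev u g → Integrable u → (∀ᵐ x, x ∉ Ω → u x = 0) →
      ∫ x, ‖u x‖ ^ 2 ≤ C * gradInt g := by
  -- On a set of finite measure `‖u‖₁² ≤ |Ω| ‖u‖₂²`. With `|B_r| ≥ 4|Ω|` the `L¹` term in Nash is at
  -- most half of the left side, which leaves the constant `2r²`.
  obtain ⟨r, hr, hv⟩ := exists_le_volume_ball hd (4 * (volume Ω).toReal)
  refine ⟨2 * r ^ 2, by positivity, fun u g h hi h0 => ?_⟩
  have h1 := h.nash_real hi hr
  have h2 := sq_integral_norm_le h.memLp hi hΩ hΩf h0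
  have hb : 0 < (volume (Metric.ball (0 : Space d) r)).toReal :=
    ENNReal.toReal_pos (Metric.measure_ball_pos _ _ hr).ne' measure_ball_lt_top.ne
  have hJ : 0 ≤ ∫ x, ‖u x‖ ^ 2 := integral_nonneg fun _ => by positivity
  have h3 : 2 / (volume (Metric.ball (0 : Space d) r)).toReal * (∫ x, ‖u x‖) ^ 2
      ≤ 1 / 2 * ∫ x, ‖u x‖ ^ 2 := by
    rw [div_mul_eq_mul_div, div_le_iff₀ hb]
    nlinarith [mul_le_mul_of_nonneg_right hv hJ]
  linarith

theorem integrable_smul_test {Ω : Set (Space d)} {V : Space d → ℝ} (hV : LocallyIntegrableOn V Ω)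
    {w : Space d → ℝ} (hw : Continuous w) (hc : HasCompactSupport w) (hs : tsupport w ⊆ Ω) :
    Integrable fun x => V x * w x := by
  have hK : IntegrableOn (fun x => V x * w x) (tsupport w) :=
    (hV.integrableOn_compact_subset hs hc).mul_continuousOn hw.continuousOn hc
  refine (integrableOn_iff_integrable_of_support_subset fun x hx => ?_).mp hK
  by_contra h
  exact hx (by simp [image_eq_zero_of_notMem_tsupport h])

theorem IsTest.norm_sq {Ω : Set (Space d)} {u : Space d → E} (hu : IsTest Ω u) :
    IsTest Ω fun x => ‖u x‖ ^ 2 := by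
  have h0 : ‖(0 : E)‖ ^ 2 = 0 := by simp
  exact ⟨hu.1.norm_sq ℝ, hu.2.1.comp_left (g := fun v => ‖v‖ ^ 2) h0,
    (closure_mono (Function.support_comp_subset (g := fun v : E => ‖v‖ ^ 2) h0 _)).trans hu.2.2⟩

theorem IsTest.admissible {Ω : Set (Space d)} {V : Space d → ℝ} (hV : LocallyIntegrableOn V Ω)
    {φ : Space d → ℂ} (hφ : IsTest Ω φ) (h1 : ∫ x, ‖φ x‖ ^ 2 = 1) :
    Admissible V φ (classicalGrad φ) := by
  have h := hφ.isSobolev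
  have hsq := hφ.norm_sq
  refine ⟨h, integrable_smul_test hV hsq.1.continuous hsq.2.1 hsq.2.2, h1,
    hsq.isSobolev.congr EventuallyEq.rfl fun i => ?_⟩
  have := (hsq.isSobolev.hasWeakPartial i).ae_eq isOpen_univ (h.hasWeakPartial_normSq i)
  rwa [Measure.restrict_univ] at this

theorem exists_isTest_mass_eq_one {Ω : Set (Space d)} (hΩ : IsOpen Ω) (hne : Ω.Nonempty) :
    ∃ φ : Space d → ℂ, IsTest Ω φ ∧ ∫ x, ‖φ x‖ ^ 2 = 1 := by
  obtain ⟨c, hc⟩ := hne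
  obtain ⟨R, hR, hRΩ⟩ := Metric.nhds_basis_closedBall.mem_iff.1 (hΩ.mem_nhds hc)
  let f : ContDiffBump c := ⟨R / 2, R, by positivity, by linarith⟩
  have hf : IsTest Ω (fun x => f x) := ⟨f.contDiff, f.hasCompactSupport, by
    rw [f.tsupport_eq]; exact hRΩ⟩
  have hI : 0 < ∫ x, ‖f x‖ ^ 2 := by
    have hsq := hf.norm_sq
    rw [integral_pos_iff_support_of_nonneg (fun x => by positivity)
      (hsq.1.continuous.integrable_of_hasCompactSupport hsq.2.1)]
    have : Function.support (fun x => ‖f x‖ ^ 2) = Metric.ball c R := by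
      rw [← f.support_eq]; ext x; simp
    rw [this]
    exact Metric.measure_ball_pos _ _ hR
  set I := ∫ x, ‖f x‖ ^ 2 with hIdef
  let L : ℝ →L[ℝ] ℂ := (√I)⁻¹ • Complex.ofRealCLM
  refine ⟨fun x => L (f x), ⟨L.contDiff.comp hf.1, hf.2.1.comp_left (map_zero L),
    (closure_mono (Function.support_comp_subset (map_zero L) _)).trans hf.2.2⟩, ?_⟩
  have : ∀ x, ‖L (f x)‖ ^ 2 = I⁻¹ * ‖f x‖ ^ 2 := fun x => by
    simp only [L, _root_.smul_apply, norm_smul, mul_pow, Complex.ofRealCLM_apply,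
      Complex.norm_real, norm_inv, inv_pow, Real.norm_of_nonneg (Real.sqrt_nonneg I),
      Real.sq_sqrt hI.le]
  simp only [this]
  rw [integral_const_mul, inv_mul_cancel₀ hI.ne']

/-! ### Concentrating functions -/

/-- The function `s^(d/2) φ(s x)`. -/
def dilate (s : ℝ) (φ : Space d → E) (x : Space d) : E := √(s ^ d) • φ (s • x)

theorem integral_dilate (f : Space d → ℝ) {s : ℝ} (hs : 0 < s) :
    ∫ x, f (s • x) = (s ^ d)⁻¹ * ∫ x, f x := by
  rw [Measure.integral_comp_smul, finrank_euclideanSpace_fin, abs_of_pos (by positivity),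
    smul_eq_mul]

theorem norm_dilate_sq (φ : Space d → E) {s : ℝ} (hs : 0 < s) (x : Space d) :
    ‖dilate s φ x‖ ^ 2 = s ^ d * ‖φ (s • x)‖ ^ 2 := by
  rw [dilate, norm_smul, mul_pow, Real.norm_of_nonneg (Real.sqrt_nonneg _),
    Real.sq_sqrt (by positivity)]

theorem classicalGrad_dilate {φ : Space d → E} (hφ : ContDiff ℝ ∞ φ) (s : ℝ) (i : Fin d) (x : Space d) :
    classicalGrad (dilate s φ) i x = (√(s ^ d) * s) • classicalGrad φ i (s • x) := by
  have h1 := (hφ.differentiable (by simp) (s • x)).hasFDerivAt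
  have h2 : HasFDerivAt (fun x : Space d => s • x) (s • ContinuousLinearMap.id ℝ (Space d)) x :=
    (hasFDerivAt_id x).const_smul s
  have h3 := (h1.comp x h2).const_smul √(s ^ d)
  rw [classicalGrad, HasFDerivAt.fderiv (f := dilate s φ) h3, classicalGrad]
  simp [mul_smul]

theorem IsTest.dilate {φ : Space d → E} (hφ : IsTest (Metric.ball (0 : Space d) 1) φ) {s : ℝ}
    (hs : 1 ≤ s) : IsTest (Metric.ball (0 : Space d) 1) (dilate s φ) := by
  have hs0 : s ≠ 0 := by positivity
  have hsub : tsupport (MGPE.dilate s φ) ⊆ (fun x => s • x) ⁻¹' tsupport φ := by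
    refine closure_minimal (fun x hx => subset_tsupport _ fun h => hx ?_)
      ((isClosed_tsupport φ).preimage (continuous_const_smul s))
    rw [MGPE.dilate, h, smul_zero]
  have hc : IsCompact ((fun x : Space d => s • x) ⁻¹' tsupport φ) :=
    (Homeomorph.smulOfNeZero s hs0).isCompact_preimage.2 hφ.2.1
  refine ⟨(hφ.1.comp (contDiff_const_smul s)).const_smul _, hc.of_isClosed_subset
    (isClosed_tsupport _) hsub, fun x hx => ?_⟩
  have := hφ.2.2 (hsub hx)
  rw [mem_ball_zero_iff, norm_smul, Real.norm_of_nonneg (by positivity)] at this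
  rw [mem_ball_zero_iff]
  nlinarith [norm_nonneg x]

/-- For `δ < 0` the energy is unbounded from below. -/
theorem exists_energy_lt (hd : 1 ≤ d) {V : Space d → ℝ} (hV0 : ∀ x, 0 ≤ V x)
    (hV : LocallyIntegrable V) (β : ℝ) {δ : ℝ} (hδ : δ < 0) (m : ℝ) :
    ∃ φ ∈ constraintSet Set.univ V β δ, energy Set.univ V β δ φ < m := by
  set B := Metric.ball (0 : Space d) 1 with hB
  obtain ⟨φ, hφ, hmass⟩ := exists_isTest_mass_eq_one (Ω := B) Metric.isOpen_ball
    (Metric.nonempty_ball.2 one_pos)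
  have hBm : MeasurableSet B := measurableSet_ball
  have hVB : LocallyIntegrableOn V B := hV.locallyIntegrableOn _
  have hadm := hφ.admissible hVB hmass
  set g := classicalGrad φ with hg
  set R := gradInt (rhoGrad φ g) with hR
  -- Otherwise the density would be an integrable function without gradient, hence zero, against the
  -- unit mass.
  have hR0 : 0 < R := by
    by_contra! hle
    have h0 := hadm.isSobolev_sq.integral_sq_eq_zero hd hadm.integrable_sq hle
    rw [integral_eq_zero_iff_of_nonneg (fun x => by positivity)
      (hadm.isSobolev_sq.memLp.integrable_norm_pow two_ne_zero)] at h0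
    have : ∫ x, ‖φ x‖ ^ 2 = 0 := integral_eq_zero_of_ae (by
      filter_upwards [h0] with x hx
      simpa using hx)
    rw [hmass] at this
    exact one_ne_zero this
  obtain ⟨M, hM⟩ := hφ.1.continuous.bounded_above_of_compact_support hφ.2.1
  have hM0 : 0 ≤ M := (norm_nonneg _).trans (hM 0)
  set K := ∫ x in B, V x with hK
  have hK0 : 0 ≤ K := integral_nonneg hV0
  have hVBi : IntegrableOn V B := (hV.integrableOn_isCompact (isCompact_closedBall 0 1)).mono_set
    Metric.ball_subset_closedBall
  set Q := ∫ x, ‖φ x‖ ^ 4 with hQ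
  have hQ0 : 0 ≤ Q := integral_nonneg fun _ => by positivity
  -- `A` collects the terms that grow at most like `s ^ (d + 1)`; the `δ` term grows like `s ^ (d +
  -- 2)` and is negative.
  set A := gradInt g / 2 + M ^ 2 * K + |β| / 2 * Q with hA
  have hG0 := gradInt_nonneg g
  have key : ∀ s : ℝ, 1 ≤ s → dilate s φ ∈ constraintSet Set.univ V β δ ∧
      energy Set.univ V β δ (dilate s φ) ≤ s ^ (d + 1) * (A - (-δ) / 2 * R * s) := by
    intro s hs
    have hs0 : 0 < s := by positivity
    have hsd : s ^ d ≠ 0 := by positivity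
    have hsq : √(s ^ d) ^ 2 = s ^ d := Real.sq_sqrt (by positivity)
    have hadms := (hφ.dilate hs).admissible hVB (by
      simp only [norm_dilate_sq φ hs0]
      rw [integral_const_mul, integral_dilate (fun x => ‖φ x‖ ^ 2) hs0, hmass]
      field_simp)
    refine ⟨hadms.mem_constraintSet β δ, ?_⟩
    rw [hadms.energy_eq, splitEnergy]
    have e1 : gradInt (classicalGrad (dilate s φ)) = s ^ 2 * gradInt g := by
      rw [gradInt, gradInt, Finset.mul_sum]
      refine Finset.sum_congr rfl fun i _ => ?_
      simp only [classicalGrad_dilate hφ.1, norm_smul, mul_pow, norm_mul, Real.norm_eq_abs, sq_abs,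
        hsq]
      rw [integral_const_mul, integral_dilate (fun x => ‖classicalGrad φ i x‖ ^ 2) hs0]
      field_simp
      rfl
    have e2 : ∫ x, ‖dilate s φ x‖ ^ 4 = s ^ d * Q := by
      have : ∀ x, ‖dilate s φ x‖ ^ 4 = s ^ d * s ^ d * ‖φ (s • x)‖ ^ 4 := fun x => by
        rw [show ∀ t : ℝ, t ^ 4 = (t ^ 2) ^ 2 from fun t => by ring, norm_dilate_sq φ hs0]
        ring
      simp only [this]
      rw [integral_const_mul, integral_dilate (fun x => ‖φ x‖ ^ 4) hs0]
      field_simp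
      rfl
    have e3 : gradInt (rhoGrad (dilate s φ) (classicalGrad (dilate s φ))) = s ^ (d + 2) * R := by
      rw [hR, gradInt, gradInt, Finset.mul_sum]
      refine Finset.sum_congr rfl fun i _ => ?_
      have : ∀ x, rhoGrad (dilate s φ) (classicalGrad (dilate s φ)) i x
          = s ^ d * s * rhoGrad φ g i (s • x) := fun x => by
        rw [rhoGrad, classicalGrad_dilate hφ.1, dilate, real_inner_smul_left,
          real_inner_smul_right, rhoGrad, ← hg]
        linear_combination 2 * s * inner ℝ (φ (s • x)) (g i (s • x)) * hsq
      simp only [this, norm_mul, mul_pow, Real.norm_eq_abs, sq_abs]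
      rw [integral_const_mul]
      have e := integral_dilate (fun x => rhoGrad φ g i x ^ 2) hs0
      rw [e]
      field_simp
      ring
    -- For `s ≥ 1` the dilated function stays supported in the unit ball, where local integrability
    -- bounds the integral of `V`.
    have e4 : ∫ x, V x * ‖dilate s φ x‖ ^ 2 ≤ s ^ d * (M ^ 2 * K) := by
      rw [hK, ← integral_indicator hBm, ← integral_const_mul, ← integral_const_mul]
      refine integral_mono hadms.integrable_pot
        (((hVBi.integrable_indicator hBm).const_mul _).const_mul _) fun x => ?_
      by_cases hx : x ∈ B
      · simp only [Set.indicator_of_mem hx]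
        rw [norm_dilate_sq φ hs0]
        have h1 : ‖φ (s • x)‖ ^ 2 ≤ M ^ 2 := pow_le_pow_left₀ (norm_nonneg _) (hM _) 2
        have h2 : 0 ≤ s ^ d * V x := mul_nonneg (by positivity) (hV0 x)
        nlinarith
      · have h0 : dilate s φ x = 0 :=
          image_eq_zero_of_notMem_tsupport fun h => hx ((hφ.dilate hs).2.2 h)
        simp [h0, Set.indicator_of_notMem hx]
    rw [e1, e2, e3]
    have p1 : s ^ 2 ≤ s ^ (d + 1) := pow_le_pow_right₀ hs (by omega)
    have p2 : s ^ d ≤ s ^ (d + 1) := pow_le_pow_right₀ hs (by omega)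
    have q1 := mul_le_mul_of_nonneg_right p1 hG0
    have q2 := mul_le_mul_of_nonneg_right p2 (show 0 ≤ M ^ 2 * K by positivity)
    have q3 := mul_le_mul_of_nonneg_right p2 (show 0 ≤ |β| / 2 * Q by positivity)
    have q4 : β / 2 * (s ^ d * Q) ≤ s ^ d * (|β| / 2 * Q) := by
      have : 0 ≤ s ^ d * Q := by positivity
      nlinarith [le_abs_self β]
    rw [hA]
    have q5 : s ^ (d + 1) * (gradInt g / 2 + M ^ 2 * K + |β| / 2 * Q - -δ / 2 * R * s)
        = s ^ (d + 1) * gradInt g / 2 + s ^ (d + 1) * (M ^ 2 * K) + s ^ (d + 1) * (|β| / 2 * Q)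
          + δ / 2 * (s ^ (d + 2) * R) := by ring
    rw [q5]
    linarith
  set c := (-δ) / 2 * R with hc
  have hc0 : 0 < c := mul_pos (by linarith) hR0
  -- Makes `A - c s ≤ -(|m| + 1)`, and the factor `s ^ (d + 1) ≥ 1` only helps.
  set s := max 1 ((A + |m| + 1) / c) with hs
  have hs1 : 1 ≤ s := le_max_left _ _
  obtain ⟨h1, h2⟩ := key s hs1
  refine ⟨_, h1, h2.trans_lt ?_⟩
  have h3 : A + |m| + 1 ≤ c * s := by
    rw [mul_comm, ← div_le_iff₀ hc0]
    exact le_max_right _ _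
  have h4 : 1 ≤ s ^ (d + 1) := one_le_pow₀ hs1
  nlinarith [neg_abs_le m, abs_nonneg m]

/-! ### Ground states on the whole space -/

/-- A minimizer is impossible when the energy is unbounded below. Besides nonexistence, this
supplies the positivity of `δ` behind the statements about `|φ|` and uniqueness. -/
theorem IsGroundState.pos (hd : 1 ≤ d) {V : Space d → ℝ} (hV0 : ∀ x, 0 ≤ V x)
    (hV : LocallyIntegrable V) {β δ : ℝ} (hδ : δ ≠ 0) {φ : Space d → ℂ}
    (hφ : IsGroundState V β δ φ) : 0 < δ := by
  by_contra! h
  obtain ⟨χ, h1, h2⟩ := exists_energy_lt hd hV0 hV β (lt_of_le_of_ne h hδ)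
    (energy Set.univ V β δ φ)
  exact (hφ.2 χ h1).not_gt h2

theorem exists_isGroundState {V : Space d → ℝ} (hV0 : ∀ x, 0 ≤ V x) (hV : LocallyIntegrable V)
    (hVc : Tendsto V (cocompact (Space d)) atTop) (β : ℝ) {δ : ℝ} (hδ : 0 < δ) :
    ∃ φ, IsGroundState V β δ φ := by
  obtain ⟨u, hu, hu1⟩ := exists_isTest_mass_eq_one (d := d) isOpen_univ Set.univ_nonempty
  have ha := hu.admissible (hV.locallyIntegrableOn _) hu1
  obtain ⟨φ, ⟨-, h1⟩, h2⟩ := sobolevClass_memH1.exists_minimizer hV0 hV.aestronglyMeasurable hVc β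
    hδ ⟨u, ha.isSobolev.memH1, ha.mem_constraintSet β δ⟩
  exact ⟨φ, h1, fun χ hχ => h2 χ hχ.1.1 hχ⟩

theorem density_const_mul (V : Space d → ℝ) (β δ : ℝ) (φ : Space d → ℂ)
    (g : Fin d → Space d → ℂ) {c : ℂ} (hc : ‖c‖ = 1) :
    density V β δ (fun x => c * φ x) (fun i x => c * g i x) = density V β δ φ g := by
  have hin : ∀ z w : ℂ, inner ℝ (c * z) (c * w) = inner ℝ z w := fun z w => by
    have h : c.re * c.re + c.im * c.im = 1 := by
      rw [← Complex.normSq_apply, Complex.normSq_eq_norm_sq, hc, one_pow]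
    simp only [Complex.inner, map_mul, Complex.mul_re, Complex.conj_re, Complex.conj_im,
      Complex.mul_im]
    linear_combination (z.re * w.re + z.im * w.im) * h
  funext x
  simp only [density, rhoGrad, norm_mul, hc, one_mul, hin]

theorem IsGroundState.const_mul {V : Space d → ℝ} {β δ : ℝ} {φ : Space d → ℂ}
    (hφ : IsGroundState V β δ φ) {c : ℂ} (hc : ‖c‖ = 1) :
    IsGroundState V β δ fun x => c * φ x := by
  obtain ⟨g, hg⟩ := hφ.1.1.1.exists_isSobolev
  have hcg : IsSobolev (fun x => c * φ x) (fun i x => c * g i x) :=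
    hg.clm (ContinuousLinearMap.mul ℝ ℂ c)
  have hd := density_const_mul V β δ φ g hc
  refine ⟨?_, fun χ hχ => ?_⟩
  · have h := hφ.1
    rw [hg.mem_constraintSet_iff] at h
    rw [hcg.mem_constraintSet_iff, hd]
    simpa only [norm_mul, hc, one_mul] using h
  · rw [hcg.energy_eq, hd, ← hg.energy_eq]
    exact hφ.2 χ hχ

theorem IsGroundState.norm {V : Space d → ℝ} {β δ : ℝ} (hδ : 0 < δ) {φ : Space d → ℂ}
    (hφ : IsGroundState V β δ φ) : IsGroundState V β δ fun x => ((‖φ x‖ : ℝ) : ℂ) := by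
  obtain ⟨g, hg⟩ := hφ.1.1.1.exists_isSobolev
  have ha := hg.admissible hδ hφ.1
  obtain ⟨G, hG, hle⟩ := ha.norm β δ
  refine ⟨hG.mem_constraintSet β δ, fun χ hχ => ?_⟩
  rw [hG.energy_eq]
  exact (hle.trans_eq (ha.energy_eq β δ).symm).trans (hφ.2 χ hχ)

/-- For `β ≥ 0` both parts of the convexity defect are nonnegative. The difference of the densities
therefore has zero gradient and, being integrable, vanishes. -/
theorem IsGroundState.ae_eq (hd : 1 ≤ d) {V : Space d → ℝ} {β δ : ℝ} (hβ : 0 ≤ β) (hδ : 0 < δ)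
    {φ₁ φ₂ : Space d → ℂ} (h₁ : IsGroundState V β δ φ₁) (h₂ : IsGroundState V β δ φ₂)
    (hn₁ : IsNonneg Set.univ φ₁) (hn₂ : IsNonneg Set.univ φ₂) : ∀ᵐ x, φ₁ x = φ₂ x := by
  have h := sobolevClass_memH1.norm_ae_eq hδ (V := V) (β := β) (fun {ψ₁ ψ₂ r} a₁ a₂ hr hle => ?_)
    h₁.1.1.1 h₂.1.1.1 h₁.1 h₂.1 (fun χ _ => h₁.2 χ) fun χ _ => h₂.2 χ
  · rw [IsNonneg, Measure.restrict_univ] at hn₁ hn₂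
    filter_upwards [h, hn₁, hn₂] with x hx e₁ e₂
    rw [eq_norm_of_nonneg e₁, eq_norm_of_nonneg e₂, hx]
  · obtain ⟨g₁, a₁⟩ := a₁.exists_isSobolev
    obtain ⟨g₂, a₂⟩ := a₂.exists_isSobolev
    refine hr.integral_sq_eq_zero hd ((a₁.memLp.integrable_norm_pow two_ne_zero).sub
      (a₂.memLp.integrable_norm_pow two_ne_zero)) ?_
    have : 0 ≤ β * ∫ x, ‖‖ψ₁ x‖ ^ 2 - ‖ψ₂ x‖ ^ 2‖ ^ 2 :=
      mul_nonneg hβ (integral_nonneg fun _ => by positivity)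
    by_contra! hpos
    nlinarith

/-! ### Bounded domains -/

theorem ae_eq_zero_of_tendsto {Ω : Set (Space d)} (hΩ : MeasurableSet Ω) {f : Space d → E}
    (hf : MemLp f 2) {u : ℕ → Space d → E} (hu : ∀ n, ∀ x ∉ Ω, u n x = 0)
    (hlim : Tendsto (fun n => ∫⁻ x, ‖u n x - f x‖ₑ ^ 2) atTop (𝓝 0)) :
    ∀ᵐ x, x ∉ Ω → f x = 0 := by
  have h : ∫⁻ x in Ωᶜ, ‖f x‖ₑ ^ 2 = 0 := by
    refine le_antisymm (ge_of_tendsto' hlim fun n => ?_) zero_le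
    calc ∫⁻ x in Ωᶜ, ‖f x‖ₑ ^ 2 = ∫⁻ x in Ωᶜ, ‖u n x - f x‖ₑ ^ 2 :=
          setLIntegral_congr_fun hΩ.compl fun x hx => by simp [hu n x hx]
      _ ≤ _ := setLIntegral_le_lintegral _ _
  rw [lintegral_eq_zero_iff' (hf.1.restrict.enorm.pow_const 2), EventuallyEq,
    ae_restrict_iff' hΩ.compl] at h
  filter_upwards [h] with x hx hxΩ
  simpa using hx hxΩ

theorem IsTest.eq_zero {Ω : Set (Space d)} {u : Space d → E} (hu : IsTest Ω u) {x : Space d}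
    (hx : x ∉ Ω) : u x = 0 :=
  image_eq_zero_of_notMem_tsupport fun h => hx (hu.2.2 h)

theorem IsTest.classicalGrad_eq_zero {Ω : Set (Space d)} {u : Space d → E} (hu : IsTest Ω u)
    {x : Space d} (hx : x ∉ Ω) (i : Fin d) : classicalGrad u i x = 0 := by
  have : fderiv ℝ u x = 0 :=
    image_eq_zero_of_notMem_tsupport fun h => hx (hu.2.2 (tsupport_fderiv_subset ℝ h))
  rw [classicalGrad, this]
  rfl

/-- The boundary of `Ω` may have positive measure; vanishing of the function and of its gradient off
`Ω` is inherited directly from the test functions. -/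
theorem MemTestClosure.ae_eq_zero {Ω : Set (Space d)} (hΩ : MeasurableSet Ω) {f : Space d → E}
    {g : Fin d → Space d → E} (hf : MemTestClosure Ω f) (h : IsSobolev f g) :
    (∀ᵐ x, x ∉ Ω → f x = 0) ∧ ∀ i, ∀ᵐ x, x ∉ Ω → g i x = 0 := by
  obtain ⟨g', h', u, hu, h1, h2⟩ := hf
  refine ⟨ae_eq_zero_of_tendsto hΩ h.memLp (fun n x hx => (hu n).eq_zero hx) h1, fun i => ?_⟩
  have := ae_eq_zero_of_tendsto hΩ (h'.memLp_grad i)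
    (fun n x hx => (hu n).classicalGrad_eq_zero hx i) (h2 i)
  filter_upwards [this, h.ae_unique h' EventuallyEq.rfl i] with x hx e hxΩ
  rw [e, hx hxΩ]

theorem HasWeakPartial.restrict_congr {F : Type*} [NormedAddCommGroup F] [NormedSpace ℝ F]
    {Ω : Set (Space d)} (hΩ : IsOpen Ω) {f f' : Space d → F} {i : Fin d} {g : Space d → F}
    (h : HasWeakPartial Set.univ f i g) (hff' : ∀ x ∈ Ω, f' x = f x) :
    HasWeakPartial Ω f' i g := by
  refine ⟨fun x hx => ?_, h.2.1.mono_set (Set.subset_univ _), fun ψ h1 h2 h3 => ?_⟩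
  · obtain ⟨s, hs, hi⟩ := h.1 x (Set.mem_univ x)
    rw [nhdsWithin_univ] at hs
    obtain ⟨t, hts, hto, hxt⟩ := mem_nhds_iff.1 hs
    have hm : MeasurableSet (t ∩ Ω) := (hto.inter hΩ).measurableSet
    refine ⟨t ∩ Ω, inter_mem (mem_nhdsWithin_of_mem_nhds (hto.mem_nhds hxt)) self_mem_nhdsWithin,
      (hi.mono_set (Set.inter_subset_left.trans hts)).congr_fun (fun y hy => (hff' y hy.2).symm) hm⟩
  · have e1 : ∫ x in Ω, (fderiv ℝ ψ x (EuclideanSpace.single i 1)) • f' x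
        = ∫ x, (fderiv ℝ ψ x (EuclideanSpace.single i 1)) • f x := by
      rw [setIntegral_congr_fun (g := fun x => (fderiv ℝ ψ x (EuclideanSpace.single i 1)) • f x)
        hΩ.measurableSet fun x hx => by simp only [hff' x hx]]
      refine setIntegral_eq_integral_of_forall_compl_eq_zero fun x hx => ?_
      have := IsTest.classicalGrad_eq_zero (Ω := Ω) ⟨h1, h2, h3⟩ hx i
      rw [classicalGrad] at this
      rw [this, zero_smul]
    have e2 : ∫ x in Ω, ψ x • g x = ∫ x, ψ x • g x :=
      setIntegral_eq_integral_of_forall_compl_eq_zero fun x hx => by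
        rw [IsTest.eq_zero (Ω := Ω) ⟨h1, h2, h3⟩ hx, zero_smul]
    rw [e1, e2]
    simpa using h.2.2 ψ h1 h2 (Set.subset_univ _)

theorem memH10_of_memTestClosure {Ω : Set (Space d)} (hΩ : IsOpen Ω) {f φ : Space d → ℂ}
    (hf : MemTestClosure Ω f) (h : ∀ x ∈ Ω, φ x = f x) : MemH10 Ω φ := by
  obtain ⟨g, hg, u, hu, h1, h2⟩ := hf
  have hae : f =ᵐ[volume.restrict Ω] φ :=
    (ae_restrict_iff' hΩ.measurableSet).2 (Eventually.of_forall fun x hx => (h x hx).symm)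
  have hw : ∀ i, HasWeakPartial Ω φ i (g i) := fun i => (hg.hasWeakPartial i).restrict_congr hΩ h
  refine ⟨⟨(hg.memLp.restrict Ω).ae_eq hae, fun i => ⟨g i, hw i, (hg.memLp_grad i).restrict _⟩⟩,
    u, hu, ?_, fun i => ?_⟩
  · rw [tendsto_eLpNorm_two_zero_iff]
    refine tendsto_of_tendsto_of_tendsto_of_le_of_le tendsto_const_nhds h1 (fun _ => zero_le)
      fun n => ?_
    refine (lintegral_congr_ae ?_).trans_le (setLIntegral_le_lintegral Ω _)
    filter_upwards [hae] with x hx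
    rw [hx]
  · rw [tendsto_eLpNorm_two_zero_iff]
    refine tendsto_of_tendsto_of_tendsto_of_le_of_le tendsto_const_nhds (h2 i) (fun _ => zero_le)
      fun n => ?_
    refine (lintegral_congr_ae ?_).trans_le (setLIntegral_le_lintegral Ω _)
    filter_upwards [weakPartial_ae_eq hΩ (hw i)] with x hx
    rw [hx]
    rfl

/-- Extension by zero creates no singular gradient at the boundary: the approximating test functions
can be integrated by parts against any `ψ` on the whole space, and the identity passes to the limit.
-/
theorem memTestClosure_indicator {Ω : Set (Space d)} (hΩ : IsOpen Ω) {φ : Space d → ℂ}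
    (hφ : MemH10 Ω φ) : MemTestClosure Ω (Ω.indicator φ) := by
  obtain ⟨⟨h2, hg⟩, u, hu, hl, hlg⟩ := hφ
  have hm := hΩ.measurableSet
  have hu : ∀ n, IsTest Ω (u n) := hu
  have hw2 : ∀ i, MemLp (weakPartial Ω φ i) 2 (volume.restrict Ω) := fun i => by
    obtain ⟨g, hg1, hg2⟩ := hg i
    exact (memLp_congr_ae (weakPartial_ae_eq hΩ hg1)).2 hg2
  have key : ∀ {v : ℕ → Space d → ℂ} {w : Space d → ℂ}, (∀ n, ∀ x ∉ Ω, v n x = 0) →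
      Tendsto (fun n => eLpNorm (fun x => v n x - w x) 2 (volume.restrict Ω)) atTop (𝓝 0) →
      Tendsto (fun n => ∫⁻ x, ‖v n x - Ω.indicator w x‖ₑ ^ 2) atTop (𝓝 0) := by
    intro v w hv hvw
    rw [tendsto_eLpNorm_two_zero_iff] at hvw
    refine hvw.congr fun n => ?_
    rw [← lintegral_indicator hm]
    congr 1; ext x
    by_cases hx : x ∈ Ω
    · simp [hx]
    · simp [hx, hv n x hx]
  have l1 := key (fun n x hx => (hu n).eq_zero hx) hl
  have l2 : ∀ i, Tendsto (fun n => ∫⁻ x, ‖classicalGrad (u n) i x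
      - Ω.indicator (weakPartial Ω φ i) x‖ₑ ^ 2) atTop (𝓝 0) := fun i =>
    key (fun n x hx => (hu n).classicalGrad_eq_zero hx i) (hlg i)
  have m1 : MemLp (Ω.indicator φ) 2 := (memLp_indicator_iff_restrict hm).2 h2
  have m2 : ∀ i, MemLp (Ω.indicator (weakPartial Ω φ i)) 2 := fun i =>
    (memLp_indicator_iff_restrict hm).2 (hw2 i)
  refine ⟨fun i => Ω.indicator (weakPartial Ω φ i), ⟨m1, m2, fun i ψ h1 h2 => ?_⟩, u, hu, l1, l2⟩
  have t1 := tendsto_integral_smul_of_tendsto (memLp_of_continuous_hasCompactSupport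
    (continuous_fderiv_apply h1 (EuclideanSpace.single i 1)) (hasCompactSupport_fderiv_apply h2 _))
    (fun n => (hu n).isSobolev.memLp) m1 l1
  have t2 := tendsto_integral_smul_of_tendsto (memLp_of_continuous_hasCompactSupport h1.continuous
    h2) (fun n => (hu n).isSobolev.memLp_grad i) (m2 i) (l2 i)
  exact tendsto_nhds_unique t1 (t2.neg.congr fun n => ((hu n).isSobolev.integral_eq i ψ h1 h2).symm)

/-- The extension of a potential on `Ω` to a confining potential on the whole space. -/
def extPot (Ω : Set (Space d)) (V : Space d → ℝ) (x : Space d) : ℝ :=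
  Ω.indicator V x + Ωᶜ.indicator (fun x => ‖x‖) x

theorem extPot_of_mem {Ω : Set (Space d)} (V : Space d → ℝ) {x : Space d} (hx : x ∈ Ω) :
    extPot Ω V x = V x := by simp [extPot, hx]

theorem extPot_of_notMem {Ω : Set (Space d)} (V : Space d → ℝ) {x : Space d} (hx : x ∉ Ω) :
    extPot Ω V x = ‖x‖ := by simp [extPot, hx]

theorem extPot_nonneg {Ω : Set (Space d)} {V : Space d → ℝ} (hV : ∀ x ∈ Ω, 0 ≤ V x)
    (x : Space d) : 0 ≤ extPot Ω V x := by
  by_cases hx : x ∈ Ω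
  · rw [extPot_of_mem V hx]; exact hV x hx
  · rw [extPot_of_notMem V hx]; exact norm_nonneg x

theorem aestronglyMeasurable_extPot {Ω : Set (Space d)} (hΩ : MeasurableSet Ω) {V : Space d → ℝ}
    (hV : LocallyIntegrableOn V Ω) : AEStronglyMeasurable (extPot Ω V) :=
  ((aestronglyMeasurable_indicator_iff hΩ).2 hV.aestronglyMeasurable).add
    (continuous_norm.aestronglyMeasurable.indicator hΩ.compl)

theorem tendsto_extPot {Ω : Set (Space d)} (hΩ : Bornology.IsBounded Ω) (V : Space d → ℝ) :
    Tendsto (extPot Ω V) (cocompact (Space d)) atTop := by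
  refine (tendsto_norm_cocompact_atTop (E := Space d)).congr' ?_
  rw [← Metric.cobounded_eq_cocompact]
  filter_upwards [Bornology.isBounded_def.1 hΩ] with x hx
  exact (extPot_of_notMem V hx).symm

/-- The energy on `Ω` is the energy on the whole space. -/
theorem MemTestClosure.constraintSet_energy {Ω : Set (Space d)} (hΩ : IsOpen Ω)
    {f φ : Space d → ℂ} (hf : MemTestClosure Ω f) (h : ∀ x ∈ Ω, φ x = f x) (V : Space d → ℝ)
    (β δ : ℝ) : (φ ∈ constraintSet Ω V β δ ↔ f ∈ constraintSet Set.univ (extPot Ω V) β δ) ∧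
      energy Ω V β δ φ = energy Set.univ (extPot Ω V) β δ f := by
  have hm := hΩ.measurableSet
  obtain ⟨g, hg, -⟩ := id hf
  obtain ⟨z1, z2⟩ := hf.ae_eq_zero hm hg
  have d1 := gradSq_ae_eq hΩ fun i => (hg.hasWeakPartial i).restrict_congr hΩ h
  have d2 := gradSq_ae_eq hΩ fun i => (hg.hasWeakPartial_normSq i).restrict_congr hΩ
    (f' := fun x => ‖φ x‖ ^ 2) fun x hx => by rw [h x hx]
  rw [EventuallyEq, ae_restrict_iff' hm] at d1 d2
  -- Off `Ω` the function and its gradient vanish, so the value of the extended potential there does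
  -- not matter.
  have hdens : density (extPot Ω V) β δ f g =ᵐ[volume] Ω.indicator (energyDensity Ω V β δ φ) := by
    filter_upwards [z1, ae_all_iff.2 z2, d1, d2] with x e1 e2 e3 e4
    by_cases hx : x ∈ Ω
    · rw [Set.indicator_of_mem hx, energyDensity, e3 hx, e4 hx, density, extPot_of_mem V hx, h x hx]
      rfl
    · simp [density, rhoGrad, e1 hx, e2 _ hx, hx]
  have hpot : (fun x => extPot Ω V x * ‖f x‖ ^ 2) =ᵐ[volume]
      Ω.indicator fun x => V x * ‖φ x‖ ^ 2 := by
    filter_upwards [z1] with x e1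
    by_cases hx : x ∈ Ω
    · rw [Set.indicator_of_mem hx, extPot_of_mem V hx, h x hx]
    · simp [e1 hx, hx]
  have hmass : (fun x => ‖f x‖ ^ 2) =ᵐ[volume] Ω.indicator fun x => ‖φ x‖ ^ 2 := by
    filter_upwards [z1] with x e1
    by_cases hx : x ∈ Ω
    · rw [Set.indicator_of_mem hx, h x hx]
    · simp [e1 hx, hx]
  constructor
  · rw [hg.mem_constraintSet_iff, integrable_congr hpot, integrable_congr hdens,
      integral_congr_ae hmass, integrable_indicator_iff hm, integrable_indicator_iff hm,
      integral_indicator hm, constraintSet, Set.mem_ofPred_eq, MemX]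
    simp [(memH10_of_memTestClosure hΩ hf h).1]
  · rw [hg.energy_eq, integral_congr_ae hdens, integral_indicator hm, energy]

/-- Restriction to `Ω` and extension by zero match the competitors of the two problems, with equal
energies. -/
theorem isDirichletGroundState_iff {Ω : Set (Space d)} (hΩ : IsOpen Ω) {f φ : Space d → ℂ}
    (hf : MemTestClosure Ω f) (h : ∀ x ∈ Ω, φ x = f x) (V : Space d → ℝ) (β δ : ℝ) :
    IsDirichletGroundState Ω V β δ φ ↔ f ∈ constraintSet Set.univ (extPot Ω V) β δ ∧
      ∀ χ, MemTestClosure Ω χ → χ ∈ constraintSet Set.univ (extPot Ω V) β δ →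
        energy Set.univ (extPot Ω V) β δ f ≤ energy Set.univ (extPot Ω V) β δ χ := by
  have hφ := hf.constraintSet_energy hΩ h V β δ
  rw [IsDirichletGroundState, hφ.1, hφ.2]
  simp only [memH10_of_memTestClosure hΩ hf h, and_true]
  refine and_congr_right fun _ => ⟨fun hmin χ h1 h2 => ?_, fun hmin χ h1 h2 => ?_⟩
  · obtain ⟨e1, e2⟩ := h1.constraintSet_energy hΩ (fun _ _ => rfl) V β δ
    rw [← e2]
    exact hmin χ (e1.2 h2) (memH10_of_memTestClosure hΩ h1 fun _ _ => rfl)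
  · have h3 := memTestClosure_indicator hΩ h2
    obtain ⟨e1, e2⟩ := h3.constraintSet_energy hΩ
      (fun x hx => (Set.indicator_of_mem hx χ).symm) V β δ
    rw [e2]
    exact hmin _ h3 (e1.1 h1)

theorem exists_isDirichletGroundState {Ω : Set (Space d)} (hΩ : IsOpen Ω) (hne : Ω.Nonempty)
    (hb : Bornology.IsBounded Ω) {V : Space d → ℝ} (hV0 : ∀ x ∈ Ω, 0 ≤ V x)
    (hV : LocallyIntegrableOn V Ω) (β : ℝ) {δ : ℝ} (hδ : 0 < δ) :
    ∃ φ, IsDirichletGroundState Ω V β δ φ ∧ IsNonneg Ω φ := by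
  have hA := sobolevClass_memTestClosure (d := d) Ω
  obtain ⟨u, hu, hu1⟩ := exists_isTest_mass_eq_one hΩ hne
  have hua := hu.admissible hV hu1
  have hu2 : Admissible (extPot Ω V) u (classicalGrad u) := by
    refine ⟨hua.isSobolev, hua.integrable_pot.congr (Eventually.of_forall fun x => ?_), hu1,
      hua.isSobolev_sq⟩
    by_cases hx : x ∈ Ω
    · simp only [extPot_of_mem V hx]
    · simp [hu.eq_zero hx]
  obtain ⟨f, ⟨hfA, hfS⟩, hmin⟩ := hA.exists_minimizer (extPot_nonneg hV0)
    (aestronglyMeasurable_extPot hΩ.measurableSet hV) (tendsto_extPot hb V) β hδ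
    ⟨u, hu.memTestClosure, hu2.mem_constraintSet β δ⟩
  obtain ⟨g, hg⟩ := hA.exists_grad hfA
  have ha := hg.admissible hδ hfS
  obtain ⟨G, hG, hle⟩ := ha.norm β δ
  have hN : MemTestClosure Ω fun x => ((‖f x‖ : ℝ) : ℂ) := by
    have := hA.mean hfA hfA
    rwa [show (fun x => ((√((‖f x‖ ^ 2 + ‖f x‖ ^ 2) / 2) : ℝ) : ℂ))
      = fun x => ((‖f x‖ : ℝ) : ℂ) from funext (rootMean_self f)] at this
  refine ⟨_, (isDirichletGroundState_iff hΩ hN (fun _ _ => rfl) V β δ).2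
    ⟨hG.mem_constraintSet β δ, fun χ h1 h2 => ?_⟩,
    Eventually.of_forall fun x => ⟨by simp, by simp⟩⟩
  rw [hG.energy_eq]
  exact (hle.trans_eq (ha.energy_eq β δ).symm).trans (hmin χ h1 h2)

theorem IsDirichletGroundState.ae_eq {Ω : Set (Space d)} (hΩ : IsOpen Ω) {C : ℝ} (hC : 0 < C)
    (hP : ∀ (u : Space d → ℝ) (g : Fin d → Space d → ℝ), IsSobolev u g → Integrable u →
      (∀ᵐ x, x ∉ Ω → u x = 0) → ∫ x, ‖u x‖ ^ 2 ≤ C * gradInt g) {V : Space d → ℝ} {β δ : ℝ}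
    (hδ : 0 < δ) (hβ : -δ / C < β) {φ₁ φ₂ : Space d → ℂ} (h₁ : IsDirichletGroundState Ω V β δ φ₁)
    (h₂ : IsDirichletGroundState Ω V β δ φ₂) (hn₁ : IsNonneg Ω φ₁) (hn₂ : IsNonneg Ω φ₂) :
    ∀ᵐ x ∂(volume.restrict Ω), φ₁ x = φ₂ x := by
  have m₁ := memTestClosure_indicator hΩ h₁.1.2
  have m₂ := memTestClosure_indicator hΩ h₂.1.2
  rw [isDirichletGroundState_iff hΩ m₁ fun x hx => (Set.indicator_of_mem hx φ₁).symm] at h₁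
  rw [isDirichletGroundState_iff hΩ m₂ fun x hx => (Set.indicator_of_mem hx φ₂).symm] at h₂
  have h := (sobolevClass_memTestClosure Ω).norm_ae_eq hδ (fun {ψ₁ ψ₂ r} a₁ a₂ hr hle => ?_)
    m₁ m₂ h₁.1 h₂.1 h₁.2 h₂.2
  · filter_upwards [ae_restrict_of_ae h, ae_restrict_mem hΩ.measurableSet, hn₁, hn₂]
      with x hx hxΩ e₁ e₂
    rw [Set.indicator_of_mem hxΩ, Set.indicator_of_mem hxΩ] at hx
    rw [eq_norm_of_nonneg e₁, eq_norm_of_nonneg e₂, hx]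
  · obtain ⟨g₁, b₁, -⟩ := id a₁
    obtain ⟨g₂, b₂, -⟩ := id a₂
    have hp := hP _ _ hr ((b₁.memLp.integrable_norm_pow two_ne_zero).sub
      (b₂.memLp.integrable_norm_pow two_ne_zero)) (by
        filter_upwards [(a₁.ae_eq_zero hΩ.measurableSet b₁).1,
          (a₂.ae_eq_zero hΩ.measurableSet b₂).1] with x e₁ e₂ hx
        simp [e₁ hx, e₂ hx])
    have h0 : 0 ≤ ∫ x, ‖‖ψ₁ x‖ ^ 2 - ‖ψ₂ x‖ ^ 2‖ ^ 2 := integral_nonneg fun _ => by positivity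
    -- This is the threshold `β > -δ/C`. Multiplying the defect inequality by `C` and inserting
    -- Poincaré gives `(β C + δ) ∫ (ρ₁ - ρ₂)² ≤ 0`.
    have hβ' : 0 < β * C + δ := by
      rw [div_lt_iff₀ hC] at hβ
      linarith
    by_contra hne
    have hpos := lt_of_le_of_ne h0 (Ne.symm hne)
    nlinarith [mul_pos hβ' hpos, mul_le_mul_of_nonneg_left hp hδ.le,
      mul_le_mul_of_nonneg_left hle hC.le]

end MGPE

end

/-! ### Assembly of the whole-space and bounded-domain results -/

theorem mainTheorem1 (d : ℕ) (hd1 : 1 ≤ d) (hd3 : d ≤ 3) :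
    -- the problem on the whole space with a confining potential
    (∀ (V : MGPE.Space d → ℝ) (β δ : ℝ), δ ≠ 0 → (∀ x, 0 ≤ V x) → LocallyIntegrable V →
      Tendsto V (cocompact (MGPE.Space d)) atTop →
        ((∃ φ, MGPE.IsGroundState V β δ φ) ↔ 0 < δ) ∧
        (∀ φ, MGPE.IsGroundState V β δ φ → ∀ θ : ℝ,
          MGPE.IsGroundState V β δ (fun x => Complex.exp (θ * Complex.I) * φ x)) ∧
        (∀ φ, MGPE.IsGroundState V β δ φ →
          MGPE.IsGroundState V β δ (fun x => ((‖φ x‖ : ℝ) : ℂ))) ∧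
        (0 ≤ β → ∀ φ₁ φ₂, MGPE.IsGroundState V β δ φ₁ → MGPE.IsGroundState V β δ φ₂ →
          MGPE.IsNonneg Set.univ φ₁ → MGPE.IsNonneg Set.univ φ₂ → ∀ᵐ x, φ₁ x = φ₂ x)) ∧
    -- the problem on a bounded domain with zero Dirichlet boundary conditions
    (∀ Ω : Set (MGPE.Space d), IsOpen Ω → IsConnected Ω → Bornology.IsBounded Ω →
      ∃ C : ℝ, 0 < C ∧ ∀ (V : MGPE.Space d → ℝ) (β δ : ℝ), 0 < δ → -δ / C < β →
        (∀ x ∈ Ω, 0 ≤ V x) → LocallyIntegrableOn V Ω →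
          (∃ φ, MGPE.IsDirichletGroundState Ω V β δ φ ∧ MGPE.IsNonneg Ω φ) ∧
          ∀ φ₁ φ₂, MGPE.IsDirichletGroundState Ω V β δ φ₁ →
            MGPE.IsDirichletGroundState Ω V β δ φ₂ → MGPE.IsNonneg Ω φ₁ → MGPE.IsNonneg Ω φ₂ →
              ∀ᵐ x ∂(volume.restrict Ω), φ₁ x = φ₂ x) := by
  refine ⟨fun V β δ hδ hV0 hV hVc => ⟨⟨?_, ?_⟩, ?_, ?_, ?_⟩, fun Ω hΩ hc hb => ?_⟩
  · rintro ⟨φ, hφ⟩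
    exact hφ.pos hd1 hV0 hV hδ
  · exact MGPE.exists_isGroundState hV0 hV hVc β
  · exact fun φ hφ θ => hφ.const_mul (Complex.norm_exp_ofReal_mul_I θ)
  · exact fun φ hφ => hφ.norm (hφ.pos hd1 hV0 hV hδ)
  · exact fun hβ φ₁ φ₂ h₁ h₂ => h₁.ae_eq hd1 hβ (h₁.pos hd1 hV0 hV hδ) h₂
  -- `C` is the Poincaré constant, fixed before `V`, `β` and `δ` are introduced.
  · obtain ⟨C, hC, hP⟩ := MGPE.exists_poincare hd1 hΩ.measurableSet hb.measure_lt_top.ne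
    exact ⟨C, hC, fun V β δ hδ hβ hV0 hV =>
      ⟨MGPE.exists_isDirichletGroundState hΩ hc.nonempty hb hV0 hV β hδ,
        fun φ₁ φ₂ h₁ h₂ => h₁.ae_eq hΩ hC hP hδ hβ h₂⟩⟩
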